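/- \textbf{Setting.} The finite types are $0$ (natural numbers) and, with $\rho,\tau$, the type $\rho\to\tau$; write $1$ for $0\to0$ (sets are identified with characteristic functions). The language $\mathcal L(\widehat{\mathsf{E}\text{-}\mathsf{HA}}{}^\omega_{\upharpoonright})$ has variables of all finite types, the constants $0$, successor, $+$, $\cdot$, the combinators $\Pi_{\rho,\tau}$, $\Sigma_{\delta,\rho,\tau}$, the recursor $R_0$ for primitive recursion of type $0$, application, the prime formulas $s=_0t$ (for terms of type $0$) and $\bot$, and $\land,\lor,\to,\forall,\exists$; equality of higher type is defined pointwise and $\lnot A$ is $A\to\bot$. The theory $\widehat{\mathsf{E}\text{-}\mathsf{HA}}{}^\omega_{\upharpoonright}$ is based on intuitionistic logic and has the equality axioms for $=_0$, the extensionality scheme $\forall x^\rho\forall y^\rho\forall z^{\rho\to\tau}(x=_\rho y\to z(x)=_\tau z(y))$, the usual axioms for $0$, successor, $+$, $\cdot$, the defining equations of $\Pi,\Sigma,R_0$, and induction for quantifier-free formulas. A formula is $\exists$-free if it is built from prime formulas with $\land,\to,\forall$ only. $\mathsf{AC}$ is the scheme $\forall x\,\exists y\,A(x,y)\to\exists Y\,\forall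 x\,A(x,Y(x))$ for all formulas $A$ and all finite types. $\mathsf{IP}^\omega_{\mathrm{ef}}$ is the scheme $(A\to\exists x\,B(x))\to\exists x\,(A\to B(x))$ for $x$ of any finite type and $A$ an $\exists$-free formula not containing $x$. Let $I_0=\widehat{\mathsf{E}\text{-}\mathsf{HA}}{}^\omega_{\upharpoonright}+\mathsf{AC}+\mathsf{IP}^\omega_{\mathrm{ef}}$. $\Gamma_1$ is the least class of formulas that contains the prime formulas, is closed under $\land,\lor,\forall,\exists$, and contains $(\exists x_1\cdots\exists x_k\,A)\to B$ whenever $k\ge0$, $A$ is $\exists$-free and $B\in\Gamma_1$. $\mathsf{QF\text{-}AC}^{\rho,\tau}$ is $\mathsf{AC}$ restricted to quantifier-free $A$, $x$ of type $\rho$ and $y$ of type $\tau$. $\mathsf{RCA}_0^\omega$ is $\widehat{\mathsf{E}\text{-}\mathsf{HA}}{}^\omega_{\upharpoonright}+\mathsf{QF\text{-}AC}^{1,0}$ plus the law of the excluded middle. $\mathcal L(\mathsf{RCA}_0)$ consists of the formulas in which all variables have type $0$ or $1$, and $\mathsf{RCA}_0$ is the restriction of $\widehat{\mathsf{E}\text{-}\mathsf{HA}}{}^\omega_{\upharpoonright}$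 to this language (with axioms taken in the form in which arbitrary terms of the language replace the universally quantified variables) plus $\mathsf{QF\text{-}AC}^{0,0}$ and the law of the excluded middle. \textbf{Theorem.} Let $\forall x^\rho\,\exists y^\tau A(x,y)$ be a sentence of $\mathcal L(\widehat{\mathsf{E}\text{-}\mathsf{HA}}{}^\omega_{\upharpoonright})$ in $\Gamma_1$, where $\rho,\tau$ are arbitrary finite types. If \[ I_0\vdash\forall x\,\exists y\,A(x,y), \] then \[ \mathsf{RCA}_0^\omega\vdash\forall\langle x_n\mid n\in\mathbb N\rangle\,\exists\langle y_n\mid n\in\mathbb N\rangle\,\forall n\,A(x_n,y_n), \] where sequences are objects of type $0\to\rho$ and $0\to\tau$. Furthermore, if $\rho=\tau=1$ and $\forall x\,\exists y\,A(x,y)$ is a sentence of $\mathcal L(\mathsf{RCA}_0)$, then the same implication holds with $\mathsf{RCA}_0$ in place of $\mathsf{RCA}_0^\omega$, where a sequence $\langle x_n\rangle$ of type $1$ objects is coded by one type $1$ object $X$ through $x_n=\lambda m.\,X((n,m))$ with the pairing $(n,m)=(n+m)^2+n$. -/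

import Mathlib

namespace FiniteType

/-! ### Types, terms and formulas of arithmetic in all finite types -/

/-- The finite types: `nat` is the type `0` of natural numbers, `arr ρ τ` is `ρ → τ`. -/
inductive Ty : Type
  | nat : Ty
  | arr : Ty → Ty → Ty

/-- The type `1 = 0 → 0` of number-theoretic functions (and of sets, given by their
characteristic functions). -/
abbrev Ty.one : Ty := Ty.arr Ty.nat Ty.nat

/-- Typed de Bruijn variables: `Var Γ σ` is the set of variables of type `σ` in the list `Γ` of
the types of the free variables (the most recently bound variable comes first). -/
inductive Var : List Ty → Ty → Type
  | zero {Γ : List Ty} {σ : Ty} : Var (σ :: Γ) σ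
  | succ {Γ : List Ty} {σ τ : Ty} : Var Γ σ → Var (τ :: Γ) σ

/-- Terms: variables, `0`, successor, addition, multiplication, the projectors `Π_{ρ,τ}`
(`proj`), the substitution combinators `Σ_{δ,ρ,τ}` (`comb`), the recursor `R₀` of type `0`
(`recr`), and application. -/
inductive Tm (Γ : List Ty) : Ty → Type
  | var {σ : Ty} : Var Γ σ → Tm Γ σ
  | zero : Tm Γ Ty.nat
  | succ : Tm Γ (Ty.arr Ty.nat Ty.nat)
  | add : Tm Γ (Ty.arr Ty.nat (Ty.arr Ty.nat Ty.nat))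
  | mul : Tm Γ (Ty.arr Ty.nat (Ty.arr Ty.nat Ty.nat))
  | proj (ρ τ : Ty) : Tm Γ (Ty.arr ρ (Ty.arr τ ρ))
  | comb (δ ρ τ : Ty) :
      Tm Γ (Ty.arr (Ty.arr δ (Ty.arr ρ τ)) (Ty.arr (Ty.arr δ ρ) (Ty.arr δ τ)))
  | recr : Tm Γ (Ty.arr Ty.nat (Ty.arr Ty.nat
      (Ty.arr (Ty.arr Ty.nat (Ty.arr Ty.nat Ty.nat)) Ty.nat)))
  | app {σ τ : Ty} : Tm Γ (Ty.arr σ τ) → Tm Γ σ → Tm Γ τ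

/-- Substitutions of terms over `Δ` for the variables of `Γ`. -/
abbrev Sub (Γ Δ : List Ty) : Type := ∀ σ : Ty, Var Γ σ → Tm Δ σ

/-- The substitution that regards each variable of `Γ` as a variable of `σ :: Γ`. -/
def Sub.shift (Γ : List Ty) (σ : Ty) : Sub Γ (σ :: Γ) := fun _ v => Tm.var (Var.succ v)

/-- Extend a substitution by a term for the most recent variable. -/
def Sub.cons {Γ Δ : List Ty} {ρ : Ty} (s : Sub Γ Δ) (t : Tm Δ ρ) : Sub (ρ :: Γ) Δ
  | _, Var.zero => t
  | _, Var.succ v => s _ v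

/-- The substitution with empty domain. -/
def Sub.nil (Δ : List Ty) : Sub [] Δ := fun _ v => nomatch v

/-- Simultaneous substitution in terms. -/
def Tm.subst {Γ Δ : List Ty} (s : Sub Γ Δ) : {σ : Ty} → Tm Γ σ → Tm Δ σ
  | _, Tm.var v => s _ v
  | _, Tm.zero => Tm.zero
  | _, Tm.succ => Tm.succ
  | _, Tm.add => Tm.add
  | _, Tm.mul => Tm.mul
  | _, Tm.proj ρ τ => Tm.proj ρ τ
  | _, Tm.comb δ ρ τ => Tm.comb δ ρ τ
  | _, Tm.recr => Tm.recr
  | _, Tm.app f a => Tm.app (f.subst s) (a.subst s)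

/-- Weakening of a term by a variable of type `ρ`. -/
def Tm.weaken {Γ : List Ty} {σ : Ty} (ρ : Ty) (t : Tm Γ σ) : Tm (ρ :: Γ) σ :=
  t.subst (Sub.shift Γ ρ)

/-- Extend a substitution under a binder. -/
def Sub.lift {Γ Δ : List Ty} (s : Sub Γ Δ) (ρ : Ty) : Sub (ρ :: Γ) (ρ :: Δ) :=
  Sub.cons (fun σ v => (s σ v).weaken ρ) (Tm.var Var.zero)

/-- The variable bound last, the one before it, and the third-last one, as terms. -/
abbrev Tm.v0 {Γ : List Ty} {σ : Ty} : Tm (σ :: Γ) σ := Tm.var Var.zero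
abbrev Tm.v1 {Γ : List Ty} {ρ σ : Ty} : Tm (ρ :: σ :: Γ) σ := Tm.var (Var.succ Var.zero)
abbrev Tm.v2 {Γ : List Ty} {δ ρ σ : Ty} : Tm (δ :: ρ :: σ :: Γ) σ :=
  Tm.var (Var.succ (Var.succ Var.zero))

/-- `λ`-abstraction of the most recent variable, defined from the combinators:
`λx.x = ΣΠΠ`, `λx.c = Πc` if `c` is a constant or another variable, and
`λx.fa = Σ(λx.f)(λx.a)`. -/
def Tm.lam {Γ : List Ty} {σ : Ty} : {τ : Ty} → Tm (σ :: Γ) τ → Tm Γ (Ty.arr σ τ)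
  | _, Tm.var Var.zero =>
      Tm.app (Tm.app (Tm.comb σ (Ty.arr σ σ) σ) (Tm.proj σ (Ty.arr σ σ))) (Tm.proj σ σ)
  | _, Tm.var (Var.succ v) => Tm.app (Tm.proj _ σ) (Tm.var v)
  | _, Tm.zero => Tm.app (Tm.proj _ σ) Tm.zero
  | _, Tm.succ => Tm.app (Tm.proj _ σ) Tm.succ
  | _, Tm.add => Tm.app (Tm.proj _ σ) Tm.add
  | _, Tm.mul => Tm.app (Tm.proj _ σ) Tm.mul
  | _, Tm.proj ρ τ => Tm.app (Tm.proj _ σ) (Tm.proj ρ τ)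
  | _, Tm.comb δ ρ τ => Tm.app (Tm.proj _ σ) (Tm.comb δ ρ τ)
  | _, Tm.recr => Tm.app (Tm.proj _ σ) Tm.recr
  | _, Tm.app f a => Tm.app (Tm.app (Tm.comb σ _ _) f.lam) a.lam

/-- `s + t`, `s · t` and `S t`. -/
def Tm.plus {Γ : List Ty} (s t : Tm Γ Ty.nat) : Tm Γ Ty.nat := Tm.app (Tm.app Tm.add s) t
def Tm.times {Γ : List Ty} (s t : Tm Γ Ty.nat) : Tm Γ Ty.nat := Tm.app (Tm.app Tm.mul s) t
def Tm.suc {Γ : List Ty} (t : Tm Γ Ty.nat) : Tm Γ Ty.nat := Tm.app Tm.succ t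

/-- `R₀ n y z`. -/
def Tm.rec0 {Γ : List Ty} (n y : Tm Γ Ty.nat)
    (z : Tm Γ (Ty.arr Ty.nat (Ty.arr Ty.nat Ty.nat))) : Tm Γ Ty.nat :=
  Tm.app (Tm.app (Tm.app Tm.recr n) y) z

/-- The number pairing of second order arithmetic, `(m, n) = (m + n)² + m`. -/
def Tm.pair {Γ : List Ty} (m n : Tm Γ Ty.nat) : Tm Γ Ty.nat :=
  ((m.plus n).times (m.plus n)).plus m

/-- Lists of arguments that bring a term of the given type down to type `0`. -/
inductive Args (Γ : List Ty) : Ty → Type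
  | nil : Args Γ Ty.nat
  | cons {σ τ : Ty} : Tm Γ σ → Args Γ τ → Args Γ (Ty.arr σ τ)

/-- `t u₁ … u_k`. -/
def Tm.applyArgs {Γ : List Ty} : {τ : Ty} → Tm Γ τ → Args Γ τ → Tm Γ Ty.nat
  | _, t, Args.nil => t
  | _, t, Args.cons u us => (Tm.app t u).applyArgs us

/-- Formulas over `Γ` in which all bound variables have a type in `V`. Prime formulas are the
equations of type `0` and `⊥`. Negation is an abbreviation. -/
inductive Fm (V : Ty → Prop) : List Ty → Type
  | eq {Γ : List Ty} : Tm Γ Ty.nat → Tm Γ Ty.nat → Fm V Γ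
  | bot {Γ : List Ty} : Fm V Γ
  | and {Γ : List Ty} : Fm V Γ → Fm V Γ → Fm V Γ
  | or {Γ : List Ty} : Fm V Γ → Fm V Γ → Fm V Γ
  | imp {Γ : List Ty} : Fm V Γ → Fm V Γ → Fm V Γ
  | all {Γ : List Ty} {σ : Ty} : V σ → Fm V (σ :: Γ) → Fm V Γ
  | ex {Γ : List Ty} {σ : Ty} : V σ → Fm V (σ :: Γ) → Fm V Γ

/-- All finite types are allowed for variables: the language of arithmetic in all finite types. -/
def AnyType : Ty → Prop := fun _ => True

/-- Only the types `0` and `1` are allowed for variables: the second order language. -/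
def SecondOrder : Ty → Prop := fun σ => σ = Ty.nat ∨ σ = Ty.one

theorem anyType (σ : Ty) : AnyType σ := trivial
theorem secondOrder_nat : SecondOrder Ty.nat := Or.inl rfl
theorem secondOrder_one : SecondOrder Ty.one := Or.inr rfl

namespace Fm

variable {V W : Ty → Prop}

def neg {Γ : List Ty} (A : Fm V Γ) : Fm V Γ := imp A bot

/-- Simultaneous (capture-avoiding) substitution in formulas. -/
def subst : {Γ Δ : List Ty} → Sub Γ Δ → Fm V Γ → Fm V Δ
  | _, _, s, eq a b => eq (a.subst s) (b.subst s)
  | _, _, _, bot => bot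
  | _, _, s, and A B => and (A.subst s) (B.subst s)
  | _, _, s, or A B => or (A.subst s) (B.subst s)
  | _, _, s, imp A B => imp (A.subst s) (B.subst s)
  | _, _, s, all h A => all h (A.subst (s.lift _))
  | _, _, s, ex h A => ex h (A.subst (s.lift _))

/-- Weakening of a formula by a variable of type `ρ`. -/
def weaken {Γ : List Ty} (ρ : Ty) (A : Fm V Γ) : Fm V (ρ :: Γ) := A.subst (Sub.shift Γ ρ)

/-- `A(t)`: substitution for the most recent variable. -/
def inst {Γ : List Ty} {σ : Ty} (A : Fm V (σ :: Γ)) (t : Tm Γ σ) : Fm V Γ :=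
  A.subst (Sub.cons (fun _ v => Tm.var v) t)

/-- A formula with variables of fewer types, read in a larger language. -/
def mono (h : ∀ σ, V σ → W σ) : {Γ : List Ty} → Fm V Γ → Fm W Γ
  | _, eq a b => eq a b
  | _, bot => bot
  | _, and A B => and (A.mono h) (B.mono h)
  | _, or A B => or (A.mono h) (B.mono h)
  | _, imp A B => imp (A.mono h) (B.mono h)
  | _, all hσ A => all (h _ hσ) (A.mono h)
  | _, ex hσ A => ex (h _ hσ) (A.mono h)

/-- Quantifier-free formulas. -/
def QFree : {Γ : List Ty} → Fm V Γ → Prop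
  | _, eq _ _ => True
  | _, bot => True
  | _, and A B => A.QFree ∧ B.QFree
  | _, or A B => A.QFree ∧ B.QFree
  | _, imp A B => A.QFree ∧ B.QFree
  | _, all _ _ => False
  | _, ex _ _ => False

/-- `∃`-free formulas: built from prime formulas by `∧`, `→` and `∀`. -/
def ExFree : {Γ : List Ty} → Fm V Γ → Prop
  | _, eq _ _ => True
  | _, bot => True
  | _, and A B => A.ExFree ∧ B.ExFree
  | _, or _ _ => False
  | _, imp A B => A.ExFree ∧ B.ExFree
  | _, all _ A => A.ExFree
  | _, ex _ _ => False

/-- Formulas `∃x₁ … ∃x_k A` with `A` an `∃`-free formula and `k ≥ 0`. -/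
def ExBlock : {Γ : List Ty} → Fm V Γ → Prop
  | _, ex _ A => A.ExBlock
  | _, A => A.ExFree

/-- The class `Γ₁`: it contains the prime formulas, is closed under `∧`, `∨`, `∀`, `∃`, and
contains `∃x₁ … ∃x_k A → B` for `A` an `∃`-free formula and `B` in `Γ₁`. -/
def Gamma1 : {Γ : List Ty} → Fm V Γ → Prop
  | _, eq _ _ => True
  | _, bot => True
  | _, and A B => A.Gamma1 ∧ B.Gamma1
  | _, or A B => A.Gamma1 ∧ B.Gamma1
  | _, imp A B => A.ExBlock ∧ B.Gamma1
  | _, all _ A => A.Gamma1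
  | _, ex _ A => A.Gamma1

end Fm

/-- All argument types of the given type are in `V`. -/
def ArgsIn (V : Ty → Prop) : Ty → Prop
  | Ty.nat => True
  | Ty.arr σ τ => V σ ∧ ArgsIn V τ

/-- Pointwise equality `s =_τ t` of higher type. It is a formula of the language with variables
of types in `V` when all argument types of `τ` are in `V`. -/
def Fm.eqAt {V : Ty → Prop} : {Γ : List Ty} → (τ : Ty) → ArgsIn V τ → Tm Γ τ → Tm Γ τ → Fm V Γ
  | _, Ty.nat, _, s, t => Fm.eq s t
  | _, Ty.arr σ τ, h, s, t =>
      Fm.all h.1 (Fm.eqAt τ h.2 (Tm.app (s.weaken σ) Tm.v0) (Tm.app (t.weaken σ) Tm.v0))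

/-! ### Derivations -/

/-- A set of axioms: formulas with free variables, read as universally quantified. -/
abbrev Theory (V : Ty → Prop) : Type := ∀ Γ : List Ty, Set (Fm V Γ)

/-- Natural deduction for many-sorted intuitionistic predicate logic, with axioms `T`:
`Der T Γ Δ A` says that `A` is derivable from the assumptions `Δ`, where all free variables are
among `Γ`. -/
inductive Der {V : Ty → Prop} (T : Theory V) :
    (Γ : List Ty) → List (Fm V Γ) → Fm V Γ → Prop
  | ax {Γ : List Ty} {Δ : List (Fm V Γ)} {A : Fm V Γ} : A ∈ T Γ → Der T Γ Δ A
  | hyp {Γ : List Ty} {Δ : List (Fm V Γ)} {A : Fm V Γ} : A ∈ Δ → Der T Γ Δ A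
  | botE {Γ : List Ty} {Δ : List (Fm V Γ)} {A : Fm V Γ} : Der T Γ Δ Fm.bot → Der T Γ Δ A
  | andI {Γ : List Ty} {Δ : List (Fm V Γ)} {A B : Fm V Γ} :
      Der T Γ Δ A → Der T Γ Δ B → Der T Γ Δ (Fm.and A B)
  | andE1 {Γ : List Ty} {Δ : List (Fm V Γ)} {A B : Fm V Γ} :
      Der T Γ Δ (Fm.and A B) → Der T Γ Δ A
  | andE2 {Γ : List Ty} {Δ : List (Fm V Γ)} {A B : Fm V Γ} :
      Der T Γ Δ (Fm.and A B) → Der T Γ Δ B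
  | orI1 {Γ : List Ty} {Δ : List (Fm V Γ)} {A B : Fm V Γ} :
      Der T Γ Δ A → Der T Γ Δ (Fm.or A B)
  | orI2 {Γ : List Ty} {Δ : List (Fm V Γ)} {A B : Fm V Γ} :
      Der T Γ Δ B → Der T Γ Δ (Fm.or A B)
  | orE {Γ : List Ty} {Δ : List (Fm V Γ)} {A B C : Fm V Γ} :
      Der T Γ Δ (Fm.or A B) → Der T Γ (A :: Δ) C → Der T Γ (B :: Δ) C → Der T Γ Δ C
  | impI {Γ : List Ty} {Δ : List (Fm V Γ)} {A B : Fm V Γ} :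
      Der T Γ (A :: Δ) B → Der T Γ Δ (Fm.imp A B)
  | impE {Γ : List Ty} {Δ : List (Fm V Γ)} {A B : Fm V Γ} :
      Der T Γ Δ (Fm.imp A B) → Der T Γ Δ A → Der T Γ Δ B
  | allI {Γ : List Ty} {Δ : List (Fm V Γ)} {σ : Ty} (h : V σ) {A : Fm V (σ :: Γ)} :
      Der T (σ :: Γ) (Δ.map (Fm.weaken σ)) A → Der T Γ Δ (Fm.all h A)
  | allE {Γ : List Ty} {Δ : List (Fm V Γ)} {σ : Ty} {h : V σ} {A : Fm V (σ :: Γ)}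
      (t : Tm Γ σ) : Der T Γ Δ (Fm.all h A) → Der T Γ Δ (A.inst t)
  | exI {Γ : List Ty} {Δ : List (Fm V Γ)} {σ : Ty} (h : V σ) {A : Fm V (σ :: Γ)}
      (t : Tm Γ σ) : Der T Γ Δ (A.inst t) → Der T Γ Δ (Fm.ex h A)
  | exE {Γ : List Ty} {Δ : List (Fm V Γ)} {σ : Ty} {h : V σ} {A : Fm V (σ :: Γ)}
      {B : Fm V Γ} : Der T Γ Δ (Fm.ex h A) →
      Der T (σ :: Γ) (A :: Δ.map (Fm.weaken σ)) (B.weaken σ) → Der T Γ Δ B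

/-- The sentence `A` is provable from the axioms `T`. -/
def Provable {V : Ty → Prop} (T : Theory V) (A : Fm V []) : Prop := Der T [] [] A

/-! ### Axioms -/

/-- The axioms of extensional Heyting arithmetic in the finite types with primitive recursion of
type `0` and quantifier-free induction, in the language with variables of types in `V`.
Each axiom is given with arbitrary terms in place of its universally quantified variables. The
axioms for the combinators are the equations `Π s t = s` and `Σ r s t = r t (s t)`, where equality
is pointwise, hence applied to arbitrary arguments that bring both sides down to type `0`. -/
inductive HA (V : Ty → Prop) : (Γ : List Ty) → Fm V Γ → Prop
  | eq_refl {Γ : List Ty} (s : Tm Γ Ty.nat) : HA V Γ (Fm.eq s s)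
  | eq_symm {Γ : List Ty} (s t : Tm Γ Ty.nat) : HA V Γ (Fm.imp (Fm.eq s t) (Fm.eq t s))
  | eq_trans {Γ : List Ty} (r s t : Tm Γ Ty.nat) :
      HA V Γ (Fm.imp (Fm.and (Fm.eq r s) (Fm.eq s t)) (Fm.eq r t))
  /-- The extensionality scheme. -/
  | ext {Γ : List Ty} {ρ τ : Ty} (hρ : ArgsIn V ρ) (hτ : ArgsIn V τ)
      (s t : Tm Γ ρ) (r : Tm Γ (Ty.arr ρ τ)) :
      HA V Γ (Fm.imp (Fm.eqAt ρ hρ s t) (Fm.eqAt τ hτ (Tm.app r s) (Tm.app r t)))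
  | succ_ne_zero {Γ : List Ty} (s : Tm Γ Ty.nat) : HA V Γ (Fm.neg (Fm.eq s.suc Tm.zero))
  | succ_inj {Γ : List Ty} (s t : Tm Γ Ty.nat) :
      HA V Γ (Fm.imp (Fm.eq s.suc t.suc) (Fm.eq s t))
  | add_zero {Γ : List Ty} (s : Tm Γ Ty.nat) : HA V Γ (Fm.eq (s.plus Tm.zero) s)
  | add_succ {Γ : List Ty} (s t : Tm Γ Ty.nat) :
      HA V Γ (Fm.eq (s.plus t.suc) (s.plus t).suc)
  | mul_zero {Γ : List Ty} (s : Tm Γ Ty.nat) : HA V Γ (Fm.eq (s.times Tm.zero) Tm.zero)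
  | mul_succ {Γ : List Ty} (s t : Tm Γ Ty.nat) :
      HA V Γ (Fm.eq (s.times t.suc) ((s.times t).plus s))
  | proj {Γ : List Ty} {ρ τ : Ty} (s : Tm Γ ρ) (t : Tm Γ τ) (u : Args Γ ρ) :
      HA V Γ (Fm.eq ((Tm.app (Tm.app (Tm.proj ρ τ) s) t).applyArgs u) (s.applyArgs u))
  | comb {Γ : List Ty} {δ ρ τ : Ty} (r : Tm Γ (Ty.arr δ (Ty.arr ρ τ))) (s : Tm Γ (Ty.arr δ ρ))
      (t : Tm Γ δ) (u : Args Γ τ) :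
      HA V Γ (Fm.eq ((Tm.app (Tm.app (Tm.app (Tm.comb δ ρ τ) r) s) t).applyArgs u)
        ((Tm.app (Tm.app r t) (Tm.app s t)).applyArgs u))
  | rec_zero {Γ : List Ty} (y : Tm Γ Ty.nat) (z : Tm Γ (Ty.arr Ty.nat (Ty.arr Ty.nat Ty.nat))) :
      HA V Γ (Fm.eq (Tm.rec0 Tm.zero y z) y)
  | rec_succ {Γ : List Ty} (n y : Tm Γ Ty.nat)
      (z : Tm Γ (Ty.arr Ty.nat (Ty.arr Ty.nat Ty.nat))) :
      HA V Γ (Fm.eq (Tm.rec0 n.suc y z) (Tm.app (Tm.app z (Tm.rec0 n y z)) n))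
  /-- Induction `A(0) ∧ ∀n (A(n) → A(n+1)) → ∀n A(n)` for quantifier-free formulas. -/
  | induction {Γ : List Ty} (h : V Ty.nat) (A : Fm V (Ty.nat :: Γ)) (hA : A.QFree) :
      HA V Γ (Fm.imp
        (Fm.and (A.inst Tm.zero)
          (Fm.all h (Fm.imp A (A.subst (Sub.cons (Sub.shift Γ Ty.nat) Tm.v0.suc)))))
        (Fm.all h A))

/-- For `A(x, y)` with the variables `x : ρ`, `y : τ` in this order, the formula `A(x, Y(x))`
with the variables `Y : ρ → τ`, `x : ρ` in this order. -/
def Fm.choiceInst {V : Ty → Prop} {Γ : List Ty} {ρ τ : Ty} (A : Fm V (τ :: ρ :: Γ)) :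
    Fm V (ρ :: Ty.arr ρ τ :: Γ) :=
  A.subst (Sub.cons (Sub.cons (fun _ v => Tm.var (Var.succ (Var.succ v))) Tm.v0)
    (Tm.app Tm.v1 Tm.v0))

/-- The axiom of choice `∀x ∃y A(x,y) → ∃Y ∀x A(x,Y(x))` in all finite types. -/
inductive AC (V : Ty → Prop) : (Γ : List Ty) → Fm V Γ → Prop
  | mk {Γ : List Ty} {ρ τ : Ty} (hρ : V ρ) (hτ : V τ) (hY : V (Ty.arr ρ τ))
      (A : Fm V (τ :: ρ :: Γ)) :
      AC V Γ (Fm.imp (Fm.all hρ (Fm.ex hτ A)) (Fm.ex hY (Fm.all hρ A.choiceInst)))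

/-- The axiom of choice for quantifier-free formulas, `x` of type `ρ` and `y` of type `τ`. -/
inductive QFAC (V : Ty → Prop) (ρ τ : Ty) : (Γ : List Ty) → Fm V Γ → Prop
  | mk {Γ : List Ty} (hρ : V ρ) (hτ : V τ) (hY : V (Ty.arr ρ τ))
      (A : Fm V (τ :: ρ :: Γ)) (hA : A.QFree) :
      QFAC V ρ τ Γ (Fm.imp (Fm.all hρ (Fm.ex hτ A)) (Fm.ex hY (Fm.all hρ A.choiceInst)))

/-- Independence of premise `(A → ∃x B(x)) → ∃x (A → B(x))` for `∃`-free `A` without `x`. -/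
inductive IPef (V : Ty → Prop) : (Γ : List Ty) → Fm V Γ → Prop
  | mk {Γ : List Ty} {σ : Ty} (h : V σ) (A : Fm V Γ) (hA : A.ExFree) (B : Fm V (σ :: Γ)) :
      IPef V Γ (Fm.imp (Fm.imp A (Fm.ex h B)) (Fm.ex h (Fm.imp (A.weaken σ) B)))

/-- The law of the excluded middle. -/
inductive LEM (V : Ty → Prop) : (Γ : List Ty) → Fm V Γ → Prop
  | mk {Γ : List Ty} (A : Fm V Γ) : LEM V Γ (Fm.or A A.neg)

/-- The intuitionistic system `I₀`: extensional Heyting arithmetic in all finite types with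
restricted recursion and induction, plus choice and independence of premise. -/
def I0 : Theory AnyType := fun Γ => {A | HA AnyType Γ A ∨ AC AnyType Γ A ∨ IPef AnyType Γ A}

/-- The classical system `RCA₀^ω`. -/
def RCA0omega : Theory AnyType :=
  fun Γ => {A | HA AnyType Γ A ∨ QFAC AnyType Ty.one Ty.nat Γ A ∨ LEM AnyType Γ A}

/-- The classical second order system `RCA₀` (in its version with functions). -/
def RCA0 : Theory SecondOrder :=
  fun Γ => {A | HA SecondOrder Γ A ∨ QFAC SecondOrder Ty.nat Ty.nat Γ A ∨ LEM SecondOrder Γ A}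

/-! ### Sequential forms -/

/-- The sentence `∀x^ρ ∃y^τ A(x,y)`. -/
def allEx {ρ τ : Ty} (A : Fm AnyType [τ, ρ]) : Fm AnyType [] :=
  Fm.all (anyType ρ) (Fm.ex (anyType τ) A)

/-- `∀⟨xₙ⟩ ∃⟨yₙ⟩ ∀n A(xₙ, yₙ)`, where sequences are objects of type `0 → ρ` and `0 → τ`. -/
def seqForm {ρ τ : Ty} (A : Fm AnyType [τ, ρ]) : Fm AnyType [] :=
  Fm.all (anyType (Ty.arr Ty.nat ρ)) (Fm.ex (anyType (Ty.arr Ty.nat τ)) (Fm.all (anyType Ty.nat)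
    (A.subst (Sub.cons (Sub.cons (Sub.nil _) (Tm.app Tm.v2 Tm.v0)) (Tm.app Tm.v1 Tm.v0)))))

/-- The `n`-th member `λm. X((n, m))` of the sequence of functions (sets) coded by `X`. -/
def Tm.row {Γ : List Ty} (X : Tm Γ Ty.one) (n : Tm Γ Ty.nat) : Tm Γ Ty.one :=
  Tm.lam (Tm.app (X.weaken Ty.nat) (Tm.pair (n.weaken Ty.nat) Tm.v0))

/-- The sentence `∀x¹ ∃y¹ A(x,y)` of the second order language. -/
def allEx2 (A : Fm SecondOrder [Ty.one, Ty.one]) : Fm SecondOrder [] :=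
  Fm.all secondOrder_one (Fm.ex secondOrder_one A)

/-- `∀⟨xₙ⟩ ∃⟨yₙ⟩ ∀n A(xₙ, yₙ)` in the second order language, where a sequence of functions (sets)
is coded by a single one. -/
def seqForm2 (A : Fm SecondOrder [Ty.one, Ty.one]) : Fm SecondOrder [] :=
  Fm.all secondOrder_one (Fm.ex secondOrder_one (Fm.all secondOrder_nat
    (A.subst (Sub.cons (Sub.cons (Sub.nil _) (Tm.row Tm.v2 Tm.v0)) (Tm.row Tm.v1 Tm.v0)))))

/-- A formula of the second order language, read in the language of all finite types. -/
def Fm.toAny {Γ : List Ty} (A : Fm SecondOrder Γ) : Fm AnyType Γ := A.mono fun σ _ => anyType σ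

end FiniteType

namespace FiniteType

/-! ### Substitution -/

theorem Tm.subst_subst {Γ Δ Θ : List Ty} (s : Sub Γ Δ) (r : Sub Δ Θ) {σ : Ty} (t : Tm Γ σ) :
    (t.subst s).subst r = t.subst (fun σ v => (s σ v).subst r) := by
  induction t with
  | app f a hf ha => simp only [Tm.subst, hf, ha]
  | _ => rfl

theorem Tm.subst_var {Γ : List Ty} {σ : Ty} (t : Tm Γ σ) :
    t.subst (fun _ v => Tm.var v) = t := by
  induction t with
  | app f a hf ha => simp only [Tm.subst, hf, ha]
  | _ => rfl

theorem Sub.lift_comp {Γ Δ Θ : List Ty} (s : Sub Γ Δ) (r : Sub Δ Θ) (ρ : Ty) :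
    (fun σ v => (s.lift ρ σ v).subst (r.lift ρ)) =
      Sub.lift (fun σ v => (s σ v).subst r) ρ := by
  funext σ v
  cases v with
  | zero => rfl
  | succ v =>
    change ((s _ v).weaken ρ).subst (r.lift ρ) = ((s _ v).subst r).weaken ρ
    rw [Tm.weaken, Tm.weaken, Tm.subst_subst, Tm.subst_subst]
    rfl

theorem Sub.lift_var (Γ : List Ty) (ρ : Ty) :
    Sub.lift (fun σ (v : Var Γ σ) => Tm.var v) ρ = fun _ v => Tm.var v := by
  funext σ v
  cases v <;> rfl

theorem Fm.subst_subst {V : Ty → Prop} {Γ : List Ty} (A : Fm V Γ) :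
    ∀ {Δ Θ : List Ty} (s : Sub Γ Δ) (r : Sub Δ Θ),
      (A.subst s).subst r = A.subst (fun σ v => (s σ v).subst r) := by
  induction A with
  | eq a b => intros; simp only [Fm.subst, Tm.subst_subst]
  | bot => intros; rfl
  | and A B hA hB => intros; simp only [Fm.subst, hA, hB]
  | or A B hA hB => intros; simp only [Fm.subst, hA, hB]
  | imp A B hA hB => intros; simp only [Fm.subst, hA, hB]
  | all h A hA => intros; simp only [Fm.subst, hA, Sub.lift_comp]
  | ex h A hA => intros; simp only [Fm.subst, hA, Sub.lift_comp]

theorem Fm.subst_var {V : Ty → Prop} {Γ : List Ty} (A : Fm V Γ) :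
    A.subst (fun _ v => Tm.var v) = A := by
  induction A with
  | eq a b => simp only [Fm.subst, Tm.subst_var]
  | bot => rfl
  | and A B hA hB => simp only [Fm.subst, hA, hB]
  | or A B hA hB => simp only [Fm.subst, hA, hB]
  | imp A B hA hB => simp only [Fm.subst, hA, hB]
  | all h A hA => simp only [Fm.subst, Sub.lift_var, hA]
  | ex h A hA => simp only [Fm.subst, Sub.lift_var, hA]

theorem Tm.weaken_subst_lift {Γ Δ : List Ty} {σ ρ : Ty} (t : Tm Γ σ) (s : Sub Γ Δ) :
    (t.weaken ρ).subst (s.lift ρ) = (t.subst s).weaken ρ := by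
  rw [Tm.weaken, Tm.weaken, Tm.subst_subst, Tm.subst_subst]
  rfl

theorem Fm.eqAt_subst {V : Ty → Prop} (τ : Ty) : ∀ {Γ Δ : List Ty} (h : ArgsIn V τ)
    (s t : Tm Γ τ) (r : Sub Γ Δ),
    (Fm.eqAt τ h s t).subst r = Fm.eqAt τ h (s.subst r) (t.subst r) := by
  induction τ with
  | nat => intros; rfl
  | arr σ τ _ ih =>
    intro Γ Δ h s t r
    simp only [Fm.eqAt, Fm.subst, ih, Tm.subst, Tm.weaken_subst_lift]
    rfl

/-! ### Applicative structures -/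

/-- The data of a structure for the language of arithmetic in all finite types. The objects of
type `0` are only preinterpreted: `val` maps them to the actual numbers of the structure. -/
structure Str where
  D : Ty → Type
  N : Type
  val : D Ty.nat → N
  app : {σ τ : Ty} → D (Ty.arr σ τ) → D σ → D τ
  zero : D Ty.nat
  succ : D (Ty.arr Ty.nat Ty.nat)
  add : D (Ty.arr Ty.nat (Ty.arr Ty.nat Ty.nat))
  mul : D (Ty.arr Ty.nat (Ty.arr Ty.nat Ty.nat))
  proj : (ρ τ : Ty) → D (Ty.arr ρ (Ty.arr τ ρ))
  comb : (δ ρ τ : Ty) → D (Ty.arr (Ty.arr δ (Ty.arr ρ τ)) (Ty.arr (Ty.arr δ ρ) (Ty.arr δ τ)))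
  recr : D (Ty.arr Ty.nat (Ty.arr Ty.nat (Ty.arr (Ty.arr Ty.nat (Ty.arr Ty.nat Ty.nat)) Ty.nat)))

namespace Str

/-- Pointwise equality. -/
def E (M : Str) : (σ : Ty) → M.D σ → M.D σ → Prop
  | Ty.nat, a, b => M.val a = M.val b
  | Ty.arr σ τ, f, g => ∀ a : M.D σ, M.E τ (M.app f a) (M.app g a)

/-- The laws of arithmetic in all finite types, with extensionality for the types allowed by `V`
and induction for disjunctions of two equations between functions of the structure. -/
structure IsModel (V : Ty → Prop) (M : Str) : Prop where
  val_surj : Function.Surjective M.val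
  ext : ∀ {ρ τ : Ty}, ArgsIn V ρ → ArgsIn V τ → ∀ (s t : M.D ρ) (r : M.D (Ty.arr ρ τ)),
    M.E ρ s t → M.E τ (M.app r s) (M.app r t)
  succ_ne_zero : ∀ a, M.val (M.app M.succ a) ≠ M.val M.zero
  succ_inj : ∀ a b, M.val (M.app M.succ a) = M.val (M.app M.succ b) → M.val a = M.val b
  add_zero : ∀ a, M.val (M.app (M.app M.add a) M.zero) = M.val a
  add_succ : ∀ a b, M.val (M.app (M.app M.add a) (M.app M.succ b)) =
    M.val (M.app M.succ (M.app (M.app M.add a) b))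
  mul_zero : ∀ a, M.val (M.app (M.app M.mul a) M.zero) = M.val M.zero
  mul_succ : ∀ a b, M.val (M.app (M.app M.mul a) (M.app M.succ b)) =
    M.val (M.app (M.app M.add (M.app (M.app M.mul a) b)) a)
  proj_eq : ∀ {ρ τ : Ty} (s : M.D ρ) (t : M.D τ),
    M.E ρ (M.app (M.app (M.proj ρ τ) s) t) s
  comb_eq : ∀ {δ ρ τ : Ty} (r : M.D (Ty.arr δ (Ty.arr ρ τ))) (s : M.D (Ty.arr δ ρ)) (t : M.D δ),
    M.E τ (M.app (M.app (M.app (M.comb δ ρ τ) r) s) t) (M.app (M.app r t) (M.app s t))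
  rec_zero : ∀ y z, M.val (M.app (M.app (M.app M.recr M.zero) y) z) = M.val y
  rec_succ : ∀ n y z, M.val (M.app (M.app (M.app M.recr (M.app M.succ n)) y) z) =
    M.val (M.app (M.app z (M.app (M.app (M.app M.recr n) y) z)) n)
  ind : ∀ f g f' g' : M.D Ty.one,
    (M.val (M.app f M.zero) = M.val (M.app g M.zero) ∨
      M.val (M.app f' M.zero) = M.val (M.app g' M.zero)) →
    (∀ a, (M.val (M.app f a) = M.val (M.app g a) ∨ M.val (M.app f' a) = M.val (M.app g' a)) →
      (M.val (M.app f (M.app M.succ a)) = M.val (M.app g (M.app M.succ a)) ∨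
        M.val (M.app f' (M.app M.succ a)) = M.val (M.app g' (M.app M.succ a)))) →
    ∀ a, M.val (M.app f a) = M.val (M.app g a) ∨ M.val (M.app f' a) = M.val (M.app g' a)

/-- Environments: objects for the variables of `Γ`. -/
abbrev Env (M : Str) (Γ : List Ty) : Type := ∀ σ : Ty, Var Γ σ → M.D σ

def Env.nil (M : Str) : M.Env [] := fun _ v => nomatch v

def Env.cons {M : Str} {Γ : List Ty} {ρ : Ty} (e : M.Env Γ) (d : M.D ρ) : M.Env (ρ :: Γ)
  | _, Var.zero => d
  | _, Var.succ v => e _ v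

def Env.tail {M : Str} {Γ : List Ty} {ρ : Ty} (e : M.Env (ρ :: Γ)) : M.Env Γ :=
  fun _ v => e _ (Var.succ v)

def Env.head {M : Str} {Γ : List Ty} {ρ : Ty} (e : M.Env (ρ :: Γ)) : M.D ρ := e _ Var.zero

@[simp] theorem Env.cons_zero {M : Str} {Γ : List Ty} {ρ : Ty} (e : M.Env Γ) (d : M.D ρ) :
    e.cons d ρ Var.zero = d := rfl

@[simp] theorem Env.cons_succ {M : Str} {Γ : List Ty} {ρ σ : Ty} (e : M.Env Γ) (d : M.D ρ)
    (v : Var Γ σ) : e.cons d σ (Var.succ v) = e σ v := rfl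

@[simp] theorem Env.tail_cons {M : Str} {Γ : List Ty} {ρ : Ty} (e : M.Env Γ) (d : M.D ρ) :
    (e.cons d).tail = e := rfl

@[simp] theorem Env.cons_head_tail {M : Str} {Γ : List Ty} {ρ : Ty} (e : M.Env (ρ :: Γ)) :
    e.tail.cons e.head = e := by
  funext σ v
  cases v <;> rfl

theorem Env.eq_nil {M : Str} (e : M.Env []) : e = Env.nil M := by
  funext σ v
  cases v

/-- The value of a term. -/
def eval (M : Str) {Γ : List Ty} (e : M.Env Γ) : {σ : Ty} → Tm Γ σ → M.D σ
  | _, Tm.var v => e _ v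
  | _, Tm.zero => M.zero
  | _, Tm.succ => M.succ
  | _, Tm.add => M.add
  | _, Tm.mul => M.mul
  | _, Tm.proj ρ τ => M.proj ρ τ
  | _, Tm.comb δ ρ τ => M.comb δ ρ τ
  | _, Tm.recr => M.recr
  | _, Tm.app f a => M.app (M.eval e f) (M.eval e a)

/-- The environment that a substitution induces. -/
def Env.sub {M : Str} {Γ Δ : List Ty} (e : M.Env Δ) (s : Sub Γ Δ) : M.Env Γ :=
  fun σ v => M.eval e (s σ v)

theorem eval_subst (M : Str) {Γ Δ : List Ty} (s : Sub Γ Δ) (e : M.Env Δ) {σ : Ty}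
    (t : Tm Γ σ) : M.eval e (t.subst s) = M.eval (e.sub s) t := by
  induction t with
  | app f a hf ha => simp only [Tm.subst, eval, hf, ha]
  | _ => rfl

theorem eval_weaken (M : Str) {Γ : List Ty} {ρ σ : Ty} (e : M.Env (ρ :: Γ)) (t : Tm Γ σ) :
    M.eval e (t.weaken ρ) = M.eval e.tail t :=
  M.eval_subst _ _ _

theorem Env.sub_lift {M : Str} {Γ Δ : List Ty} {ρ : Ty} (s : Sub Γ Δ) (e : M.Env Δ)
    (d : M.D ρ) : (e.cons d).sub (s.lift ρ) = (e.sub s).cons d := by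
  funext σ v
  cases v with
  | zero => rfl
  | succ v => exact M.eval_weaken _ _

theorem Env.sub_cons {M : Str} {Γ Δ : List Ty} {ρ : Ty} (s : Sub Γ Δ) (t : Tm Δ ρ)
    (e : M.Env Δ) : e.sub (s.cons t) = (e.sub s).cons (M.eval e t) := by
  funext σ v
  cases v <;> rfl

@[simp] theorem Env.sub_var {M : Str} {Γ : List Ty} (e : M.Env Γ) :
    e.sub (fun _ v => Tm.var v) = e := rfl

/-- Truth of a formula. -/
def Sat (M : Str) {V : Ty → Prop} : {Γ : List Ty} → M.Env Γ → Fm V Γ → Prop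
  | _, e, Fm.eq a b => M.val (M.eval e a) = M.val (M.eval e b)
  | _, _, Fm.bot => False
  | _, e, Fm.and A B => M.Sat e A ∧ M.Sat e B
  | _, e, Fm.or A B => M.Sat e A ∨ M.Sat e B
  | _, e, Fm.imp A B => M.Sat e A → M.Sat e B
  | _, e, Fm.all (σ := σ) _ A => ∀ d : M.D σ, M.Sat (e.cons d) A
  | _, e, Fm.ex (σ := σ) _ A => ∃ d : M.D σ, M.Sat (e.cons d) A

theorem sat_subst (M : Str) {V : Ty → Prop} {Γ : List Ty} (A : Fm V Γ) :
    ∀ {Δ : List Ty} (s : Sub Γ Δ) (e : M.Env Δ), M.Sat e (A.subst s) ↔ M.Sat (e.sub s) A := by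
  induction A with
  | eq a b => intros; simp only [Fm.subst, Sat, eval_subst]
  | bot => intros; rfl
  | and A B hA hB => intros; simp only [Fm.subst, Sat, hA, hB]
  | or A B hA hB => intros; simp only [Fm.subst, Sat, hA, hB]
  | imp A B hA hB => intros; simp only [Fm.subst, Sat, hA, hB]
  | all h A hA => intros; simp only [Fm.subst, Sat, hA, Env.sub_lift]
  | ex h A hA => intros; simp only [Fm.subst, Sat, hA, Env.sub_lift]

theorem sat_eqAt (M : Str) {V : Ty → Prop} (τ : Ty) : ∀ {Γ : List Ty} (h : ArgsIn V τ)
    (e : M.Env Γ) (s t : Tm Γ τ),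
    M.Sat e (Fm.eqAt τ h s t) ↔ M.E τ (M.eval e s) (M.eval e t) := by
  induction τ with
  | nat => intros; rfl
  | arr σ τ _ ih =>
    intro Γ h e s t
    simp only [Fm.eqAt, Sat, ih, eval, eval_weaken, Env.tail_cons, E, Env.cons_zero]

theorem E.refl {M : Str} : ∀ {σ : Ty} (a : M.D σ), M.E σ a a
  | Ty.nat, _ => rfl
  | Ty.arr _ _, f => fun a => E.refl (M.app f a)

theorem E.symm {M : Str} : ∀ {σ : Ty} {a b : M.D σ}, M.E σ a b → M.E σ b a
  | Ty.nat, _, _, h => Eq.symm h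
  | Ty.arr _ _, _, _, h => fun a => E.symm (h a)

theorem E.trans {M : Str} : ∀ {σ : Ty} {a b c : M.D σ}, M.E σ a b → M.E σ b c → M.E σ a c
  | Ty.nat, _, _, _, h, h' => Eq.trans h h'
  | Ty.arr _ _, _, _, _, h, h' => fun a => E.trans (h a) (h' a)

end Str

end FiniteType

namespace FiniteType

/-! ### Primitive recursive arithmetic -/

/-- Numbers with classes `F1`, `F2` of unary and binary functions that are closed under composition
and primitive recursion and for which induction for disjunctions of two equations holds. -/
class Arith (N : Type) where
  o : N
  s : N → N
  plus : N → N → N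
  times : N → N → N
  F1 : (N → N) → Prop
  F2 : (N → N → N) → Prop
  s_ne : ∀ x, s x ≠ o
  s_inj : ∀ x y, s x = s y → x = y
  plus_o : ∀ x, plus x o = x
  plus_s : ∀ x y, plus x (s y) = s (plus x y)
  times_o : ∀ x, times x o = o
  times_s : ∀ x y, times x (s y) = plus (times x y) x
  F1_id : F1 fun x => x
  F1_const : ∀ c, F1 fun _ => c
  F1_s : F1 s
  F2_plus : F2 plus
  F2_times : F2 times
  F2_fst : F2 fun x _ => x
  F2_snd : F2 fun _ y => y
  F1_comp2 : ∀ {h f g}, F2 h → F1 f → F1 g → F1 fun x => h (f x) (g x)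
  F2_comp1 : ∀ {f g}, F1 f → F2 g → F2 fun x y => f (g x y)
  F2_comp2 : ∀ {h f g}, F2 h → F2 f → F2 g → F2 fun x y => h (f x y) (g x y)
  F2_rec : ∀ {h}, F2 h → ∃ R, F2 R ∧ (∀ y, R o y = y) ∧ ∀ n y, R (s n) y = h (R n y) n
  ind_or : ∀ {f g f' g'}, F1 f → F1 g → F1 f' → F1 g' → (f o = g o ∨ f' o = g' o) →
    (∀ x, (f x = g x ∨ f' x = g' x) → (f (s x) = g (s x) ∨ f' (s x) = g' (s x))) →
    ∀ x, f x = g x ∨ f' x = g' x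

namespace Arith

variable {N : Type} [Arith N]

theorem F1_comp1 {f g : N → N} (hf : F1 f) (hg : F1 g) : F1 fun x => f (g x) :=
  F1_comp2 (F2_comp1 hf F2_fst) hg hg

theorem F1_plus {f g : N → N} (hf : F1 f) (hg : F1 g) : F1 fun x => plus (f x) (g x) :=
  F1_comp2 F2_plus hf hg

theorem F1_times {f g : N → N} (hf : F1 f) (hg : F1 g) : F1 fun x => times (f x) (g x) :=
  F1_comp2 F2_times hf hg

theorem F1_succ {f : N → N} (hf : F1 f) : F1 fun x => s (f x) :=
  F1_comp1 F1_s hf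

theorem ind {f g : N → N} (hf : F1 f) (hg : F1 g) (h0 : f o = g o)
    (h : ∀ x, f x = g x → f (s x) = g (s x)) (x : N) : f x = g x :=
  or_self_iff.1 (ind_or hf hg hf hg (Or.inl h0) (fun x hx => Or.inl (h x (or_self_iff.1 hx))) x)

theorem o_plus (x : N) : plus o x = x :=
  ind (F1_plus (F1_const o) F1_id) F1_id (plus_o o) (fun x h => by rw [plus_s, h]) x

theorem s_plus (x y : N) : plus (s x) y = s (plus x y) :=
  ind (F1_plus (F1_const (s x)) F1_id) (F1_succ (F1_plus (F1_const x) F1_id))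
    (by simp only [plus_o]) (fun y h => by simp only [plus_s, h]) y

theorem plus_comm (x y : N) : plus x y = plus y x :=
  ind (F1_plus (F1_const x) F1_id) (F1_plus F1_id (F1_const x))
    (by simp only [plus_o, o_plus]) (fun y h => by simp only [plus_s, s_plus, h]) y

theorem plus_assoc (x y z : N) : plus (plus x y) z = plus x (plus y z) :=
  ind (F1_plus (F1_const (plus x y)) F1_id) (F1_plus (F1_const x) (F1_plus (F1_const y) F1_id))
    (by simp only [plus_o]) (fun y h => by simp only [plus_s, h]) z

theorem o_times (x : N) : times o x = o :=
  ind (F1_times (F1_const o) F1_id) (F1_const o) (times_o o)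
    (fun x h => by rw [times_s, h, plus_o]) x

theorem s_times (x y : N) : times (s x) y = plus (times x y) y :=
  ind (F1_times (F1_const (s x)) F1_id) (F1_plus (F1_times (F1_const x) F1_id) F1_id)
    (by simp only [times_o, plus_o])
    (fun y h => by
      simp only [times_s, h, plus_s, plus_assoc]
      rw [plus_comm y x]) y

theorem times_comm (x y : N) : times x y = times y x :=
  ind (F1_times (F1_const x) F1_id) (F1_times F1_id (F1_const x))
    (by simp only [times_o, o_times]) (fun y h => by simp only [times_s, s_times, h]) y

theorem times_plus (x y z : N) : times x (plus y z) = plus (times x y) (times x z) :=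
  ind (F1_times (F1_const x) (F1_plus (F1_const y) F1_id))
    (F1_plus (F1_const (times x y)) (F1_times (F1_const x) F1_id))
    (by simp only [times_o, plus_o])
    (fun z h => by simp only [plus_s, times_s, h, plus_assoc]) z

theorem times_assoc (x y z : N) : times (times x y) z = times x (times y z) :=
  ind (F1_times (F1_const (times x y)) F1_id)
    (F1_times (F1_const x) (F1_times (F1_const y) F1_id))
    (by simp only [times_o])
    (fun z h => by simp only [times_s, h, times_plus]) z

theorem times_one (x : N) : times x (s o) = x := by rw [times_s, times_o, o_plus]

noncomputable instance : CommSemiring N where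
  add := plus
  add_assoc := plus_assoc
  zero := o
  zero_add := o_plus
  add_zero := plus_o
  nsmul := @nsmulRec N ⟨o⟩ ⟨plus⟩
  npow := @npowRec N ⟨s o⟩ ⟨times⟩
  add_comm := plus_comm
  mul := times
  left_distrib := times_plus
  right_distrib x y z := by
    change times (plus x y) z = plus (times x z) (times y z)
    rw [times_comm, times_plus, times_comm z x, times_comm z y]
  zero_mul := o_times
  mul_zero := times_o
  mul_assoc := times_assoc
  one := s o
  one_mul x := (times_comm _ _).trans (times_one x)
  mul_one := times_one
  mul_comm := times_comm

theorem s_eq (x : N) : s x = x + 1 := by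
  change s x = plus x (s o)
  rw [plus_s, plus_o]

theorem add_one_ne_zero (x : N) : x + 1 ≠ 0 := by
  rw [← s_eq]
  exact s_ne x

theorem add_one_inj {x y : N} (h : x + 1 = y + 1) : x = y := by
  rw [← s_eq, ← s_eq] at h
  exact s_inj _ _ h

theorem induct {f g : N → N} (hf : F1 f) (hg : F1 g) (h0 : f 0 = g 0)
    (h : ∀ x, f x = g x → f (x + 1) = g (x + 1)) (x : N) : f x = g x :=
  ind hf hg h0 (fun x hx => by rw [s_eq]; exact h x hx) x

theorem F1_add {f g : N → N} (hf : F1 f) (hg : F1 g) : F1 fun x => f x + g x := F1_plus hf hg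

theorem F1_mul {f g : N → N} (hf : F1 f) (hg : F1 g) : F1 fun x => f x * g x := F1_times hf hg

theorem F2_const (c : N) : F2 fun _ _ : N => c := F2_comp1 (F1_const c) F2_fst

theorem F2_add {f g : N → N → N} (hf : F2 f) (hg : F2 g) : F2 fun x y => f x y + g x y :=
  F2_comp2 F2_plus hf hg

theorem F2_mul {f g : N → N → N} (hf : F2 f) (hg : F2 g) : F2 fun x y => f x y * g x y :=
  F2_comp2 F2_times hf hg

theorem F2_left {f : N → N → N} (hf : F2 f) (y : N) : F1 fun x => f x y :=
  F1_comp2 hf F1_id (F1_const y)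

theorem exists_rec {h : N → N → N} (hh : F2 h) :
    ∃ R : N → N → N, F2 R ∧ (∀ y, R 0 y = y) ∧ ∀ n y, R (n + 1) y = h (R n y) n := by
  obtain ⟨R, h1, h2, h3⟩ := F2_rec hh
  exact ⟨R, h1, h2, fun n y => by rw [← s_eq, h3]⟩

theorem exists_pred : ∃ p : N → N, F1 p ∧ p 0 = 0 ∧ ∀ x, p (x + 1) = x := by
  obtain ⟨R, h1, h2, h3⟩ := exists_rec (N := N) F2_snd
  exact ⟨fun x => R x 0, F2_left h1 0, h2 0, fun x => h3 x 0⟩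

/-- The predecessor. -/
noncomputable def pred : N → N := exists_pred.choose

theorem F1_pred : F1 (pred : N → N) := exists_pred.choose_spec.1
@[simp] theorem pred_zero : pred (0 : N) = 0 := exists_pred.choose_spec.2.1
@[simp] theorem pred_add_one (x : N) : pred (x + 1) = x := exists_pred.choose_spec.2.2 x

theorem exists_monus : ∃ d : N → N → N, F2 d ∧ (∀ x, d x 0 = x) ∧
    ∀ x y, d x (y + 1) = pred (d x y) := by
  obtain ⟨R, h1, h2, h3⟩ := exists_rec (N := N) (F2_comp1 F1_pred F2_fst)
  exact ⟨fun x y => R y x, F2_comp2 h1 F2_snd F2_fst, h2, fun x y => h3 y x⟩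

/-- Truncated subtraction. -/
noncomputable def monus : N → N → N := exists_monus.choose

theorem F2_monus : F2 (monus : N → N → N) := exists_monus.choose_spec.1
@[simp] theorem monus_zero (x : N) : monus x 0 = x := exists_monus.choose_spec.2.1 x
theorem monus_add_one (x y : N) : monus x (y + 1) = pred (monus x y) :=
  exists_monus.choose_spec.2.2 x y

theorem F1_monus' {f g : N → N} (hf : F1 f) (hg : F1 g) : F1 fun x => monus (f x) (g x) :=
  F1_comp2 F2_monus hf hg

theorem F2_monus' {f g : N → N → N} (hf : F2 f) (hg : F2 g) :
    F2 fun x y => monus (f x y) (g x y) :=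
  F2_comp2 F2_monus hf hg

@[simp] theorem monus_succ_succ (x y : N) : monus (x + 1) (y + 1) = monus x y :=
  induct (F1_monus' (F1_const (x + 1)) (F1_add F1_id (F1_const 1)))
    (F1_monus' (F1_const x) F1_id)
    (by rw [monus_add_one, monus_zero, monus_zero, pred_add_one])
    (fun y h => by rw [monus_add_one, h, monus_add_one]) y

@[simp] theorem monus_self (x : N) : monus x x = 0 :=
  induct (F1_monus' F1_id F1_id) (F1_const 0) (by simp) (fun x h => by simp [h]) x

@[simp] theorem zero_monus (x : N) : monus 0 x = 0 :=
  induct (F1_monus' (F1_const 0) F1_id) (F1_const 0) (by simp)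
    (fun x h => by simp [h, monus_add_one]) x

@[simp] theorem add_monus (x y : N) : monus (x + y) y = x :=
  induct (F1_monus' (F1_add (F1_const x) F1_id) F1_id) (F1_const x) (by simp)
    (fun y h => by rw [← add_assoc, monus_succ_succ, h]) y

@[simp] theorem monus_add (x y : N) : monus x (x + y) = 0 :=
  induct (F1_monus' (F1_const x) (F1_add (F1_const x) F1_id)) (F1_const 0) (by simp)
    (fun y h => by rw [← add_assoc, monus_add_one, h, pred_zero]) y

theorem add_right_cancel' {x y z : N} (h : x + z = y + z) : x = y := by
  rw [← add_monus x z, h, add_monus]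

theorem eq_zero_or_succ (x : N) : x = 0 ∨ x = pred x + 1 :=
  ind_or F1_id (F1_const 0) F1_id (F1_add (F1_comp1 F1_pred F1_id) (F1_const 1)) (Or.inl rfl)
    (fun x _ => Or.inr (by rw [s_eq, pred_add_one])) x

theorem eq_zero_or_succ' (x : N) : x = 0 ∨ ∃ y, x = y + 1 :=
  (eq_zero_or_succ x).imp id fun h => ⟨_, h⟩

theorem add_eq_zero' {x y : N} (h : x + y = 0) : x = 0 ∧ y = 0 := by
  have key : ∀ {x y : N}, x + y = 0 → y = 0 := by
    intro x y h
    rcases eq_zero_or_succ' y with rfl | ⟨z, rfl⟩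
    · rfl
    · exact absurd ((add_assoc x z 1).trans h) (add_one_ne_zero _)
  exact ⟨key ((add_comm y x).trans h), key h⟩

theorem mul_eq_zero' {x y : N} (h : x * y = 0) : x = 0 ∨ y = 0 := by
  rcases eq_zero_or_succ' y with rfl | ⟨z, rfl⟩
  · exact Or.inr rfl
  · rw [mul_add, mul_one] at h
    exact Or.inl (add_eq_zero' h).2

/-- Double induction for equations. -/
theorem induct₂ {f g : N → N → N} (hf : F2 f) (hg : F2 g) (h0 : ∀ y, f 0 y = g 0 y)
    (h0' : ∀ x, f x 0 = g x 0) (h : ∀ x y, f x y = g x y → f (x + 1) (y + 1) = g (x + 1) (y + 1))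
    (x y : N) : f x y = g x y := by
  have down : ∀ n, f (monus x (n + 1)) (monus y (n + 1)) = g (monus x (n + 1)) (monus y (n + 1)) →
      f (monus x n) (monus y n) = g (monus x n) (monus y n) := by
    intro n hn
    rw [monus_add_one, monus_add_one] at hn
    rcases eq_zero_or_succ (monus x n) with hx | hx
    · rw [hx, h0]
    rcases eq_zero_or_succ (monus y n) with hy | hy
    · rw [hy, h0']
    rw [hx, hy]
    exact h _ _ hn
  have hm : F1 fun k => monus x (monus x k) :=
    F1_monus' (F1_const x) (F1_monus' (F1_const x) F1_id)
  have hm' : F1 fun k => monus y (monus x k) :=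
    F1_monus' (F1_const y) (F1_monus' (F1_const x) F1_id)
  have := induct (F1_comp2 hf hm hm') (F1_comp2 hg hm hm') (by simp [h0])
    (fun k hk => by
      rcases eq_zero_or_succ (monus x k) with hx | hx
      · rw [hx] at hk
        rw [monus_add_one, hx, pred_zero, hk]
      · rw [hx] at hk
        rw [monus_add_one]
        exact down _ hk) x
  simpa using this

theorem add_monus_comm (x y : N) : x + monus y x = y + monus x y :=
  induct₂ (F2_add F2_fst (F2_monus' F2_snd F2_fst)) (F2_add F2_snd (F2_monus' F2_fst F2_snd))
    (by simp) (by simp)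
    (fun x y h => by
      rw [monus_succ_succ, monus_succ_succ, add_right_comm, h, add_right_comm]) x y

/-- The distance of two numbers. -/
noncomputable def dist (x y : N) : N := monus x y + monus y x

theorem dist_eq_zero {x y : N} : dist x y = 0 ↔ x = y := by
  constructor
  · intro h
    have h' := add_monus_comm x y
    rw [(add_eq_zero' h).1, (add_eq_zero' h).2, add_zero, add_zero] at h'
    exact h'
  · rintro rfl
    simp [dist]

theorem F1_dist {f g : N → N} (hf : F1 f) (hg : F1 g) : F1 fun x => dist (f x) (g x) :=
  F1_add (F1_monus' hf hg) (F1_monus' hg hf)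

theorem F2_dist {f g : N → N → N} (hf : F2 f) (hg : F2 g) : F2 fun x y => dist (f x y) (g x y) :=
  F2_add (F2_monus' hf hg) (F2_monus' hg hf)

theorem one_monus_of_ne {x : N} (h : x ≠ 0) : monus 1 x = 0 := by
  rcases eq_zero_or_succ' x with rfl | ⟨y, rfl⟩
  · exact absurd rfl h
  · rw [add_comm]
    exact monus_add 1 y

theorem one_ne_zero' : (1 : N) ≠ 0 := by
  have := add_one_ne_zero (0 : N)
  rwa [zero_add] at this

theorem one_monus_mul_eq_zero {x y : N} : monus 1 x * y = 0 ↔ (x = 0 → y = 0) := by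
  constructor
  · rintro h rfl
    rwa [monus_zero, one_mul] at h
  · intro h
    by_cases hx : x = 0
    · rw [h hx, mul_zero]
    · rw [one_monus_of_ne hx, zero_mul]

/-! ### Inverting the pairing function -/

theorem exists_sqrt : ∃ r : N → N, F1 r ∧ r 0 = 0 ∧
    ∀ k, r (k + 1) = r k + monus 1 (dist (k + 1) ((r k + 1) * (r k + 1))) := by
  have h1 : F2 fun r _ : N => r + 1 := F2_add F2_fst (F2_const 1)
  have h2 : F2 fun r k : N => r + monus 1 (dist (k + 1) ((r + 1) * (r + 1))) :=
    F2_add F2_fst (F2_monus' (F2_const 1)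
      (F2_dist (F2_add F2_snd (F2_const 1)) (F2_mul h1 h1)))
  obtain ⟨R, h3, h4, h5⟩ := exists_rec h2
  exact ⟨fun k => R k 0, F2_left h3 0, h4 0, fun k => h5 k 0⟩

/-- The integer square root. -/
noncomputable def sqrt : N → N := exists_sqrt.choose

theorem F1_sqrt : F1 (sqrt : N → N) := exists_sqrt.choose_spec.1
theorem sqrt_zero : sqrt (0 : N) = 0 := exists_sqrt.choose_spec.2.1
theorem sqrt_add_one (k : N) :
    sqrt (k + 1) = sqrt k + monus 1 (dist (k + 1) ((sqrt k + 1) * (sqrt k + 1))) :=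
  exists_sqrt.choose_spec.2.2 k

theorem sqrt_sq_add_of_sqrt_sq {q : N} (hq : sqrt (q * q) = q) (n : N)
    (hn : monus n (q + q) = 0) : sqrt (q * q + n) = q := by
  have h1 : F1 fun n => monus 1 (monus n (q + q)) * dist (sqrt (q * q + n)) q :=
    F1_mul (F1_monus' (F1_const 1) (F1_monus' F1_id (F1_const _)))
      (F1_dist (F1_comp1 F1_sqrt (F1_add (F1_const _) F1_id)) (F1_const _))
  have h2 := induct h1 (F1_const 0)
    (by
      rw [one_monus_mul_eq_zero, dist_eq_zero, add_zero]
      exact fun _ => hq)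
    (fun n ih => by
      rw [one_monus_mul_eq_zero, dist_eq_zero] at ih ⊢
      intro hn
      have hn' : monus n (q + q) = 0 := by
        rw [← monus_succ_succ, monus_add_one, hn, pred_zero]
      have hd : dist (q * q + n + 1) ((q + 1) * (q + 1)) ≠ 0 := by
        rw [Ne, dist_eq_zero]
        intro h
        have : n = q + q := by
          refine add_right_cancel' (z := q * q + 1) ?_
          calc n + (q * q + 1) = q * q + n + 1 := by ring
            _ = (q + 1) * (q + 1) := h
            _ = q + q + (q * q + 1) := by ring
        rw [this, add_comm, add_monus] at hn
        exact one_ne_zero' hn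
      rw [← add_assoc, sqrt_add_one, ih hn', one_monus_of_ne hd, add_zero]) n
  rw [one_monus_mul_eq_zero, dist_eq_zero] at h2
  exact h2 hn

theorem sqrt_sq (q : N) : sqrt (q * q) = q :=
  induct (F1_comp1 F1_sqrt (F1_mul F1_id F1_id)) F1_id (by rw [mul_zero, sqrt_zero])
    (fun q hq => by
      have h := sqrt_sq_add_of_sqrt_sq hq (q + q) (monus_self _)
      have e : (q + 1) * (q + 1) = q * q + (q + q) + 1 := by ring
      rw [e, sqrt_add_one, h, ← e, dist_eq_zero.2 rfl, monus_zero]) q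

/-- The pairing of second order arithmetic. -/
noncomputable def pair (m n : N) : N := (m + n) * (m + n) + m

noncomputable def unpairFst (k : N) : N := monus k (sqrt k * sqrt k)
noncomputable def unpairSnd (k : N) : N := monus (sqrt k) (unpairFst k)

theorem F1_unpairFst : F1 (unpairFst : N → N) :=
  F1_monus' F1_id (F1_mul F1_sqrt F1_sqrt)

theorem F1_unpairSnd : F1 (unpairSnd : N → N) := F1_monus' F1_sqrt F1_unpairFst

theorem sqrt_pair (m n : N) : sqrt (pair m n) = m + n :=
  sqrt_sq_add_of_sqrt_sq (sqrt_sq _) _ (by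
    have : m + n + (m + n) = m + (n + (m + n)) := by ring
    rw [this, monus_add])

@[simp] theorem unpairFst_pair (m n : N) : unpairFst (pair m n) = m := by
  rw [unpairFst, sqrt_pair, pair, add_comm, add_monus]

@[simp] theorem unpairSnd_pair (m n : N) : unpairSnd (pair m n) = n := by
  rw [unpairSnd, sqrt_pair, unpairFst_pair, add_comm, add_monus]

theorem F2_pair : F2 (pair : N → N → N) :=
  F2_add (F2_mul (F2_add F2_fst F2_snd) (F2_add F2_fst F2_snd)) F2_fst

end Arith

end FiniteType

namespace FiniteType

namespace Str

variable {M : Str} {V : Ty → Prop}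

/-! ### The arithmetic of a model -/

theorem E.app {σ τ : Ty} {f g : M.D (Ty.arr σ τ)} (h : M.E (Ty.arr σ τ) f g) (a : M.D σ) :
    M.E τ (M.app f a) (M.app g a) := h a

theorem E.val_eq {a b : M.D Ty.nat} (h : M.E Ty.nat a b) : M.val a = M.val b := h

/-- The unary number functions that objects of the structure represent. -/
def F1 (M : Str) (f : M.N → M.N) : Prop :=
  ∃ t : M.D Ty.one, ∀ a, M.val (M.app t a) = f (M.val a)

/-- The binary number functions that objects of the structure represent. -/
def F2 (M : Str) (f : M.N → M.N → M.N) : Prop :=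
  ∃ t : M.D (Ty.arr Ty.nat Ty.one), ∀ a b, M.val (M.app (M.app t a) b) = f (M.val a) (M.val b)

namespace IsModel

theorem exists_F1 (hM : M.IsModel V) (t : M.D Ty.one) :
    ∃ f : M.N → M.N, ∀ a, M.val (M.app t a) = f (M.val a) := by
  refine ⟨fun x => M.val (M.app t (Function.surjInv hM.val_surj x)), fun a => ?_⟩
  exact hM.ext (ρ := Ty.nat) (τ := Ty.nat) trivial trivial a _ t
    (Function.surjInv_eq hM.val_surj (M.val a)).symm

theorem exists_F2 (hM : M.IsModel V) (hV : V Ty.nat) (t : M.D (Ty.arr Ty.nat Ty.one)) :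
    ∃ f : M.N → M.N → M.N, ∀ a b, M.val (M.app (M.app t a) b) = f (M.val a) (M.val b) := by
  refine ⟨fun x y => M.val (M.app (M.app t (Function.surjInv hM.val_surj x))
    (Function.surjInv hM.val_surj y)), fun a b => ?_⟩
  have h1 := hM.ext (ρ := Ty.nat) (τ := Ty.one) trivial ⟨hV, trivial⟩ a _ t
    (Function.surjInv_eq hM.val_surj (M.val a)).symm
  exact (h1 b).trans (hM.ext (ρ := Ty.nat) (τ := Ty.nat) trivial trivial b _ _
    (Function.surjInv_eq hM.val_surj (M.val b)).symm)

theorem F1_comp2 (hM : M.IsModel V) {h : M.N → M.N → M.N} {f g : M.N → M.N} (hh : M.F2 h)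
    (hf : M.F1 f) (hg : M.F1 g) : M.F1 fun x => h (f x) (g x) := by
  obtain ⟨h', hh⟩ := hh
  obtain ⟨f', hf⟩ := hf
  obtain ⟨g', hg⟩ := hg
  refine ⟨M.app (M.app (M.comb _ _ _) (M.app (M.app (M.comb _ _ _) (M.app (M.proj _ _) h')) f')) g',
    fun a => ?_⟩
  beta_reduce
  rw [← hf, ← hg, ← hh]
  refine Eq.trans (hM.comb_eq _ _ _).val_eq ?_
  refine Eq.trans (E.app (hM.comb_eq _ _ _) _).val_eq ?_
  exact (E.app (E.app (hM.proj_eq _ _) _) _).val_eq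

theorem F2_comp2 (hM : M.IsModel V) {h f g : M.N → M.N → M.N} (hh : M.F2 h)
    (hf : M.F2 f) (hg : M.F2 g) : M.F2 fun x y => h (f x y) (g x y) := by
  obtain ⟨h', hh⟩ := hh
  obtain ⟨f', hf⟩ := hf
  obtain ⟨g', hg⟩ := hg
  refine ⟨M.app (M.app (M.comb _ _ _) (M.app (M.app (M.comb _ _ _) (M.app (M.proj _ _)
    (M.comb _ _ _))) (M.app (M.app (M.comb _ _ _) (M.app (M.proj _ _) (M.app (M.comb _ _ _)
    (M.app (M.proj _ _) h')))) f'))) g', fun a b => ?_⟩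
  beta_reduce
  rw [← hf, ← hg, ← hh]
  refine Eq.trans (E.app (hM.comb_eq _ _ _) _).val_eq ?_
  refine Eq.trans (E.app (E.app (hM.comb_eq _ _ _) _) _).val_eq ?_
  refine Eq.trans (E.app (E.app (E.app (hM.proj_eq _ _) _) _) _).val_eq ?_
  refine Eq.trans (hM.comb_eq _ _ _).val_eq ?_
  refine Eq.trans (E.app (E.app (hM.comb_eq _ _ _) _) _).val_eq ?_
  refine Eq.trans (E.app (E.app (E.app (hM.proj_eq _ _) _) _) _).val_eq ?_
  refine Eq.trans (E.app (hM.comb_eq _ _ _) _).val_eq ?_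
  exact (E.app (E.app (hM.proj_eq _ _) _) _).val_eq

theorem F2_snd (hM : M.IsModel V) : M.F2 fun _ y => y := by
  refine ⟨M.app (M.proj _ _) (M.app (M.app (M.comb _ (Ty.arr Ty.nat Ty.nat) _) (M.proj _ _))
    (M.proj _ _)), fun a b => ?_⟩
  refine Eq.trans (E.app (hM.proj_eq _ _) _).val_eq ?_
  refine Eq.trans (hM.comb_eq _ _ _).val_eq ?_
  exact (hM.proj_eq _ _).val_eq

theorem F1_id (hM : M.IsModel V) : M.F1 fun x => x := by
  refine ⟨M.app (M.app (M.comb _ (Ty.arr Ty.nat Ty.nat) _) (M.proj _ _)) (M.proj _ _),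
    fun a => ?_⟩
  refine Eq.trans (hM.comb_eq _ _ _).val_eq ?_
  exact (hM.proj_eq _ _).val_eq

theorem F2_fst (hM : M.IsModel V) : M.F2 fun x _ => x :=
  ⟨M.proj _ _, fun _ _ => (hM.proj_eq _ _).val_eq⟩

theorem F2_comp1 (hM : M.IsModel V) {f : M.N → M.N} {g : M.N → M.N → M.N} (hf : M.F1 f)
    (hg : M.F2 g) : M.F2 fun x y => f (g x y) := by
  have h : M.F2 fun x _ => f x := by
    obtain ⟨f', hf⟩ := hf
    refine ⟨M.app (M.app (M.comb _ _ _) (M.app (M.proj _ _) (M.proj _ _))) f', fun a b => ?_⟩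
    beta_reduce
    rw [← hf]
    refine Eq.trans (E.app (hM.comb_eq _ _ _) _).val_eq ?_
    refine Eq.trans (E.app (E.app (hM.proj_eq _ _) _) _).val_eq ?_
    exact (hM.proj_eq _ _).val_eq
  exact hM.F2_comp2 h hg hg

theorem exists_F2_recr (hM : M.IsModel V) (hV : V Ty.nat) (z : M.D (Ty.arr Ty.nat Ty.one)) :
    ∃ R : M.N → M.N → M.N, M.F2 R ∧
      ∀ a b, M.val (M.app (M.app (M.app M.recr a) b) z) = R (M.val a) (M.val b) := by
  have hR : ∀ a b, M.val (M.app (M.app (M.app (M.app (M.comb _ _ _) (M.app (M.app (M.comb _ _ _)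
      (M.app (M.proj _ _) (M.comb _ _ _))) M.recr)) (M.app (M.proj _ _) (M.app (M.proj _ _) z))) a)
      b) = M.val (M.app (M.app (M.app M.recr a) b) z) := by
    intro a b
    refine Eq.trans (E.app (hM.comb_eq _ _ _) _).val_eq ?_
    refine Eq.trans (E.app (E.app (hM.comb_eq _ _ _) _) _).val_eq ?_
    refine Eq.trans (E.app (E.app (E.app (hM.proj_eq _ _) _) _) _).val_eq ?_
    refine Eq.trans (hM.comb_eq _ _ _).val_eq ?_
    refine hM.ext (ρ := Ty.arr Ty.nat Ty.one) (τ := Ty.nat) ⟨hV, hV, trivial⟩ trivial _ _ _ ?_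
    exact E.trans (E.app (hM.proj_eq _ _) _) (hM.proj_eq z b)
  obtain ⟨R, hR'⟩ := hM.exists_F2 hV (M.app (M.app (M.comb _ _ _) (M.app (M.app (M.comb _ _ _)
      (M.app (M.proj _ _) (M.comb _ _ _))) M.recr)) (M.app (M.proj _ _) (M.app (M.proj _ _) z)))
  exact ⟨R, ⟨_, hR'⟩, fun a b => by rw [← hR', hR]⟩

theorem F2_rec (hM : M.IsModel V) (hV : V Ty.nat) {h : M.N → M.N → M.N} (hh : M.F2 h) :
    ∃ R : M.N → M.N → M.N, M.F2 R ∧ (∀ b, R (M.val M.zero) (M.val b) = M.val b) ∧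
      ∀ a b, R (M.val (M.app M.succ a)) (M.val b) = h (R (M.val a) (M.val b)) (M.val a) := by
  obtain ⟨z, hz⟩ := hh
  obtain ⟨R, hR, hR'⟩ := hM.exists_F2_recr hV z
  refine ⟨R, hR, fun b => ?_, fun a b => ?_⟩
  · rw [← hR', hM.rec_zero]
  · rw [← hR', ← hR', hM.rec_succ, hz]

/-- The numbers of a model with its functions. -/
@[reducible] noncomputable def arith (hM : M.IsModel V) (hV : V Ty.nat) : Arith M.N where
  o := M.val M.zero
  s := (hM.exists_F1 M.succ).choose
  plus := (hM.exists_F2 hV M.add).choose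
  times := (hM.exists_F2 hV M.mul).choose
  F1 := M.F1
  F2 := M.F2
  s_ne x := by
    obtain ⟨a, rfl⟩ := hM.val_surj x
    rw [← (hM.exists_F1 M.succ).choose_spec]
    exact hM.succ_ne_zero a
  s_inj x y h := by
    obtain ⟨a, rfl⟩ := hM.val_surj x
    obtain ⟨b, rfl⟩ := hM.val_surj y
    rw [← (hM.exists_F1 M.succ).choose_spec, ← (hM.exists_F1 M.succ).choose_spec] at h
    exact hM.succ_inj a b h
  plus_o x := by
    obtain ⟨a, rfl⟩ := hM.val_surj x
    rw [← (hM.exists_F2 hV M.add).choose_spec]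
    exact hM.add_zero a
  plus_s x y := by
    obtain ⟨a, rfl⟩ := hM.val_surj x
    obtain ⟨b, rfl⟩ := hM.val_surj y
    rw [← (hM.exists_F1 M.succ).choose_spec, ← (hM.exists_F2 hV M.add).choose_spec,
      ← (hM.exists_F2 hV M.add).choose_spec, ← (hM.exists_F1 M.succ).choose_spec]
    exact hM.add_succ a b
  times_o x := by
    obtain ⟨a, rfl⟩ := hM.val_surj x
    rw [← (hM.exists_F2 hV M.mul).choose_spec]
    exact hM.mul_zero a
  times_s x y := by
    obtain ⟨a, rfl⟩ := hM.val_surj x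
    obtain ⟨b, rfl⟩ := hM.val_surj y
    rw [← (hM.exists_F1 M.succ).choose_spec, ← (hM.exists_F2 hV M.mul).choose_spec,
      ← (hM.exists_F2 hV M.mul).choose_spec, ← (hM.exists_F2 hV M.add).choose_spec]
    exact hM.mul_succ a b
  F1_id := hM.F1_id
  F1_const c := by
    obtain ⟨a, rfl⟩ := hM.val_surj c
    exact ⟨M.app (M.proj _ _) a, fun b => hM.proj_eq (ρ := Ty.nat) a b⟩
  F1_s := ⟨M.succ, (hM.exists_F1 M.succ).choose_spec⟩
  F2_plus := ⟨M.add, (hM.exists_F2 hV M.add).choose_spec⟩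
  F2_times := ⟨M.mul, (hM.exists_F2 hV M.mul).choose_spec⟩
  F2_fst := hM.F2_fst
  F2_snd := hM.F2_snd
  F1_comp2 := hM.F1_comp2
  F2_comp1 := hM.F2_comp1
  F2_comp2 := hM.F2_comp2
  F2_rec hh := by
    obtain ⟨R, h1, h2, h3⟩ := hM.F2_rec hV hh
    refine ⟨R, h1, fun y => ?_, fun x y => ?_⟩
    · obtain ⟨b, rfl⟩ := hM.val_surj y
      exact h2 b
    · obtain ⟨a, rfl⟩ := hM.val_surj x
      obtain ⟨b, rfl⟩ := hM.val_surj y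
      rw [← (hM.exists_F1 M.succ).choose_spec]
      exact h3 a b
  ind_or := by
    rintro f g f' g' ⟨tf, hf⟩ ⟨tg, hg⟩ ⟨tf', hf'⟩ ⟨tg', hg'⟩ h0 h x
    obtain ⟨a, rfl⟩ := hM.val_surj x
    rw [← hf, ← hg, ← hf', ← hg']
    refine hM.ind tf tg tf' tg' ?_ (fun a ha => ?_) a
    · rwa [hf, hg, hf', hg']
    · rw [hf, hg, hf', hg'] at ha
      rw [hf, hg, hf', hg', (hM.exists_F1 M.succ).choose_spec]
      exact h _ ha

theorem val_zero (hM : M.IsModel V) (hV : V Ty.nat) :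
    let _ := hM.arith hV
    M.val M.zero = 0 := rfl

theorem val_succ (hM : M.IsModel V) (hV : V Ty.nat) (a : M.D Ty.nat) :
    let _ := hM.arith hV
    M.val (M.app M.succ a) = M.val a + 1 := by
  intro _
  rw [← Arith.s_eq]
  exact (hM.exists_F1 M.succ).choose_spec a

theorem val_add (hM : M.IsModel V) (hV : V Ty.nat) (a b : M.D Ty.nat) :
    let _ := hM.arith hV
    M.val (M.app (M.app M.add a) b) = M.val a + M.val b :=
  (hM.exists_F2 hV M.add).choose_spec a b

theorem val_mul (hM : M.IsModel V) (hV : V Ty.nat) (a b : M.D Ty.nat) :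
    let _ := hM.arith hV
    M.val (M.app (M.app M.mul a) b) = M.val a * M.val b :=
  (hM.exists_F2 hV M.mul).choose_spec a b

end IsModel

end Str

end FiniteType

namespace FiniteType

namespace Str

/-- Extensional models: the law of extensionality holds in all types, and pointwise equal objects
are identical. -/
structure IsExt (M : Str) : Prop where
  model : M.IsModel AnyType
  eq_of_E : ∀ {σ : Ty} {f g : M.D σ}, M.E σ f g → f = g

variable {M : Str}

/-! ### Definability with parameters -/

/-- Functions of environments given by terms with parameters. -/
inductive Def (M : Str) {Γ : List Ty} : {τ : Ty} → (M.Env Γ → M.D τ) → Prop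
  | var {σ : Ty} (v : Var Γ σ) : Def M fun e => e σ v
  | const {τ : Ty} (d : M.D τ) : Def M fun _ => d
  | app {σ τ : Ty} {f : M.Env Γ → M.D (Ty.arr σ τ)} {g : M.Env Γ → M.D σ} :
      Def M f → Def M g → Def M fun e => M.app (f e) (g e)

theorem Def.eval {Γ : List Ty} {τ : Ty} (t : Tm Γ τ) : M.Def fun e : M.Env Γ => M.eval e t := by
  induction t with
  | var v => exact Def.var v
  | app f a hf ha => exact hf.app ha
  | _ => exact Def.const _

theorem Def.comp {Γ Δ : List Ty} {τ : Ty} {f : M.Env Γ → M.D τ} (hf : M.Def f)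
    {s : M.Env Δ → M.Env Γ} (hs : ∀ σ v, M.Def fun e => s e σ v) : M.Def fun e => f (s e) := by
  induction hf with
  | var v => exact hs _ v
  | const d => exact Def.const d
  | app _ _ hf hg => exact hf.app hg

theorem Def.head {Γ : List Ty} {ρ : Ty} : M.Def fun e : M.Env (ρ :: Γ) => e.head :=
  Def.var Var.zero

theorem Def.tail {Γ : List Ty} {ρ τ : Ty} {f : M.Env Γ → M.D τ} (hf : M.Def f) :
    M.Def fun e : M.Env (ρ :: Γ) => f e.tail :=
  hf.comp fun _ v => Def.var v.succ

theorem Def.cons {Γ Δ : List Ty} {ρ τ : Ty} {f : M.Env (ρ :: Γ) → M.D τ} (hf : M.Def f)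
    {s : M.Env Δ → M.Env Γ} (hs : ∀ σ v, M.Def fun e => s e σ v) {g : M.Env Δ → M.D ρ}
    (hg : M.Def g) : M.Def fun e => f ((s e).cons (g e)) :=
  hf.comp fun σ v => by
    cases v with
    | zero => exact hg
    | succ v => exact hs σ v

namespace IsExt

theorem proj_eq (hM : M.IsExt) {ρ τ : Ty} (s : M.D ρ) (t : M.D τ) :
    M.app (M.app (M.proj ρ τ) s) t = s := hM.eq_of_E (hM.model.proj_eq s t)

theorem comb_eq (hM : M.IsExt) {δ ρ τ : Ty} (r : M.D (Ty.arr δ (Ty.arr ρ τ)))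
    (s : M.D (Ty.arr δ ρ)) (t : M.D δ) :
    M.app (M.app (M.app (M.comb δ ρ τ) r) s) t = M.app (M.app r t) (M.app s t) :=
  hM.eq_of_E (hM.model.comb_eq r s t)

theorem funext (hM : M.IsExt) {σ τ : Ty} {f g : M.D (Ty.arr σ τ)}
    (h : ∀ a, M.app f a = M.app g a) : f = g :=
  hM.eq_of_E fun a => by rw [h a]; exact E.refl _

theorem val_inj (hM : M.IsExt) {a b : M.D Ty.nat} (h : M.val a = M.val b) : a = b :=
  hM.eq_of_E h

theorem nonempty (_ : M.IsExt) (τ : Ty) : Nonempty (M.D τ) := by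
  induction τ with
  | nat => exact ⟨M.zero⟩
  | arr σ τ _ h => exact ⟨M.app (M.proj _ _) h.some⟩

theorem lam (hM : M.IsExt) {Γ : List Ty} {σ τ : Ty} {f : M.Env (σ :: Γ) → M.D τ} (hf : M.Def f) :
    ∃ g : M.Env Γ → M.D (Ty.arr σ τ), M.Def g ∧ ∀ e d, M.app (g e) d = f (e.cons d) := by
  induction hf with
  | var v =>
    cases v with
    | zero =>
      refine ⟨fun _ => M.app (M.app (M.comb σ (Ty.arr σ σ) σ) (M.proj σ (Ty.arr σ σ)))
        (M.proj σ σ), Def.const _, fun e d => ?_⟩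
      rw [hM.comb_eq, hM.proj_eq]
      rfl
    | succ v =>
      exact ⟨fun e => M.app (M.proj _ _) (e _ v), (Def.const _).app (Def.var v),
        fun e d => hM.proj_eq _ _⟩
  | const d => exact ⟨fun _ => M.app (M.proj _ _) d, Def.const _, fun e d => hM.proj_eq _ _⟩
  | app _ _ hf hg =>
    obtain ⟨f', hf, hf'⟩ := hf
    obtain ⟨g', hg, hg'⟩ := hg
    refine ⟨fun e => M.app (M.app (M.comb _ _ _) (f' e)) (g' e),
      ((Def.const _).app hf).app hg, fun e d => ?_⟩
    rw [hM.comb_eq, hf', hg']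

end IsExt

/-! ### Pairs and definition by cases -/

/-- A type of codes for pairs. -/
abbrev prodTy (ρ τ : Ty) : Ty := Ty.arr (Ty.arr ρ (Ty.arr τ Ty.nat)) Ty.nat

namespace IsExt

theorem exists_pair (hM : M.IsExt) (ρ τ : Ty) : ∃ p : M.D (Ty.arr ρ (Ty.arr τ (prodTy ρ τ))),
    ∀ a b k, M.app (M.app (M.app p a) b) k = M.app (M.app k a) b := by
  obtain ⟨f, hf, hf'⟩ := hM.lam (((Def.var (M := M)
    (Γ := [Ty.arr ρ (Ty.arr τ Ty.nat), τ, ρ]) Var.zero).app (Def.var Var.zero.succ.succ)).app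
    (Def.var Var.zero.succ))
  obtain ⟨g, hg, hg'⟩ := hM.lam hf
  obtain ⟨h, hh, hh'⟩ := hM.lam hg
  exact ⟨h (Env.nil M), fun a b k => by rw [hh', hg', hf']; rfl⟩

noncomputable def pairElt (hM : M.IsExt) (ρ τ : Ty) : M.D (Ty.arr ρ (Ty.arr τ (prodTy ρ τ))) :=
  (hM.exists_pair ρ τ).choose

noncomputable def pair (hM : M.IsExt) {ρ τ : Ty} (a : M.D ρ) (b : M.D τ) : M.D (prodTy ρ τ) :=
  M.app (M.app (hM.pairElt ρ τ) a) b

theorem app_pair (hM : M.IsExt) {ρ τ : Ty} (a : M.D ρ) (b : M.D τ)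
    (k : M.D (Ty.arr ρ (Ty.arr τ Ty.nat))) : M.app (hM.pair a b) k = M.app (M.app k a) b :=
  (hM.exists_pair ρ τ).choose_spec a b k

/-- Elimination of pairs into an arbitrary type. -/
theorem exists_split (hM : M.IsExt) (ρ τ σ : Ty) :
    ∃ L : M.D (Ty.arr (Ty.arr ρ (Ty.arr τ σ)) (Ty.arr (prodTy ρ τ) σ)),
      ∀ f a b, M.app (M.app L f) (hM.pair a b) = M.app (M.app f a) b := by
  induction σ with
  | nat =>
    obtain ⟨f, hf, hf'⟩ := hM.lam ((Def.var (M := M)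
      (Γ := [prodTy ρ τ, Ty.arr ρ (Ty.arr τ Ty.nat)]) Var.zero).app (Def.var Var.zero.succ))
    obtain ⟨g, hg, hg'⟩ := hM.lam hf
    exact ⟨g (Env.nil M), fun f a b => by rw [hg', hf']; exact hM.app_pair a b f⟩
  | arr σ₁ σ₂ _ ih =>
    obtain ⟨L, hL⟩ := ih
    obtain ⟨f, hf, hf'⟩ := hM.lam ((((Def.var (M := M)
      (Γ := [τ, ρ, σ₁, prodTy ρ τ, Ty.arr ρ (Ty.arr τ (Ty.arr σ₁ σ₂))])
      Var.zero.succ.succ.succ.succ).app (Def.var Var.zero.succ)).app (Def.var Var.zero)).app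
      (Def.var Var.zero.succ.succ))
    obtain ⟨g, hg, hg'⟩ := hM.lam hf
    obtain ⟨h, hh, hh'⟩ := hM.lam (((Def.const L).app hg).app (Def.var Var.zero.succ))
    obtain ⟨k, hk, hk'⟩ := hM.lam hh
    obtain ⟨l, hl, hl'⟩ := hM.lam hk
    refine ⟨l (Env.nil M), fun f a b => hM.funext fun r => ?_⟩
    rw [hl', hk', hh', Env.cons_succ, Env.cons_zero, hL, hg', hf']
    rfl

theorem exists_fst (hM : M.IsExt) (ρ τ : Ty) : ∃ p : M.D (Ty.arr (prodTy ρ τ) ρ),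
    ∀ a b, M.app p (hM.pair a b) = a := by
  obtain ⟨L, hL⟩ := hM.exists_split ρ τ ρ
  exact ⟨M.app L (M.proj _ _), fun a b => by rw [hL, hM.proj_eq]⟩

theorem exists_snd (hM : M.IsExt) (ρ τ : Ty) : ∃ p : M.D (Ty.arr (prodTy ρ τ) τ),
    ∀ a b, M.app p (hM.pair a b) = b := by
  obtain ⟨L, hL⟩ := hM.exists_split ρ τ τ
  obtain ⟨f, -, hf'⟩ := hM.lam (Def.var (M := M) (Γ := [τ]) Var.zero)
  exact ⟨M.app L (M.app (M.proj _ _) (f (Env.nil M))), fun a b => by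
    rw [hL, hM.proj_eq, hf']; rfl⟩

noncomputable def fst (hM : M.IsExt) {ρ τ : Ty} (d : M.D (prodTy ρ τ)) : M.D ρ :=
  M.app (hM.exists_fst ρ τ).choose d

noncomputable def snd (hM : M.IsExt) {ρ τ : Ty} (d : M.D (prodTy ρ τ)) : M.D τ :=
  M.app (hM.exists_snd ρ τ).choose d

@[simp] theorem fst_pair (hM : M.IsExt) {ρ τ : Ty} (a : M.D ρ) (b : M.D τ) :
    hM.fst (hM.pair a b) = a := (hM.exists_fst ρ τ).choose_spec a b

@[simp] theorem snd_pair (hM : M.IsExt) {ρ τ : Ty} (a : M.D ρ) (b : M.D τ) :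
    hM.snd (hM.pair a b) = b := (hM.exists_snd ρ τ).choose_spec a b

theorem def_pair (hM : M.IsExt) {Γ : List Ty} {ρ τ : Ty} {f : M.Env Γ → M.D ρ}
    {g : M.Env Γ → M.D τ} (hf : M.Def f) (hg : M.Def g) : M.Def fun e => hM.pair (f e) (g e) :=
  ((Def.const _).app hf).app hg

theorem def_fst (hM : M.IsExt) {Γ : List Ty} {ρ τ : Ty} {f : M.Env Γ → M.D (prodTy ρ τ)}
    (hf : M.Def f) : M.Def fun e => hM.fst (f e) :=
  (Def.const _).app hf

theorem def_snd (hM : M.IsExt) {Γ : List Ty} {ρ τ : Ty} {f : M.Env Γ → M.D (prodTy ρ τ)}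
    (hf : M.Def f) : M.Def fun e => hM.snd (f e) :=
  (Def.const _).app hf

theorem eq_zero_or_succ (hM : M.IsExt) (a : M.D Ty.nat) :
    a = M.zero ∨ ∃ b, a = M.app M.succ b := by
  let _ := hM.model.arith trivial
  rcases Arith.eq_zero_or_succ' (M.val a) with h | ⟨y, h⟩
  · exact Or.inl (hM.val_inj h)
  · obtain ⟨b, rfl⟩ := hM.model.val_surj y
    exact Or.inr ⟨b, hM.val_inj (h.trans (hM.model.val_succ trivial b).symm)⟩

/-- Definition by cases. -/
theorem exists_cond (hM : M.IsExt) (σ : Ty) :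
    ∃ c : M.D (Ty.arr Ty.nat (Ty.arr σ (Ty.arr σ σ))), ∀ a b,
      M.app (M.app (M.app c M.zero) a) b = a ∧
      ∀ n, n ≠ M.zero → M.app (M.app (M.app c n) a) b = b := by
  induction σ with
  | nat =>
    obtain ⟨f, hf, hf'⟩ := hM.lam (((((Def.const M.recr).app (Def.var (M := M)
      (Γ := [Ty.nat, Ty.nat, Ty.nat]) Var.zero.succ.succ)).app (Def.var Var.zero.succ)).app
      ((Def.const (M.proj _ _)).app ((Def.const (M.proj _ _)).app (Def.var Var.zero)))))
    obtain ⟨g, hg, hg'⟩ := hM.lam hf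
    obtain ⟨h, hh, hh'⟩ := hM.lam hg
    refine ⟨h (Env.nil M), fun a b => ⟨?_, fun n hn => ?_⟩⟩
    · rw [hh', hg', hf']
      exact hM.val_inj (hM.model.rec_zero _ _)
    · obtain ⟨n, rfl⟩ := (hM.eq_zero_or_succ n).resolve_left hn
      rw [hh', hg', hf']
      refine (hM.val_inj (hM.model.rec_succ _ _ _)).trans ?_
      rw [hM.proj_eq, hM.proj_eq]
      rfl
  | arr σ₁ σ₂ _ ih =>
    obtain ⟨c, hc⟩ := ih
    obtain ⟨f, hf, hf'⟩ := hM.lam (((((Def.const c).app (Def.var (M := M)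
      (Γ := [σ₁, Ty.arr σ₁ σ₂, Ty.arr σ₁ σ₂, Ty.nat]) Var.zero.succ.succ.succ)).app
      ((Def.var Var.zero.succ.succ).app (Def.var Var.zero))).app
      ((Def.var Var.zero.succ).app (Def.var Var.zero))))
    obtain ⟨g, hg, hg'⟩ := hM.lam hf
    obtain ⟨h, hh, hh'⟩ := hM.lam hg
    obtain ⟨k, hk, hk'⟩ := hM.lam hh
    refine ⟨k (Env.nil M), fun a b => ⟨hM.funext fun r => ?_, fun n hn => hM.funext fun r => ?_⟩⟩
    · rw [hk', hh', hg', hf']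
      exact (hc _ _).1
    · rw [hk', hh', hg', hf']
      exact (hc _ _).2 n hn

end IsExt

end Str

end FiniteType

namespace FiniteType

namespace Str

variable {M : Str}

/-! ### Modified realizability -/

/-- A proposition depending on a parameter from `X`, given by its realizers. -/
structure RProp (M : Str) (X : Type) where
  ty : Ty
  rel : X → M.D ty → Prop

namespace RProp

def reindex {X Y : Type} (A : M.RProp X) (f : Y → X) : M.RProp Y where
  ty := A.ty
  rel y d := A.rel (f y) d

/-- A proposition whose realizers carry no information. -/
def prime {X : Type} (p : X → Prop) : M.RProp X where
  ty := Ty.nat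
  rel x _ := p x

noncomputable def and (hM : M.IsExt) {X : Type} (A B : M.RProp X) : M.RProp X where
  ty := prodTy A.ty B.ty
  rel x d := A.rel x (hM.fst d) ∧ B.rel x (hM.snd d)

noncomputable def or (hM : M.IsExt) {X : Type} (A B : M.RProp X) : M.RProp X where
  ty := prodTy Ty.nat (prodTy A.ty B.ty)
  rel x d := (hM.fst d = M.zero ∧ A.rel x (hM.fst (hM.snd d))) ∨
    (hM.fst d ≠ M.zero ∧ B.rel x (hM.snd (hM.snd d)))

def imp {X : Type} (A B : M.RProp X) : M.RProp X where
  ty := Ty.arr A.ty B.ty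
  rel x d := ∀ a, A.rel x a → B.rel x (M.app d a)

def all {Γ : List Ty} {σ : Ty} (A : M.RProp (M.Env (σ :: Γ))) : M.RProp (M.Env Γ) where
  ty := Ty.arr σ A.ty
  rel e d := ∀ a, A.rel (e.cons a) (M.app d a)

noncomputable def ex (hM : M.IsExt) {Γ : List Ty} {σ : Ty} (A : M.RProp (M.Env (σ :: Γ))) :
    M.RProp (M.Env Γ) where
  ty := prodTy σ A.ty
  rel e d := A.rel (e.cons (hM.fst d)) (hM.snd d)

theorem rel_of_eq {X : Type} {A : M.RProp X} {x : X} {a b : M.D A.ty} (h : a = b)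
    (hb : A.rel x b) : A.rel x a := by rwa [h]

theorem rel_of_param_eq {X : Type} {A : M.RProp X} {x y : X} {a : M.D A.ty} (h : x = y)
    (hy : A.rel y a) : A.rel x a := by rwa [h]

theorem and_rel_pair (hM : M.IsExt) {X : Type} {A B : M.RProp X} {x : X} {a : M.D A.ty}
    {b : M.D B.ty} (ha : A.rel x a) (hb : B.rel x b) : (and hM A B).rel x (hM.pair a b) :=
  ⟨by rwa [hM.fst_pair], by rwa [hM.snd_pair]⟩

theorem ex_rel_pair (hM : M.IsExt) {Γ : List Ty} {σ : Ty} {A : M.RProp (M.Env (σ :: Γ))}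
    {e : M.Env Γ} {a : M.D σ} {b : M.D A.ty} (h : A.rel (e.cons a) b) :
    (ex hM A).rel e (hM.pair a b) := by
  change A.rel (e.cons (hM.fst (hM.pair a b))) (hM.snd (hM.pair a b))
  rwa [hM.fst_pair, hM.snd_pair]

theorem or_rel_pair_zero (hM : M.IsExt) {X : Type} {A B : M.RProp X} {x : X} {n : M.D Ty.nat}
    {a : M.D A.ty} {b : M.D B.ty} (hn : n = M.zero) (ha : A.rel x a) :
    (or hM A B).rel x (hM.pair n (hM.pair a b)) :=
  Or.inl ⟨by rwa [hM.fst_pair], by rwa [hM.snd_pair, hM.fst_pair]⟩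

theorem or_rel_pair_ne (hM : M.IsExt) {X : Type} {A B : M.RProp X} {x : X} {n : M.D Ty.nat}
    {a : M.D A.ty} {b : M.D B.ty} (hn : n ≠ M.zero) (hb : B.rel x b) :
    (or hM A B).rel x (hM.pair n (hM.pair a b)) :=
  Or.inr ⟨by rwa [hM.fst_pair], by rwa [hM.snd_pair, hM.snd_pair]⟩

noncomputable def conj (hM : M.IsExt) {X : Type} : List (M.RProp X) → M.RProp X
  | [] => prime fun _ => True
  | A :: Δ => and hM A (conj hM Δ)

theorem conj_reindex (hM : M.IsExt) {X Y : Type} (f : Y → X) (Δ : List (M.RProp X)) :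
    conj hM (Δ.map fun A => A.reindex f) = (conj hM Δ).reindex f := by
  induction Δ with
  | nil => rfl
  | cons A Δ ih =>
    rw [List.map_cons, conj, ih]
    rfl

/-- `A` follows from `C` by a definable transformation of realizers. -/
def Ent {Γ : List Ty} (C A : M.RProp (M.Env Γ)) : Prop :=
  ∃ f : M.Env Γ → M.D C.ty → M.D A.ty, (M.Def fun e : M.Env (C.ty :: Γ) => f e.tail e.head) ∧
    ∀ e d, C.rel e d → A.rel e (f e d)

namespace Ent

variable {Γ : List Ty} {A B C D : M.RProp (M.Env Γ)}

theorem of_realizer {g : M.Env Γ → M.D A.ty} (hg : M.Def g) (h : ∀ e, A.rel e (g e)) : Ent C A :=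
  ⟨fun e _ => g e, hg.tail, fun e _ _ => h e⟩

theorem mk' {g : M.Env (C.ty :: Γ) → M.D A.ty} (hg : M.Def g)
    (h : ∀ e d, C.rel e d → A.rel e (g (e.cons d))) : Ent C A :=
  ⟨fun e d => g (e.cons d), by simpa using hg, h⟩

theorem trans (h : Ent C A) (h' : Ent A B) : Ent C B := by
  obtain ⟨f, hf, hf'⟩ := h
  obtain ⟨g, hg, hg'⟩ := h'
  exact ⟨fun e d => g e (f e d),
    hg.cons (s := fun e : M.Env (C.ty :: Γ) => e.tail) (fun _ v => Def.var v.succ) hf,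
    fun e d h => hg' _ _ (hf' _ _ h)⟩

theorem botE (hM : M.IsExt) (h : Ent C (prime fun _ => False)) : Ent C A := by
  obtain ⟨f, -, hf'⟩ := h
  exact ⟨fun _ _ => (hM.nonempty A.ty).some, Def.const _, fun e d h => (hf' e d h).elim⟩

theorem andI (hM : M.IsExt) (h : Ent C A) (h' : Ent C B) : Ent C (and hM A B) := by
  obtain ⟨f, hf, hf'⟩ := h
  obtain ⟨g, hg, hg'⟩ := h'
  refine ⟨fun e d => hM.pair (f e d) (g e d), hM.def_pair hf hg, fun e d h => ?_⟩
  exact and_rel_pair hM (hf' e d h) (hg' e d h)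

theorem andE1 (hM : M.IsExt) (h : Ent C (and hM A B)) : Ent C A := by
  obtain ⟨f, hf, hf'⟩ := h
  exact ⟨fun e d => hM.fst (f e d), hM.def_fst hf, fun e d h => (hf' e d h).1⟩

theorem andE2 (hM : M.IsExt) (h : Ent C (and hM A B)) : Ent C B := by
  obtain ⟨f, hf, hf'⟩ := h
  exact ⟨fun e d => hM.snd (f e d), hM.def_snd hf, fun e d h => (hf' e d h).2⟩

theorem refl : Ent C C := ⟨fun _ d => d, Def.head, fun _ _ h => h⟩

theorem orI1 (hM : M.IsExt) (h : Ent C A) : Ent C (or hM A B) := by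
  obtain ⟨f, hf, hf'⟩ := h
  refine ⟨fun e d => hM.pair M.zero (hM.pair (f e d) (hM.nonempty B.ty).some),
    hM.def_pair (Def.const _) (hM.def_pair hf (Def.const _)), fun e d h => ?_⟩
  exact or_rel_pair_zero hM rfl (hf' e d h)

theorem succ_ne_zero (hM : M.IsExt) (a : M.D Ty.nat) : M.app M.succ a ≠ M.zero := fun h =>
  hM.model.succ_ne_zero a (congrArg M.val h)

theorem orI2 (hM : M.IsExt) (h : Ent C B) : Ent C (or hM A B) := by
  obtain ⟨f, hf, hf'⟩ := h
  refine ⟨fun e d => hM.pair (M.app M.succ M.zero) (hM.pair (hM.nonempty A.ty).some (f e d)),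
    hM.def_pair (Def.const _) (hM.def_pair (Def.const _) hf), fun e d h => ?_⟩
  exact or_rel_pair_ne hM (succ_ne_zero hM _) (hf' e d h)

theorem orE (hM : M.IsExt) (h : Ent C (or hM A B)) (hA : Ent (and hM A C) D)
    (hB : Ent (and hM B C) D) : Ent C D := by
  obtain ⟨f, hf, hf'⟩ := h
  obtain ⟨g, hg, hg'⟩ := hA
  obtain ⟨k, hk, hk'⟩ := hB
  obtain ⟨c, hc⟩ := hM.exists_cond D.ty
  refine ⟨fun e d => M.app (M.app (M.app c (hM.fst (f e d)))
    (g e (hM.pair (hM.fst (hM.snd (f e d))) d))) (k e (hM.pair (hM.snd (hM.snd (f e d))) d)),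
    (((Def.const c).app (hM.def_fst hf)).app ?_).app ?_, fun e d h => ?_⟩
  · exact hg.cons (s := fun e : M.Env (C.ty :: Γ) => e.tail) (fun _ v => Def.var v.succ)
      (hM.def_pair (hM.def_fst (hM.def_snd hf)) Def.head)
  · exact hk.cons (s := fun e : M.Env (C.ty :: Γ) => e.tail) (fun _ v => Def.var v.succ)
      (hM.def_pair (hM.def_snd (hM.def_snd hf)) Def.head)
  · have hc' : ∀ n a b, (n = M.zero → D.rel e a) → (n ≠ M.zero → D.rel e b) →
        D.rel e (M.app (M.app (M.app c n) a) b) := by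
      intro n a b h0 h1
      by_cases hn : n = M.zero
      · rw [hn, (hc _ _).1]
        exact h0 hn
      · rw [(hc _ _).2 _ hn]
        exact h1 hn
    refine hc' _ _ _ (fun h0 => hg' _ _ (and_rel_pair hM ?_ h))
      (fun h0 => hk' _ _ (and_rel_pair hM ?_ h))
    · exact ((hf' e d h).resolve_right fun h' => h'.1 h0).2
    · exact ((hf' e d h).resolve_left fun h' => h0 h'.1).2

theorem impI (hM : M.IsExt) (h : Ent (and hM A C) B) : Ent C (imp A B) := by
  obtain ⟨f, hf, hf'⟩ := h
  obtain ⟨g, hg, hg'⟩ := hM.lam (hf.cons (s := fun e : M.Env (A.ty :: C.ty :: Γ) => e.tail.tail)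
    (fun _ v => Def.var v.succ.succ) (hM.def_pair Def.head Def.head.tail))
  refine mk' hg fun e d h a ha => ?_
  rw [hg']
  exact hf' _ _ (and_rel_pair hM ha h)

theorem impE (h : Ent C (imp A B)) (h' : Ent C A) : Ent C B := by
  obtain ⟨f, hf, hf'⟩ := h
  obtain ⟨g, hg, hg'⟩ := h'
  exact ⟨fun e d => M.app (f e d) (g e d), hf.app hg, fun e d h => hf' e d h _ (hg' e d h)⟩

theorem allI (hM : M.IsExt) {σ : Ty} {A : M.RProp (M.Env (σ :: Γ))}
    (h : Ent (C.reindex Env.tail) A) : Ent C (all A) := by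
  obtain ⟨f, hf, hf'⟩ := h
  obtain ⟨g, hg, hg'⟩ := hM.lam ((hf.cons
    (s := fun e : M.Env (σ :: C.ty :: Γ) => e.tail.tail.cons e.head)
    (fun _ v => by
      cases v with
      | zero => exact Def.head
      | succ v => exact Def.var v.succ.succ) Def.head.tail))
  refine mk' hg fun e d h a => ?_
  rw [hg']
  exact hf' (e.cons a) d h

theorem allE {σ : Ty} {A : M.RProp (M.Env (σ :: Γ))} {t : M.Env Γ → M.D σ} (ht : M.Def t)
    (h : Ent C (all A)) : Ent C (A.reindex fun e => e.cons (t e)) := by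
  obtain ⟨f, hf, hf'⟩ := h
  exact ⟨fun e d => M.app (f e d) (t e), hf.app ht.tail, fun e d h => hf' e d h _⟩

theorem exI (hM : M.IsExt) {σ : Ty} {A : M.RProp (M.Env (σ :: Γ))} {t : M.Env Γ → M.D σ}
    (ht : M.Def t) (h : Ent C (A.reindex fun e => e.cons (t e))) : Ent C (ex hM A) := by
  obtain ⟨f, hf, hf'⟩ := h
  refine ⟨fun e d => hM.pair (t e) (f e d), hM.def_pair ht.tail hf, fun e d h => ?_⟩
  exact ex_rel_pair hM (hf' e d h)

theorem exE (hM : M.IsExt) {σ : Ty} {A : M.RProp (M.Env (σ :: Γ))} (h : Ent C (ex hM A))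
    (h' : Ent (and hM A (C.reindex Env.tail)) (B.reindex Env.tail)) : Ent C B := by
  obtain ⟨f, hf, hf'⟩ := h
  obtain ⟨g, hg, hg'⟩ := h'
  refine ⟨fun e d => g (e.cons (hM.fst (f e d))) (hM.pair (hM.snd (f e d)) d), hg.cons
    (s := fun e : M.Env (C.ty :: Γ) => e.tail.cons (hM.fst (f e.tail e.head)))
    (fun _ v => by
      cases v with
      | zero => exact hM.def_fst hf
      | succ v => exact Def.var v.succ) (hM.def_pair (hM.def_snd hf) Def.head), fun e d h => ?_⟩
  exact hg' (e.cons (hM.fst (f e d))) _ (and_rel_pair hM (hf' e d h) h)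

theorem hyp (hM : M.IsExt) {Δ : List (M.RProp (M.Env Γ))} (h : A ∈ Δ) : Ent (conj hM Δ) A := by
  induction Δ with
  | nil => cases h
  | cons B Δ ih =>
    rcases List.mem_cons.1 h with rfl | h
    · exact andE1 hM refl
    · exact (andE2 hM refl).trans (ih h)

end Ent

end RProp

namespace IsExt

open RProp

/-- The realizability interpretation of formulas. -/
noncomputable def interp (hM : M.IsExt) {V : Ty → Prop} : {Γ : List Ty} → Fm V Γ → M.RProp (M.Env Γ)
  | _, Fm.eq a b => prime fun e => M.eval e a = M.eval e b
  | _, Fm.bot => prime fun _ => False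
  | _, Fm.and A B => RProp.and hM (hM.interp A) (hM.interp B)
  | _, Fm.or A B => RProp.or hM (hM.interp A) (hM.interp B)
  | _, Fm.imp A B => RProp.imp (hM.interp A) (hM.interp B)
  | _, Fm.all _ A => RProp.all (hM.interp A)
  | _, Fm.ex _ A => RProp.ex hM (hM.interp A)

theorem interp_subst (hM : M.IsExt) {V : Ty → Prop} {Γ : List Ty} (A : Fm V Γ) :
    ∀ {Δ : List Ty} (s : Sub Γ Δ),
      hM.interp (A.subst s) = (hM.interp A).reindex fun e => e.sub s := by
  induction A with
  | eq a b => intros; simp only [Fm.subst, interp, eval_subst]; rfl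
  | bot => intros; rfl
  | and A B hA hB => intros; simp only [Fm.subst, interp, hA, hB]; rfl
  | or A B hA hB => intros; simp only [Fm.subst, interp, hA, hB]; rfl
  | imp A B hA hB => intros; simp only [Fm.subst, interp, hA, hB]; rfl
  | all h A hA =>
    intro Δ s
    change RProp.all (hM.interp (A.subst (s.lift _))) = _
    rw [hA]
    simp only [interp, RProp.all, reindex, Env.sub_lift]
  | ex h A hA =>
    intro Δ s
    change RProp.ex hM (hM.interp (A.subst (s.lift _))) = _
    rw [hA]
    simp only [interp, RProp.ex, reindex, Env.sub_lift]

theorem exists_rel_subst (hM : M.IsExt) {V : Ty → Prop} {Γ Δ : List Ty} (A : Fm V Γ)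
    (s : Sub Γ Δ) (e : M.Env Δ) : (∃ d, (hM.interp (A.subst s)).rel e d) ↔
      ∃ d, (hM.interp A).rel (e.sub s) d := by
  rw [interp_subst]
  rfl

theorem interp_weaken (hM : M.IsExt) {V : Ty → Prop} {Γ : List Ty} (A : Fm V Γ) (σ : Ty) :
    hM.interp (A.weaken σ) = (hM.interp A).reindex Env.tail :=
  hM.interp_subst A _

theorem interp_inst (hM : M.IsExt) {V : Ty → Prop} {Γ : List Ty} {σ : Ty} (A : Fm V (σ :: Γ))
    (t : Tm Γ σ) : hM.interp (A.inst t) = (hM.interp A).reindex fun e => e.cons (M.eval e t) := by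
  rw [Fm.inst, interp_subst]
  simp only [Env.sub_cons, Env.sub_var]

/-- The realizability interpretation is sound for intuitionistic logic. -/
theorem sound (hM : M.IsExt) {V : Ty → Prop} {T : Theory V}
    (hT : ∀ (Γ : List Ty) (A : Fm V Γ), A ∈ T Γ → ∀ C, Ent C (hM.interp A)) {Γ : List Ty}
    {Δ : List (Fm V Γ)} {A : Fm V Γ} (h : Der T Γ Δ A) :
    Ent (conj hM (Δ.map hM.interp)) (hM.interp A) := by
  have map_weaken : ∀ {Γ : List Ty} (Δ : List (Fm V Γ)) (σ : Ty),
      conj hM ((Δ.map (Fm.weaken σ)).map hM.interp) =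
        (conj hM (Δ.map hM.interp)).reindex Env.tail := by
    intro Γ Δ σ
    rw [← conj_reindex, List.map_map, List.map_map]
    congr 2
    funext A
    exact hM.interp_weaken A σ
  induction h with
  | ax h => exact hT _ _ h _
  | hyp h => exact Ent.hyp hM (List.mem_map_of_mem h)
  | botE _ ih => exact Ent.botE hM ih
  | andI _ _ h h' => exact Ent.andI hM h h'
  | andE1 _ h => exact Ent.andE1 hM h
  | andE2 _ h => exact Ent.andE2 hM h
  | orI1 _ h => exact Ent.orI1 hM h
  | orI2 _ h => exact Ent.orI2 hM h
  | orE _ _ _ h h' h'' => exact Ent.orE hM h h' h''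
  | impI _ h => exact Ent.impI hM h
  | impE _ _ h h' => exact Ent.impE h h'
  | allI _ _ h =>
    rw [map_weaken] at h
    exact Ent.allI hM h
  | allE t _ h =>
    rw [interp_inst]
    exact Ent.allE (Def.eval t) h
  | exI _ t _ h =>
    rw [interp_inst] at h
    exact Ent.exI hM (Def.eval t) h
  | exE _ _ h h' =>
    rw [List.map_cons, conj, map_weaken, interp_weaken] at h'
    exact Ent.exE hM h h'

end IsExt

end Str

end FiniteType

namespace FiniteType

theorem Fm.eqAt_exFree {V : Ty → Prop} (τ : Ty) : ∀ {Γ : List Ty} (h : ArgsIn V τ)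
    (s t : Tm Γ τ), (Fm.eqAt τ h s t).ExFree := by
  induction τ with
  | nat => intros; trivial
  | arr σ τ _ ih => intro Γ h s t; exact ih _ _ _

namespace Str

variable {M : Str}

namespace IsExt

open RProp

/-! ### Truth and realizability -/

theorem sat_eq (hM : M.IsExt) {V : Ty → Prop} {Γ : List Ty} {e : M.Env Γ} {a b : Tm Γ Ty.nat} :
    M.Sat (V := V) e (Fm.eq a b) ↔ M.eval e a = M.eval e b :=
  ⟨fun h => hM.val_inj h, fun h => congrArg M.val h⟩

/-- True `∃`-free formulas have a realizer that does not depend on the variables, and realizable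
`∃`-free formulas are true. -/
theorem exFree_realizer (hM : M.IsExt) {V : Ty → Prop} {Γ : List Ty} (A : Fm V Γ)
    (hA : A.ExFree) : ∃ c : M.D (hM.interp A).ty, ∀ e,
      (M.Sat e A → (hM.interp A).rel e c) ∧ ∀ d, (hM.interp A).rel e d → M.Sat e A := by
  induction A with
  | eq a b => exact ⟨M.zero, fun e => ⟨fun h => hM.sat_eq.1 h, fun _ h => hM.sat_eq.2 h⟩⟩
  | bot => exact ⟨M.zero, fun e => ⟨fun h => h, fun _ h => h⟩⟩
  | and A B ihA ihB =>
    obtain ⟨c, hc⟩ := ihA hA.1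
    obtain ⟨d, hd⟩ := ihB hA.2
    exact ⟨hM.pair c d, fun e => ⟨fun h => and_rel_pair hM ((hc e).1 h.1) ((hd e).1 h.2),
      fun _ h => ⟨(hc e).2 _ h.1, (hd e).2 _ h.2⟩⟩⟩
  | or A B _ _ => exact hA.elim
  | imp A B ihA ihB =>
    obtain ⟨c, hc⟩ := ihA hA.1
    obtain ⟨d, hd⟩ := ihB hA.2
    refine ⟨M.app (M.proj _ _) d, fun e => ⟨fun h a ha => ?_, fun k h hA => ?_⟩⟩
    · refine rel_of_eq (hM.proj_eq _ _) ?_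
      exact (hd e).1 (h ((hc e).2 a ha))
    · exact (hd e).2 _ (h c ((hc e).1 hA))
  | all h A ih =>
    obtain ⟨c, hc⟩ := ih hA
    refine ⟨M.app (M.proj _ _) c, fun e => ⟨fun h a => ?_, fun k h a => ?_⟩⟩
    · refine rel_of_eq (hM.proj_eq _ _) ?_
      exact (hc _).1 (h a)
    · exact (hc _).2 _ (h a)
  | ex h A _ => exact hA.elim

theorem exBlock_realizer (hM : M.IsExt) {V : Ty → Prop} {Γ : List Ty} (A : Fm V Γ)
    (hA : A.ExBlock) : ∀ e, M.Sat e A → ∃ d, (hM.interp A).rel e d := by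
  induction A with
  | ex h A ih =>
    rintro e ⟨a, ha⟩
    obtain ⟨d, hd⟩ := ih hA _ ha
    exact ⟨hM.pair a d, ex_rel_pair hM hd⟩
  | _ =>
    obtain ⟨c, hc⟩ := hM.exFree_realizer _ hA
    exact fun e h => ⟨c, (hc e).1 h⟩

/-- Realizable formulas of `Γ₁` are true. -/
theorem sat_of_realizer (hM : M.IsExt) {V : Ty → Prop} {Γ : List Ty} (A : Fm V Γ)
    (hA : A.Gamma1) : ∀ e d, (hM.interp A).rel e d → M.Sat e A := by
  induction A with
  | eq a b => exact fun e _ h => hM.sat_eq.2 h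
  | bot => exact fun e _ h => h
  | and A B ihA ihB => exact fun e d h => ⟨ihA hA.1 _ _ h.1, ihB hA.2 _ _ h.2⟩
  | or A B ihA ihB =>
    rintro e d (h | h)
    · exact Or.inl (ihA hA.1 _ _ h.2)
    · exact Or.inr (ihB hA.2 _ _ h.2)
  | imp A B ihA ihB =>
    intro e d h hs
    obtain ⟨a, ha⟩ := hM.exBlock_realizer A hA.1 e hs
    exact ihB hA.2 _ _ (h a ha)
  | all h A ih => exact fun e d h a => ih hA _ _ (h a)
  | ex h A ih => exact fun e d h => ⟨_, ih hA _ _ h⟩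

theorem exists_dist (hM : M.IsExt) : ∃ t : M.D (Ty.arr Ty.nat Ty.one),
    ∀ a b, M.app (M.app t a) b = M.zero ↔ a = b := by
  let _ := hM.model.arith trivial
  obtain ⟨t, ht⟩ := Arith.F2_dist (N := M.N) Arith.F2_fst Arith.F2_snd
  exact ⟨t, fun a b => ⟨fun h => hM.val_inj (Arith.dist_eq_zero.1 ((ht a b).symm.trans
    (congrArg M.val h))), fun h => hM.val_inj ((ht a b).trans (Arith.dist_eq_zero.2
    (congrArg M.val h)))⟩⟩

theorem exists_imp (hM : M.IsExt) : ∃ t : M.D (Ty.arr Ty.nat Ty.one),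
    ∀ a b, M.app (M.app t a) b = M.zero ↔ (a = M.zero → b = M.zero) := by
  let _ := hM.model.arith trivial
  obtain ⟨t, ht⟩ := Arith.F2_mul (N := M.N)
    (Arith.F2_monus' (Arith.F2_const 1) Arith.F2_fst) Arith.F2_snd
  exact ⟨t, fun a b => ⟨fun h ha => hM.val_inj (Arith.one_monus_mul_eq_zero.1
    ((ht a b).symm.trans (congrArg M.val h)) (congrArg M.val ha)), fun h => hM.val_inj
    ((ht a b).trans (Arith.one_monus_mul_eq_zero.2
      fun ha => congrArg M.val (h (hM.val_inj ha))))⟩⟩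

theorem add_eq_zero (hM : M.IsExt) {a b : M.D Ty.nat} :
    M.app (M.app M.add a) b = M.zero ↔ a = M.zero ∧ b = M.zero := by
  let _ := hM.model.arith trivial
  constructor
  · intro h
    have := Arith.add_eq_zero' ((hM.model.val_add trivial a b).symm.trans (congrArg M.val h))
    exact ⟨hM.val_inj this.1, hM.val_inj this.2⟩
  · rintro ⟨rfl, rfl⟩
    exact hM.val_inj (hM.model.add_zero _)

theorem mul_eq_zero (hM : M.IsExt) {a b : M.D Ty.nat} :
    M.app (M.app M.mul a) b = M.zero ↔ a = M.zero ∨ b = M.zero := by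
  let _ := hM.model.arith trivial
  constructor
  · intro h
    exact (Arith.mul_eq_zero' ((hM.model.val_mul trivial a b).symm.trans (congrArg M.val h))).imp
      (fun h => hM.val_inj h) fun h => hM.val_inj h
  · rintro (rfl | rfl)
    · exact hM.val_inj ((hM.model.val_mul trivial _ b).trans (zero_mul _))
    · exact hM.val_inj (hM.model.mul_zero _)

/-- Quantifier-free formulas are decidable, true ones are realized by a definable realizer, and
realizable ones are true. -/
theorem qFree_realizer (hM : M.IsExt) {V : Ty → Prop} {Γ : List Ty} (A : Fm V Γ)
    (hA : A.QFree) : ∃ (χ : M.Env Γ → M.D Ty.nat) (q : M.Env Γ → M.D (hM.interp A).ty),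
      M.Def χ ∧ M.Def q ∧ ∀ e, (χ e = M.zero ↔ M.Sat e A) ∧
        (M.Sat e A → (hM.interp A).rel e (q e)) ∧ ∀ d, (hM.interp A).rel e d → M.Sat e A := by
  induction A with
  | eq a b =>
    obtain ⟨t, ht⟩ := hM.exists_dist
    refine ⟨fun e => M.app (M.app t (M.eval e a)) (M.eval e b), fun _ => M.zero,
      ((Def.const t).app (Def.eval a)).app (Def.eval b), Def.const _, fun e =>
      ⟨?_, fun h => hM.sat_eq.1 h, fun _ h => hM.sat_eq.2 h⟩⟩
    rw [ht, hM.sat_eq]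
  | bot =>
    refine ⟨fun _ => M.app M.succ M.zero, fun _ => M.zero, Def.const _, Def.const _, fun e =>
      ⟨⟨fun h => Ent.succ_ne_zero hM _ h, fun h => h.elim⟩, fun h => h, fun _ h => h⟩⟩
  | and A B ihA ihB =>
    obtain ⟨χ, q, hχ, hq, h⟩ := ihA hA.1
    obtain ⟨χ', q', hχ', hq', h'⟩ := ihB hA.2
    refine ⟨fun e => M.app (M.app M.add (χ e)) (χ' e), fun e => hM.pair (q e) (q' e),
      ((Def.const _).app hχ).app hχ', hM.def_pair hq hq', fun e => ⟨?_,
      fun hs => and_rel_pair hM ((h e).2.1 hs.1) ((h' e).2.1 hs.2),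
      fun d hd => ⟨(h e).2.2 _ hd.1, (h' e).2.2 _ hd.2⟩⟩⟩
    rw [Sat, ← (h e).1, ← (h' e).1, hM.add_eq_zero]
  | or A B ihA ihB =>
    obtain ⟨χ, q, hχ, hq, h⟩ := ihA hA.1
    obtain ⟨χ', q', hχ', hq', h'⟩ := ihB hA.2
    refine ⟨fun e => M.app (M.app M.mul (χ e)) (χ' e),
      fun e => hM.pair (χ e) (hM.pair (q e) (q' e)),
      ((Def.const _).app hχ).app hχ', hM.def_pair hχ (hM.def_pair hq hq'), fun e => ⟨?_,
      fun hs => ?_, fun d hd => ?_⟩⟩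
    · rw [Sat, ← (h e).1, ← (h' e).1, hM.mul_eq_zero]
    · by_cases h0 : χ e = M.zero
      · exact or_rel_pair_zero hM h0 ((h e).2.1 ((h e).1.1 h0))
      · exact or_rel_pair_ne hM h0
          ((h' e).2.1 (hs.resolve_left fun hA => h0 ((h e).1.2 hA)))
    · rcases hd with hd | hd
      · exact Or.inl ((h e).2.2 _ hd.2)
      · exact Or.inr ((h' e).2.2 _ hd.2)
  | imp A B ihA ihB =>
    obtain ⟨χ, q, hχ, hq, h⟩ := ihA hA.1
    obtain ⟨χ', q', hχ', hq', h'⟩ := ihB hA.2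
    obtain ⟨t, ht⟩ := hM.exists_imp
    refine ⟨fun e => M.app (M.app t (χ e)) (χ' e), fun e => M.app (M.proj _ _) (q' e),
      ((Def.const _).app hχ).app hχ', (Def.const _).app hq', fun e => ⟨?_,
      fun hs a ha => ?_, fun d hd hs => ?_⟩⟩
    · rw [Sat, ← (h e).1, ← (h' e).1, ht]
    · refine rel_of_eq (hM.proj_eq _ _) ?_
      exact (h' e).2.1 (hs ((h e).2.2 _ ha))
    · exact (h' e).2.2 _ (hd _ ((h e).2.1 hs))
  | all h A _ => exact hA.elim
  | ex h A _ => exact hA.elim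

/-! ### Realizers of the axioms -/

theorem ent_of_exFree (hM : M.IsExt) {V : Ty → Prop} {Γ : List Ty} {A : Fm V Γ}
    {C : M.RProp (M.Env Γ)} (hA : A.ExFree) (h : ∀ e, M.Sat e A) : Ent C (hM.interp A) := by
  obtain ⟨c, hc⟩ := hM.exFree_realizer A hA
  exact Ent.of_realizer (Def.const c) fun e => (hc e).1 (h e)

theorem eval_applyArgs {Γ : List Ty} (e : M.Env Γ) {τ : Ty} {s t : Tm Γ τ} (u : Args Γ τ)
    (h : M.eval e s = M.eval e t) :
    M.eval e (s.applyArgs u) = M.eval e (t.applyArgs u) := by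
  induction u with
  | nil => exact h
  | cons a u ih => exact ih (by rw [Str.eval, Str.eval, h])

theorem induct (hM : M.IsExt) {Γ : List Ty} {χ : M.Env (Ty.nat :: Γ) → M.D Ty.nat} (hχ : M.Def χ)
    (e : M.Env Γ) (h0 : χ (e.cons M.zero) = M.zero)
    (h : ∀ a, χ (e.cons a) = M.zero → χ (e.cons (M.app M.succ a)) = M.zero) (a : M.D Ty.nat) :
    χ (e.cons a) = M.zero := by
  obtain ⟨f, -, hf⟩ := hM.lam hχ
  let g : M.D Ty.one := M.app (M.proj _ _) M.zero
  have hg : ∀ a, M.app g a = M.zero := hM.proj_eq _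
  have := hM.model.ind (f e) g (f e) g (by rw [hf, hg, h0]; exact Or.inl rfl)
    (fun a ha => by
      rw [hf, hg, or_self_iff] at ha
      rw [hf, hg, h a (hM.val_inj ha)]
      exact Or.inl rfl) a
  rw [hf, hg, or_self_iff] at this
  exact hM.val_inj this

theorem ent_HA (hM : M.IsExt) {V : Ty → Prop} {Γ : List Ty} {A : Fm V Γ} (h : HA V Γ A)
    (C : M.RProp (M.Env Γ)) : Ent C (hM.interp A) := by
  cases h with
  | eq_refl s => exact hM.ent_of_exFree trivial (fun e => rfl)
  | eq_symm s t => exact hM.ent_of_exFree ⟨trivial, trivial⟩ (fun e h => Eq.symm h)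
  | eq_trans r s t =>
    exact hM.ent_of_exFree ⟨⟨trivial, trivial⟩, trivial⟩ (fun e h => Eq.trans h.1 h.2)
  | ext hρ hτ s t r =>
    refine hM.ent_of_exFree ⟨Fm.eqAt_exFree _ _ _ _, Fm.eqAt_exFree _ _ _ _⟩ (fun e h => ?_)
    rw [sat_eqAt] at h ⊢
    rw [Str.eval, Str.eval, hM.eq_of_E h]
    exact E.refl _
  | succ_ne_zero s =>
    exact hM.ent_of_exFree ⟨trivial, trivial⟩ (fun e h => hM.model.succ_ne_zero _ h)
  | succ_inj s t =>
    exact hM.ent_of_exFree ⟨trivial, trivial⟩ (fun e h => hM.model.succ_inj _ _ h)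
  | add_zero s => exact hM.ent_of_exFree trivial (fun e => hM.model.add_zero _)
  | add_succ s t => exact hM.ent_of_exFree trivial (fun e => hM.model.add_succ _ _)
  | mul_zero s => exact hM.ent_of_exFree trivial (fun e => hM.model.mul_zero _)
  | mul_succ s t => exact hM.ent_of_exFree trivial (fun e => hM.model.mul_succ _ _)
  | proj s t u =>
    exact hM.ent_of_exFree trivial
      (fun e => hM.sat_eq.2 (eval_applyArgs e u (hM.proj_eq _ _)))
  | comb r s t u =>
    exact hM.ent_of_exFree trivial
      (fun e => hM.sat_eq.2 (eval_applyArgs e u (hM.comb_eq _ _ _)))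
  | rec_zero y z => exact hM.ent_of_exFree trivial (fun e => hM.model.rec_zero _ _)
  | rec_succ n y z => exact hM.ent_of_exFree trivial (fun e => hM.model.rec_succ _ _ _)
  | induction hV A hA =>
    obtain ⟨χ, q, hχ, hq, h⟩ := hM.qFree_realizer A hA
    obtain ⟨g, hg, hg'⟩ := hM.lam hq
    refine Ent.of_realizer (g := fun e => M.app (M.proj _ _) (g e)) ((Def.const _).app hg) ?_
    intro e d hd
    have h0 : M.Sat (e.cons M.zero) A := by
      obtain ⟨d', hd'⟩ := (hM.exists_rel_subst A _ e).1 ⟨_, hd.1⟩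
      rw [Env.sub_cons] at hd'
      exact (h _).2.2 d' hd'
    have hstep : ∀ a, M.Sat (e.cons a) A → M.Sat (e.cons (M.app M.succ a)) A := by
      intro a ha
      obtain ⟨d', hd'⟩ := (hM.exists_rel_subst A _ (e.cons a)).1
        ⟨_, hd.2 a (q (e.cons a)) ((h _).2.1 ha)⟩
      rw [Env.sub_cons] at hd'
      exact (h _).2.2 d' hd'
    refine rel_of_eq (hM.proj_eq _ _) fun a => ?_
    rw [hg']
    refine (h _).2.1 ((h _).1.1 (hM.induct hχ e ((h _).1.2 h0) (fun b hb => ?_) a))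
    exact (h _).1.2 (hstep b ((h _).1.1 hb))

theorem ent_AC (hM : M.IsExt) {V : Ty → Prop} {Γ : List Ty} {A : Fm V Γ} (h : AC V Γ A)
    (C : M.RProp (M.Env Γ)) : Ent C (hM.interp A) := by
  obtain ⟨hρ, hτ, hY, A⟩ := h
  rename_i ρ τ
  refine Ent.impI hM ((Ent.andE1 hM Ent.refl).trans ?_)
  obtain ⟨f, hf, hf'⟩ := hM.lam (hM.def_fst ((Def.var (M := M)
    (Γ := ρ :: Ty.arr ρ (prodTy τ (hM.interp A).ty) :: Γ) Var.zero.succ).app (Def.var Var.zero)))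
  obtain ⟨g, hg, hg'⟩ := hM.lam (hM.def_snd ((Def.var (M := M)
    (Γ := ρ :: Ty.arr ρ (prodTy τ (hM.interp A).ty) :: Γ) Var.zero.succ).app (Def.var Var.zero)))
  change Ent (RProp.all (RProp.ex hM (hM.interp A)))
    (RProp.ex hM (RProp.all (hM.interp A.choiceInst)))
  rw [Fm.choiceInst, interp_subst]
  refine Ent.mk' (hM.def_pair hf hg) fun e d hd => ex_rel_pair hM fun a => ?_
  refine rel_of_eq (hg' _ _) ?_
  change (hM.interp A).rel (Env.sub _ _) _
  rw [Env.sub_cons, Env.sub_cons]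
  exact rel_of_param_eq (congrArg (Env.cons (e.cons a)) (hf' _ _)) (hd a)

theorem ent_IPef (hM : M.IsExt) {V : Ty → Prop} {Γ : List Ty} {A : Fm V Γ} (h : IPef V Γ A)
    (C : M.RProp (M.Env Γ)) : Ent C (hM.interp A) := by
  obtain ⟨h, A, hA, B⟩ := h
  rename_i σ
  obtain ⟨c, hc⟩ := hM.exFree_realizer A hA
  refine Ent.impI hM ((Ent.andE1 hM Ent.refl).trans ?_)
  change Ent (RProp.imp (hM.interp A) (RProp.ex hM (hM.interp B)))
    (RProp.ex hM (RProp.imp (hM.interp (A.weaken _)) (hM.interp B)))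
  rw [interp_weaken]
  have hd := (Def.head (M := M) (Γ := Γ)
    (ρ := Ty.arr (hM.interp A).ty (prodTy σ (hM.interp B).ty))).app (Def.const c)
  refine Ent.mk' (hM.def_pair (hM.def_fst hd)
    ((Def.const (M.proj _ (hM.interp A).ty)).app (hM.def_snd hd)))
    fun e d hd => ex_rel_pair hM fun a ha => ?_
  refine rel_of_eq (hM.proj_eq _ _) ?_
  exact hd c ((hc e).1 ((hc e).2 a ha))

/-- In extensional models, the `∀∃`-theorems of `I₀` in `Γ₁` have choice functions. -/
theorem exists_choice (hM : M.IsExt) {ρ τ : Ty} {A : Fm AnyType [τ, ρ]} (hA : (allEx A).Gamma1)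
    (h : Provable I0 (allEx A)) :
    ∃ t : M.D (Ty.arr ρ τ), ∀ a, M.Sat (((Env.nil M).cons a).cons (M.app t a)) A := by
  obtain ⟨f, -, hf⟩ := hM.sound (fun Γ A hA C => by
    rcases hA with hA | hA | hA
    · exact hM.ent_HA hA C
    · exact hM.ent_AC hA C
    · exact hM.ent_IPef hA C) h
  have key := hf (Env.nil M) M.zero trivial
  obtain ⟨g, -, hg⟩ := hM.lam (hM.def_fst ((Def.const (M := M)
    (Γ := [ρ]) (τ := Ty.arr ρ (prodTy τ (hM.interp A).ty)) (f (Env.nil M) M.zero)).app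
    (Def.var Var.zero)))
  refine ⟨g (Env.nil M), fun a => ?_⟩
  rw [hg]
  exact hM.sat_of_realizer A hA _ _ (key a)

end IsExt

end Str

end FiniteType

namespace FiniteType

/-! ### Countability of the language -/

def Ty.code : Ty → ℕ
  | Ty.nat => 0
  | Ty.arr σ τ => Nat.pair σ.code τ.code + 1

theorem Ty.code_injective : Function.Injective Ty.code := by
  intro σ
  induction σ with
  | nat =>
    intro τ h
    cases τ with
    | nat => rfl
    | arr _ _ => simp [Ty.code] at h
  | arr σ₁ σ₂ h₁ h₂ =>
    intro τ h
    cases τ with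
    | nat => simp [Ty.code] at h
    | arr τ₁ τ₂ =>
      simp only [Ty.code, Nat.add_right_cancel_iff, Nat.pair_eq_pair] at h
      rw [h₁ h.1, h₂ h.2]

instance : Countable Ty := Ty.code_injective.countable

def Var.code : {Γ : List Ty} → {σ : Ty} → Var Γ σ → ℕ
  | _, _, Var.zero => 0
  | _, _, Var.succ v => v.code + 1

theorem Var.eq_of_code {Γ : List Ty} {σ : Ty} (v : Var Γ σ) : ∀ {σ' : Ty} (v' : Var Γ σ'),
    v.code = v'.code → (⟨σ, v⟩ : Σ σ, Var Γ σ) = ⟨σ', v'⟩ := by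
  induction v with
  | zero =>
    intro σ' v' h
    cases v' with
    | zero => rfl
    | succ v' => simp [Var.code] at h
  | succ v ih =>
    intro σ' v' h
    cases v' with
    | zero => simp [Var.code] at h
    | succ v' =>
      simp only [Var.code, Nat.add_right_cancel_iff] at h
      cases ih v' h
      rfl

def Tm.code {Γ : List Ty} : {σ : Ty} → Tm Γ σ → ℕ
  | _, Tm.var v => Nat.pair 0 v.code
  | _, Tm.zero => Nat.pair 1 0
  | _, Tm.succ => Nat.pair 2 0
  | _, Tm.add => Nat.pair 3 0
  | _, Tm.mul => Nat.pair 4 0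
  | _, Tm.proj ρ τ => Nat.pair 5 (Nat.pair ρ.code τ.code)
  | _, Tm.comb δ ρ τ => Nat.pair 6 (Nat.pair δ.code (Nat.pair ρ.code τ.code))
  | _, Tm.recr => Nat.pair 7 0
  | _, Tm.app f a => Nat.pair 8 (Nat.pair f.code a.code)

theorem Tm.eq_of_code {Γ : List Ty} {σ : Ty} (t : Tm Γ σ) : ∀ {σ' : Ty} (t' : Tm Γ σ'),
    t.code = t'.code → (⟨σ, t⟩ : Σ σ, Tm Γ σ) = ⟨σ', t'⟩ := by
  induction t with
  | var v =>
    intro σ' t' h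
    cases t' <;> simp [Tm.code, Nat.pair_eq_pair] at h
    cases v.eq_of_code _ h
    rfl
  | proj ρ τ =>
    intro σ' t' h
    cases t' <;> simp [Tm.code, Nat.pair_eq_pair] at h
    cases Ty.code_injective h.1
    cases Ty.code_injective h.2
    rfl
  | comb δ ρ τ =>
    intro σ' t' h
    cases t' <;> simp [Tm.code, Nat.pair_eq_pair] at h
    cases Ty.code_injective h.1
    cases Ty.code_injective h.2.1
    cases Ty.code_injective h.2.2
    rfl
  | app f a hf ha =>
    intro σ' t' h
    cases t' <;> simp [Tm.code, Nat.pair_eq_pair] at h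
    cases hf _ h.1
    cases ha _ h.2
    rfl
  | _ =>
    intro σ' t' h
    cases t' <;> first | rfl | simp [Tm.code, Nat.pair_eq_pair] at h

theorem Tm.code_injective {Γ : List Ty} {σ : Ty} : Function.Injective (Tm.code (Γ := Γ) (σ := σ)) :=
  fun t t' h => by
    cases t.eq_of_code t' h
    rfl

def Fm.code {V : Ty → Prop} : {Γ : List Ty} → Fm V Γ → ℕ
  | _, Fm.eq a b => Nat.pair 0 (Nat.pair a.code b.code)
  | _, Fm.bot => Nat.pair 1 0
  | _, Fm.and A B => Nat.pair 2 (Nat.pair A.code B.code)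
  | _, Fm.or A B => Nat.pair 3 (Nat.pair A.code B.code)
  | _, Fm.imp A B => Nat.pair 4 (Nat.pair A.code B.code)
  | _, Fm.all (σ := σ) _ A => Nat.pair 5 (Nat.pair σ.code A.code)
  | _, Fm.ex (σ := σ) _ A => Nat.pair 6 (Nat.pair σ.code A.code)

theorem Fm.code_injective {V : Ty → Prop} {Γ : List Ty} :
    Function.Injective (Fm.code (V := V) (Γ := Γ)) := by
  intro A
  induction A with
  | eq a b =>
    intro B h
    cases B <;> simp [Fm.code, Nat.pair_eq_pair] at h
    rw [Tm.code_injective h.1, Tm.code_injective h.2]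
  | bot =>
    intro B h
    cases B <;> first | rfl | simp [Fm.code, Nat.pair_eq_pair] at h
  | all _ _ ih =>
    intro B h
    cases B <;> simp [Fm.code, Nat.pair_eq_pair] at h
    cases Ty.code_injective h.1
    rw [ih h.2]
  | ex _ _ ih =>
    intro B h
    cases B <;> simp [Fm.code, Nat.pair_eq_pair] at h
    cases Ty.code_injective h.1
    rw [ih h.2]
  | _ _ _ ih ih' =>
    intro B h
    cases B <;> simp [Fm.code, Nat.pair_eq_pair] at h
    rw [ih h.1, ih' h.2]

instance {V : Ty → Prop} {Γ : List Ty} : Countable (Fm V Γ) := Fm.code_injective.countable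

theorem exists_enumeration (V : Ty → Prop) : ∃ en : ℕ → Σ Γ : List Ty, Fm V Γ,
    ∀ (p : Σ Γ : List Ty, Fm V Γ) (N : ℕ), ∃ n ≥ N, en n = p := by
  have : Nonempty (Σ Γ : List Ty, Fm V Γ) := ⟨⟨[], Fm.bot⟩⟩
  obtain ⟨g, hg⟩ := exists_surjective_nat (Σ Γ : List Ty, Fm V Γ)
  refine ⟨fun n => g n.unpair.1, fun p N => ?_⟩
  obtain ⟨i, rfl⟩ := hg p
  exact ⟨Nat.pair i N, Nat.right_le_pair i N, by simp⟩

/-! ### Henkin chains -/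

/-- Extensions of contexts by new variables. -/
inductive CtxExt (Γ : List Ty) : List Ty → Type
  | refl : CtxExt Γ Γ
  | step {Δ : List Ty} (σ : Ty) : CtxExt Γ Δ → CtxExt Γ (σ :: Δ)

namespace CtxExt

def sub {Γ : List Ty} : {Δ : List Ty} → CtxExt Γ Δ → Sub Γ Δ
  | _, refl => fun _ v => Tm.var v
  | _, step σ e => fun _ v => (e.sub _ v).weaken σ

theorem length_le {Γ Δ : List Ty} (e : CtxExt Γ Δ) : Γ.length ≤ Δ.length := by
  induction e with
  | refl => exact le_rfl
  | step σ e ih => exact ih.trans (Nat.le_succ _)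

theorem eq_refl {Γ Δ : List Ty} (e : CtxExt Γ Δ) (h : Δ = Γ) : HEq e (refl : CtxExt Γ Γ) := by
  cases e with
  | refl => rfl
  | step σ e =>
    subst h
    exact absurd e.length_le (by simp)

instance {Γ Δ : List Ty} : Subsingleton (CtxExt Γ Δ) := ⟨fun e => by
  induction e with
  | refl => exact fun e' => (eq_of_heq (e'.eq_refl rfl)).symm
  | step σ e ih =>
    intro e'
    cases e' with
    | refl => exact absurd e.length_le (by simp)
    | step _ e' => rw [ih e']⟩

end CtxExt

/-- An increasing chain of consistent finite sets of formulas over increasing contexts that decides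
all formulas and has witnesses for existential formulas. -/
structure HenkinChain {V : Ty → Prop} (T : Theory V) where
  C : ℕ → List Ty
  Δ : ∀ n, List (Fm V (C n))
  sh : ∀ n, Sub (C n) (C (n + 1))
  con : ∀ n, ¬ Der T (C n) (Δ n) Fm.bot
  mono : ∀ n φ, φ ∈ Δ n → φ.subst (sh n) ∈ Δ (n + 1)
  dec : ∀ (φ : ∀ n, Fm V (C n)) (N : ℕ), (∀ n ≥ N, φ (n + 1) = (φ n).subst (sh n)) →
    ∃ n ≥ N, (φ n).subst (sh n) ∈ Δ (n + 1) ∨ (φ n).neg.subst (sh n) ∈ Δ (n + 1)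
  wit : ∀ {σ : Ty} (h : V σ) (A : ∀ n, Fm V (σ :: C n)) (N : ℕ),
    (∀ n ≥ N, Fm.ex h (A (n + 1)) = (Fm.ex h (A n)).subst (sh n)) →
    (∀ n ≥ N, Fm.ex h (A n) ∈ Δ n) →
    ∃ n ≥ N, ∃ t : Tm (C (n + 1)) σ, (A n).subst ((sh n).cons t) ∈ Δ (n + 1)

section Construction

variable {V : Ty → Prop} (T : Theory V)

/-- Add a formula, with a new variable as a witness if it is existential. -/
def witnessStep {Γ : List Ty} (Δ : List (Fm V Γ)) : Fm V Γ → Σ σ : Ty, List (Fm V (σ :: Γ))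
  | Fm.ex (σ := σ) h B => ⟨σ, B :: (Fm.ex h B :: Δ).map (Fm.weaken σ)⟩
  | φ => ⟨Ty.nat, (φ :: Δ).map (Fm.weaken Ty.nat)⟩

open Classical in
/-- Add a formula if this is consistent, otherwise its negation. -/
noncomputable def henkinStep {Γ : List Ty} (Δ : List (Fm V Γ)) (φ : Fm V Γ) :
    Σ σ : Ty, List (Fm V (σ :: Γ)) :=
  if Der T Γ (φ :: Δ) Fm.bot then ⟨Ty.nat, (φ.neg :: Δ).map (Fm.weaken Ty.nat)⟩
  else witnessStep Δ φ

variable {T} {Γ : List Ty} {Δ : List (Fm V Γ)} {φ : Fm V Γ}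

theorem mem_witnessStep {ψ : Fm V Γ} (h : ψ ∈ φ :: Δ) :
    ψ.weaken (witnessStep Δ φ).1 ∈ (witnessStep Δ φ).2 := by
  cases φ with
  | ex hσ B => exact List.mem_cons_of_mem _ (List.mem_map_of_mem h)
  | _ => exact List.mem_map_of_mem h

theorem consistent_weaken (hV : V Ty.nat) (h : ¬ Der T Γ Δ Fm.bot) :
    ¬ Der T (Ty.nat :: Γ) (Δ.map (Fm.weaken Ty.nat)) Fm.bot :=
  fun hd => h (Der.allE (A := Fm.bot) Tm.zero (Der.allI hV hd))

theorem consistent_witnessStep (hV : V Ty.nat) (h : ¬ Der T Γ (φ :: Δ) Fm.bot) :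
    ¬ Der T ((witnessStep Δ φ).1 :: Γ) (witnessStep Δ φ).2 Fm.bot := by
  cases φ with
  | ex hσ B => exact fun hd => h (Der.exE (Der.hyp (List.mem_cons_self ..)) hd)
  | _ => exact consistent_weaken hV h

theorem henkinStep_of_der (h : Der T Γ (φ :: Δ) Fm.bot) :
    henkinStep T Δ φ = ⟨Ty.nat, (φ.neg :: Δ).map (Fm.weaken Ty.nat)⟩ := if_pos h

theorem henkinStep_of_not_der (h : ¬ Der T Γ (φ :: Δ) Fm.bot) :
    henkinStep T Δ φ = witnessStep Δ φ := if_neg h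

theorem mem_henkinStep {ψ : Fm V Γ} (h : ψ ∈ Δ) :
    ψ.weaken (henkinStep T Δ φ).1 ∈ (henkinStep T Δ φ).2 := by
  by_cases hd : Der T Γ (φ :: Δ) Fm.bot
  · rw [henkinStep_of_der hd]
    exact List.mem_map_of_mem (List.mem_cons_of_mem _ h)
  · rw [henkinStep_of_not_der hd]
    exact mem_witnessStep (List.mem_cons_of_mem _ h)

theorem decides_henkinStep : φ.weaken (henkinStep T Δ φ).1 ∈ (henkinStep T Δ φ).2 ∨
    φ.neg.weaken (henkinStep T Δ φ).1 ∈ (henkinStep T Δ φ).2 := by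
  by_cases hd : Der T Γ (φ :: Δ) Fm.bot
  · rw [henkinStep_of_der hd]
    exact Or.inr (List.mem_map_of_mem (List.mem_cons_self ..))
  · rw [henkinStep_of_not_der hd]
    exact Or.inl (mem_witnessStep (List.mem_cons_self ..))

theorem consistent_henkinStep (hV : V Ty.nat) (h : ¬ Der T Γ Δ Fm.bot) :
    ¬ Der T ((henkinStep T Δ φ).1 :: Γ) (henkinStep T Δ φ).2 Fm.bot := by
  by_cases hd : Der T Γ (φ :: Δ) Fm.bot
  · rw [henkinStep_of_der hd]
    refine consistent_weaken hV fun hd' => h ?_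
    exact Der.impE (Der.impI hd') (Der.impI hd)
  · rw [henkinStep_of_not_der hd]
    exact consistent_witnessStep hV hd

theorem witness_henkinStep {σ : Ty} {hσ : V σ} {B : Fm V (σ :: Γ)} (hc : ¬ Der T Γ Δ Fm.bot)
    (h : Fm.ex hσ B ∈ Δ) : ∃ t : Tm ((henkinStep T Δ (Fm.ex hσ B)).1 :: Γ) σ,
      B.subst ((Sub.shift Γ _).cons t) ∈ (henkinStep T Δ (Fm.ex hσ B)).2 := by
  have h1 : ¬ Der T Γ (Fm.ex hσ B :: Δ) Fm.bot := fun hd =>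
    hc (Der.impE (Der.impI hd) (Der.hyp h))
  rw [henkinStep_of_not_der h1]
  refine ⟨Tm.v0, ?_⟩
  have h3 : B.subst ((Sub.shift Γ σ).cons Tm.v0) = B := by
    conv_rhs => rw [← B.subst_var]
    congr 1
    funext τ v
    cases v <;> rfl
  have h4 : B ∈ (witnessStep Δ (Fm.ex hσ B)).2 := List.mem_cons_self ..
  exact h3.symm ▸ h4

open Classical in
/-- The formula of the enumeration that is treated at stage `n`. -/
noncomputable def henkinPick (en : ℕ → Σ Γ : List Ty, Fm V Γ) (n : ℕ) (Γ : List Ty) : Fm V Γ :=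
  if h : Nonempty (CtxExt (en n).1 Γ) then (en n).2.subst h.some.sub else Fm.bot

variable (T) in
noncomputable def henkinState (φ₀ : Fm V []) (en : ℕ → Σ Γ : List Ty, Fm V Γ) :
    ℕ → Σ Γ : List Ty, List (Fm V Γ)
  | 0 => ⟨[], [φ₀]⟩
  | n + 1 =>
    ⟨(henkinStep T (henkinState φ₀ en n).2 (henkinPick en n (henkinState φ₀ en n).1)).1 ::
        (henkinState φ₀ en n).1,
      (henkinStep T (henkinState φ₀ en n).2 (henkinPick en n (henkinState φ₀ en n).1)).2⟩

theorem henkinPick_hits {φ₀ : Fm V []} {en : ℕ → Σ Γ : List Ty, Fm V Γ}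
    (hen : ∀ (p : Σ Γ : List Ty, Fm V Γ) (N : ℕ), ∃ n ≥ N, en n = p)
    (φ : ∀ n, Fm V (henkinState T φ₀ en n).1) (N : ℕ)
    (hφ : ∀ n ≥ N, φ (n + 1) = (φ n).subst (Sub.shift _ _)) :
    ∃ n ≥ N, henkinPick en n (henkinState T φ₀ en n).1 = φ n := by
  have key : ∀ n ≥ N, ∃ e : CtxExt (henkinState T φ₀ en N).1 (henkinState T φ₀ en n).1,
      φ n = (φ N).subst e.sub := by
    intro n hn
    induction n, hn using Nat.le_induction with
    | base => exact ⟨CtxExt.refl, (Fm.subst_var _).symm⟩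
    | succ n hn ih =>
      obtain ⟨e, he⟩ := ih
      refine ⟨CtxExt.step _ e, ?_⟩
      rw [hφ n hn, he, Fm.subst_subst]
      rfl
  obtain ⟨n, hn, hn'⟩ := hen ⟨_, φ N⟩ N
  obtain ⟨e, he⟩ := key n hn
  refine ⟨n, hn, ?_⟩
  have : ∀ (p : Σ Γ : List Ty, Fm V Γ) (Γ : List Ty), en n = p → ∀ e : CtxExt p.1 Γ,
      henkinPick en n Γ = p.2.subst e.sub := by
    rintro p Γ rfl e
    have h : Nonempty (CtxExt (en n).1 Γ) := ⟨e⟩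
    rw [henkinPick, dif_pos h, Subsingleton.elim h.some e]
  rw [this _ _ hn' e, he]

/-- Every consistent sentence belongs to a Henkin chain. -/
theorem exists_henkinChain (hV : V Ty.nat) (φ₀ : Fm V []) (h₀ : ¬ Der T [] [φ₀] Fm.bot) :
    ∃ H : HenkinChain T, φ₀.subst (Sub.nil _) ∈ H.Δ 0 := by
  obtain ⟨en, hen⟩ := exists_enumeration V
  have con : ∀ n, ¬ Der T (henkinState T φ₀ en n).1 (henkinState T φ₀ en n).2 Fm.bot := by
    intro n
    induction n with
    | zero => exact h₀
    | succ n ih => exact consistent_henkinStep hV ih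
  refine ⟨{
    C := fun n => (henkinState T φ₀ en n).1
    Δ := fun n => (henkinState T φ₀ en n).2
    sh := fun n => Sub.shift _ _
    con := con
    mono := fun n φ h => mem_henkinStep h
    dec := fun φ N hφ => ?_
    wit := fun h A N hA hA' => ?_ }, ?_⟩
  · obtain ⟨n, hn, hn'⟩ := henkinPick_hits hen φ N hφ
    refine ⟨n, hn, ?_⟩
    rw [← hn']
    exact decides_henkinStep
  · obtain ⟨n, hn, hn'⟩ := henkinPick_hits hen (fun n => Fm.ex h (A n)) N hA
    refine ⟨n, hn, ?_⟩
    have := witness_henkinStep (con n) (hA' n hn)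
    rw [← hn'] at this
    exact this
  · have : Sub.nil [] = fun σ (v : Var [] σ) => Tm.var v := by
      funext σ v
      cases v
    change φ₀.subst (Sub.nil []) ∈ [φ₀]
    rw [this, Fm.subst_var]
    exact List.mem_cons_self ..

end Construction

end FiniteType

namespace FiniteType

theorem Fm.subst_lift_inst {V : Ty → Prop} {Γ Δ : List Ty} {σ : Ty} (A : Fm V (σ :: Γ))
    (s : Sub Γ Δ) (t : Tm Δ σ) : (A.subst (s.lift σ)).inst t = A.subst (s.cons t) := by
  rw [Fm.inst, Fm.subst_subst]
  congr 1
  funext τ v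
  cases v with
  | zero => rfl
  | succ v =>
    change ((s _ v).weaken σ).subst _ = s _ v
    rw [Tm.weaken, Tm.subst_subst]
    exact Tm.subst_var _

theorem Fm.inst_subst {V : Ty → Prop} {Γ Δ : List Ty} {σ : Ty} (A : Fm V (σ :: Γ))
    (s : Sub Γ Δ) (t : Tm Γ σ) : (A.inst t).subst s = (A.subst (s.lift σ)).inst (t.subst s) := by
  rw [Fm.subst_lift_inst, Fm.inst, Fm.subst_subst]
  congr 1
  funext τ v
  cases v <;> rfl

theorem Fm.weaken_inst_var {V : Ty → Prop} {Γ : List Ty} {σ : Ty} (A : Fm V (σ :: Γ)) :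
    (A.subst ((Sub.shift Γ σ).lift σ)).inst Tm.v0 = A := by
  rw [Fm.subst_lift_inst]
  conv_rhs => rw [← A.subst_var]
  congr 1
  funext τ v
  cases v <;> rfl

theorem Fm.step_subst {V : Ty → Prop} {Γ Δ : List Ty} (A : Fm V (Ty.nat :: Γ)) (s : Sub Γ Δ) :
    (A.subst (Sub.cons (Sub.shift Γ Ty.nat) Tm.v0.suc)).subst (s.lift Ty.nat) =
      (A.subst (s.lift Ty.nat)).subst (Sub.cons (Sub.shift Δ Ty.nat) Tm.v0.suc) := by
  rw [Fm.subst_subst, Fm.subst_subst]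
  congr 1
  funext τ v
  cases v with
  | zero => rfl
  | succ v =>
    change (s _ v).weaken Ty.nat = ((s _ v).weaken Ty.nat).subst _
    rw [Tm.weaken, Tm.subst_subst]
    rfl

namespace HenkinChain

variable {V : Ty → Prop} {T : Theory V} (H : HenkinChain T)

/-! ### The theory of a Henkin chain -/

/-- Sequences of formulas that eventually stay the same formula. -/
def Coh (φ : ∀ n, Fm V (H.C n)) : Prop :=
  ∃ N, ∀ n ≥ N, φ (n + 1) = (φ n).subst (H.sh n)

def Coh₁ {σ : Ty} (A : ∀ n, Fm V (σ :: H.C n)) : Prop :=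
  ∃ N, ∀ n ≥ N, A (n + 1) = (A n).subst ((H.sh n).lift σ)

/-- The formulas that eventually belong to the chain. -/
def Holds (φ : ∀ n, Fm V (H.C n)) : Prop := ∃ N, ∀ n ≥ N, φ n ∈ H.Δ n

/-- The objects of the term model before identification of equal numbers: sequences of terms that
eventually stay the same term. -/
structure Elt (σ : Ty) : Type where
  tm : ∀ n, Tm (H.C n) σ
  coh : ∃ N, ∀ n ≥ N, tm (n + 1) = (tm n).subst (H.sh n)

variable {H}

theorem Coh.and {φ ψ : ∀ n, Fm V (H.C n)} (h : H.Coh φ) (h' : H.Coh ψ) :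
    H.Coh fun n => (φ n).and (ψ n) := by
  obtain ⟨N, h⟩ := h
  obtain ⟨N', h'⟩ := h'
  exact ⟨max N N', fun n hn => by
    beta_reduce
    rw [h n (le_of_max_le_left hn), h' n (le_of_max_le_right hn)]; rfl⟩

theorem Coh.or {φ ψ : ∀ n, Fm V (H.C n)} (h : H.Coh φ) (h' : H.Coh ψ) :
    H.Coh fun n => (φ n).or (ψ n) := by
  obtain ⟨N, h⟩ := h
  obtain ⟨N', h'⟩ := h'
  exact ⟨max N N', fun n hn => by
    beta_reduce
    rw [h n (le_of_max_le_left hn), h' n (le_of_max_le_right hn)]; rfl⟩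

theorem Coh.imp {φ ψ : ∀ n, Fm V (H.C n)} (h : H.Coh φ) (h' : H.Coh ψ) :
    H.Coh fun n => (φ n).imp (ψ n) := by
  obtain ⟨N, h⟩ := h
  obtain ⟨N', h'⟩ := h'
  exact ⟨max N N', fun n hn => by
    beta_reduce
    rw [h n (le_of_max_le_left hn), h' n (le_of_max_le_right hn)]; rfl⟩

theorem Coh₁.neg {σ : Ty} {A : ∀ n, Fm V (σ :: H.C n)} (h : H.Coh₁ A) :
    H.Coh₁ fun n => (A n).neg := by
  obtain ⟨N, h⟩ := h
  exact ⟨N, fun n hn => by beta_reduce; rw [h n hn]; rfl⟩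

theorem Coh₁.all {σ : Ty} {A : ∀ n, Fm V (σ :: H.C n)} (h : H.Coh₁ A) (hσ : V σ) :
    H.Coh fun n => Fm.all hσ (A n) := by
  obtain ⟨N, h⟩ := h
  exact ⟨N, fun n hn => by beta_reduce; rw [h n hn]; rfl⟩

theorem Coh₁.ex {σ : Ty} {A : ∀ n, Fm V (σ :: H.C n)} (h : H.Coh₁ A) (hσ : V σ) :
    H.Coh fun n => Fm.ex hσ (A n) := by
  obtain ⟨N, h⟩ := h
  exact ⟨N, fun n hn => by beta_reduce; rw [h n hn]; rfl⟩

theorem Coh₁.inst {σ : Ty} {A : ∀ n, Fm V (σ :: H.C n)} (h : H.Coh₁ A) (a : H.Elt σ) :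
    H.Coh fun n => (A n).inst (a.tm n) := by
  obtain ⟨N, h⟩ := h
  obtain ⟨N', h'⟩ := a.coh
  exact ⟨max N N', fun n hn => by
    beta_reduce
    rw [h n (le_of_max_le_left hn), h' n (le_of_max_le_right hn), Fm.inst_subst]⟩

theorem mem_of_le {φ : ∀ n, Fm V (H.C n)} {N : ℕ}
    (hφ : ∀ n ≥ N, φ (n + 1) = (φ n).subst (H.sh n)) {m : ℕ} (hm : N ≤ m) (h : φ m ∈ H.Δ m) :
    ∀ n ≥ m, φ n ∈ H.Δ n := by
  intro n hn
  induction n, hn using Nat.le_induction with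
  | base => exact h
  | succ n hn ih =>
    rw [hφ n (hm.trans hn)]
    exact H.mono n _ ih

theorem holds_or_neg {φ : ∀ n, Fm V (H.C n)} (hφ : H.Coh φ) :
    H.Holds φ ∨ H.Holds fun n => (φ n).neg := by
  obtain ⟨N, hφ⟩ := hφ
  have hneg : ∀ n ≥ N, (φ (n + 1)).neg = (φ n).neg.subst (H.sh n) := fun n hn => by
    rw [hφ n hn]; rfl
  obtain ⟨n, hn, h⟩ := H.dec φ N hφ
  refine h.imp (fun h => ⟨n + 1, ?_⟩) (fun h => ⟨n + 1, ?_⟩)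
  · rw [← hφ n hn] at h
    exact mem_of_le hφ (Nat.le_succ_of_le hn) h
  · rw [← hneg n hn] at h
    exact mem_of_le (φ := fun n => (φ n).neg) hneg (Nat.le_succ_of_le hn) h

/-- Formulas that are eventually derivable from the chain belong to it. -/
theorem holds_of_der {φ : ∀ n, Fm V (H.C n)} (hφ : H.Coh φ)
    (h : ∃ N, ∀ n ≥ N, Der T (H.C n) (H.Δ n) (φ n)) : H.Holds φ := by
  refine (holds_or_neg hφ).resolve_right fun h' => ?_
  obtain ⟨N, h⟩ := h
  obtain ⟨N', h'⟩ := h'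
  exact H.con _ (Der.impE (Der.hyp (h' (max N N') (le_max_right _ _))) (h _ (le_max_left _ _)))

theorem not_holds_neg {φ : ∀ n, Fm V (H.C n)} (h : H.Holds φ) :
    ¬ H.Holds fun n => (φ n).neg := by
  rintro ⟨N', h'⟩
  obtain ⟨N, h⟩ := h
  exact H.con _ (Der.impE (Der.hyp (h' (max N N') (le_max_right _ _)))
    (Der.hyp (h _ (le_max_left _ _))))

theorem not_holds_bot : ¬ H.Holds fun _ => Fm.bot := by
  rintro ⟨N, h⟩
  exact H.con N (Der.hyp (h N le_rfl))

theorem holds_neg {φ : ∀ n, Fm V (H.C n)} (hφ : H.Coh φ) :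
    (H.Holds fun n => (φ n).neg) ↔ ¬ H.Holds φ :=
  ⟨fun h h' => not_holds_neg h' h, fun h => (holds_or_neg hφ).resolve_left h⟩

theorem holds_and {φ ψ : ∀ n, Fm V (H.C n)} (hφ : H.Coh φ) (hψ : H.Coh ψ) :
    (H.Holds fun n => (φ n).and (ψ n)) ↔ H.Holds φ ∧ H.Holds ψ := by
  constructor
  · rintro ⟨N, h⟩
    exact ⟨holds_of_der hφ ⟨N, fun n hn => Der.andE1 (Der.hyp (h n hn))⟩,
      holds_of_der hψ ⟨N, fun n hn => Der.andE2 (Der.hyp (h n hn))⟩⟩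
  · rintro ⟨⟨N, h⟩, ⟨N', h'⟩⟩
    exact holds_of_der (hφ.and hψ) ⟨max N N', fun n hn =>
      Der.andI (Der.hyp (h n (le_of_max_le_left hn))) (Der.hyp (h' n (le_of_max_le_right hn)))⟩

theorem holds_imp {φ ψ : ∀ n, Fm V (H.C n)} (hφ : H.Coh φ) (hψ : H.Coh ψ) :
    (H.Holds fun n => (φ n).imp (ψ n)) ↔ (H.Holds φ → H.Holds ψ) := by
  constructor
  · rintro ⟨N, h⟩ ⟨N', h'⟩
    exact holds_of_der hψ ⟨max N N', fun n hn =>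
      Der.impE (Der.hyp (h n (le_of_max_le_left hn))) (Der.hyp (h' n (le_of_max_le_right hn)))⟩
  · intro h
    rcases holds_or_neg hφ with h' | ⟨N, h'⟩
    · obtain ⟨N, h⟩ := h h'
      exact holds_of_der (hφ.imp hψ) ⟨N, fun n hn =>
        Der.impI (Der.hyp (List.mem_cons_of_mem _ (h n hn)))⟩
    · exact holds_of_der (hφ.imp hψ) ⟨N, fun n hn => Der.impI (Der.botE
        (Der.impE (Der.hyp (List.mem_cons_of_mem _ (h' n hn)))
          (Der.hyp (List.mem_cons_self ..))))⟩

theorem holds_or {φ ψ : ∀ n, Fm V (H.C n)} (hφ : H.Coh φ) (hψ : H.Coh ψ) :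
    (H.Holds fun n => (φ n).or (ψ n)) ↔ H.Holds φ ∨ H.Holds ψ := by
  constructor
  · rintro ⟨N, h⟩
    by_contra hc
    rw [not_or, ← holds_neg hφ, ← holds_neg hψ] at hc
    obtain ⟨⟨N₁, h₁⟩, ⟨N₂, h₂⟩⟩ := hc
    let n := max N (max N₁ N₂)
    refine H.con n (Der.orE (Der.hyp (h n (le_max_left _ _))) ?_ ?_)
    · exact Der.impE (Der.hyp (List.mem_cons_of_mem _ (h₁ n
        ((le_max_left _ _).trans (le_max_right _ _))))) (Der.hyp (List.mem_cons_self ..))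
    · exact Der.impE (Der.hyp (List.mem_cons_of_mem _ (h₂ n
        ((le_max_right _ _).trans (le_max_right _ _))))) (Der.hyp (List.mem_cons_self ..))
  · rintro (⟨N, h⟩ | ⟨N, h⟩)
    · exact holds_of_der (hφ.or hψ) ⟨N, fun n hn => Der.orI1 (Der.hyp (h n hn))⟩
    · exact holds_of_der (hφ.or hψ) ⟨N, fun n hn => Der.orI2 (Der.hyp (h n hn))⟩

theorem exists_default (σ : Ty) (Γ : List Ty) : Nonempty (Tm Γ σ) := by
  induction σ with
  | nat => exact ⟨Tm.zero⟩
  | arr ρ τ _ h => exact ⟨Tm.app (Tm.proj _ _) h.some⟩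

theorem exists_elt {σ : Ty} {m : ℕ} (t : Tm (H.C m) σ) : ∃ a : H.Elt σ, a.tm m = t ∧
    ∀ n ≥ m, a.tm (n + 1) = (a.tm n).subst (H.sh n) := by
  classical
  let p : ∀ n, Tm (H.C n) σ := fun n => if h : m ≤ n then
    Nat.leRecOn (C := fun n => Tm (H.C n) σ) h (fun {n} u => u.subst (H.sh n)) t
    else (exists_default σ _).some
  have hp : ∀ n ≥ m, p (n + 1) = (p n).subst (H.sh n) := fun n hn => by
    simp only [p]
    rw [dif_pos hn, dif_pos (Nat.le_succ_of_le hn), Nat.leRecOn_succ hn]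
  refine ⟨⟨p, m, hp⟩, ?_, hp⟩
  simp only [p]
  rw [dif_pos le_rfl, Nat.leRecOn_self]

theorem holds_ex {σ : Ty} {A : ∀ n, Fm V (σ :: H.C n)} (hA : H.Coh₁ A) (hσ : V σ) :
    (H.Holds fun n => Fm.ex hσ (A n)) ↔ ∃ a : H.Elt σ, H.Holds fun n => (A n).inst (a.tm n) := by
  constructor
  · rintro ⟨N, h⟩
    obtain ⟨N', hA'⟩ := id hA
    obtain ⟨n, hn, t, ht⟩ := H.wit hσ A (max N N')
      (fun n hn => by rw [hA' n (le_of_max_le_right hn)]; rfl)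
      (fun n hn => h n (le_of_max_le_left hn))
    obtain ⟨a, ha, ha'⟩ := H.exists_elt t
    refine ⟨a, n + 1, mem_of_le (φ := fun n => (A n).inst (a.tm n)) (N := n + 1)
      (fun k hk => ?_) le_rfl ?_⟩
    · have hk' : N' ≤ k := (le_of_max_le_right hn).trans ((Nat.le_succ n).trans hk)
      rw [hA' k hk', ha' k hk, Fm.inst_subst]
    · rw [ha, hA' n (le_of_max_le_right hn), Fm.subst_lift_inst]
      exact ht
  · rintro ⟨a, N, h⟩
    exact holds_of_der (hA.ex hσ) ⟨N, fun n hn => Der.exI hσ (a.tm n) (Der.hyp (h n hn))⟩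

theorem holds_all (hLEM : ∀ Γ A, LEM V Γ A → A ∈ T Γ) {σ : Ty} {A : ∀ n, Fm V (σ :: H.C n)}
    (hA : H.Coh₁ A) (hσ : V σ) :
    (H.Holds fun n => Fm.all hσ (A n)) ↔ ∀ a : H.Elt σ, H.Holds fun n => (A n).inst (a.tm n) := by
  constructor
  · rintro ⟨N, h⟩ a
    exact holds_of_der (hA.inst a) ⟨N, fun n hn => Der.allE (a.tm n) (Der.hyp (h n hn))⟩
  · intro h
    rcases holds_or_neg (hA.neg.ex hσ) with h' | ⟨N, h'⟩
    · obtain ⟨a, ha⟩ := (holds_ex hA.neg hσ).1 h'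
      exact absurd ha (not_holds_neg (h a))
    · refine holds_of_der (hA.all hσ) ⟨N, fun n hn => Der.allI hσ ?_⟩
      refine Der.orE (Der.ax (hLEM _ _ (LEM.mk (A n)))) (Der.hyp (List.mem_cons_self ..)) ?_
      refine Der.botE (Der.impE (A := (Fm.ex hσ (A n).neg).weaken σ)
        (Der.hyp (List.mem_cons_of_mem _ ?_)) ?_)
      · exact List.mem_map_of_mem (f := Fm.weaken σ) (h' n hn)
      · refine Der.exI hσ Tm.v0 ?_
        rw [Fm.weaken_inst_var]
        exact Der.hyp (List.mem_cons_self ..)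

theorem Elt.coh_eq (a b : H.Elt Ty.nat) : H.Coh fun n => Fm.eq (a.tm n) (b.tm n) := by
  obtain ⟨N, h⟩ := a.coh
  obtain ⟨N', h'⟩ := b.coh
  exact ⟨max N N', fun n hn => by
    beta_reduce
    rw [h n (le_of_max_le_left hn), h' n (le_of_max_le_right hn)]; rfl⟩

/-! ### The term model -/

theorem holds_ax {φ : ∀ n, Fm V (H.C n)} (hφ : H.Coh φ) (h : ∀ n, φ n ∈ T (H.C n)) : H.Holds φ :=
  holds_of_der hφ ⟨0, fun n _ => Der.ax (h n)⟩

variable (H) in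
/-- Provable equality of numbers. -/
def natSetoid (hHA : ∀ Γ A, HA V Γ A → A ∈ T Γ) : Setoid (H.Elt Ty.nat) where
  r a b := H.Holds fun n => Fm.eq (a.tm n) (b.tm n)
  iseqv := by
    refine ⟨fun a => ?_, fun {a b} h => ?_, fun {a b c} h h' => ?_⟩
    · exact holds_ax (a.coh_eq a) fun n => hHA _ _ (HA.eq_refl _)
    · exact (holds_imp (a.coh_eq b) (b.coh_eq a)).1
        (holds_ax ((a.coh_eq b).imp (b.coh_eq a)) fun n => hHA _ _ (HA.eq_symm _ _)) h
    · exact (holds_imp ((a.coh_eq b).and (b.coh_eq c)) (a.coh_eq c)).1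
        (holds_ax (((a.coh_eq b).and (b.coh_eq c)).imp (a.coh_eq c))
          fun n => hHA _ _ (HA.eq_trans _ _ _))
        ((holds_and (a.coh_eq b) (b.coh_eq c)).2 ⟨h, h'⟩)

variable (H) in
def const {σ : Ty} (t : ∀ Γ, Tm Γ σ) (ht : ∀ n, t (H.C (n + 1)) = (t (H.C n)).subst (H.sh n)) :
    H.Elt σ := ⟨fun _ => t _, 0, fun n _ => ht n⟩

variable (H) in
/-- The term model. -/
def str (hHA : ∀ Γ A, HA V Γ A → A ∈ T Γ) : Str where
  D := H.Elt
  N := Quotient (H.natSetoid hHA)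
  val := Quotient.mk _
  app f a := ⟨fun n => Tm.app (f.tm n) (a.tm n), by
    obtain ⟨N, h⟩ := f.coh
    obtain ⟨N', h'⟩ := a.coh
    exact ⟨max N N', fun n hn => by
      rw [h n (le_of_max_le_left hn), h' n (le_of_max_le_right hn)]; rfl⟩⟩
  zero := H.const (fun _ => Tm.zero) fun _ => rfl
  succ := H.const (fun _ => Tm.succ) fun _ => rfl
  add := H.const (fun _ => Tm.add) fun _ => rfl
  mul := H.const (fun _ => Tm.mul) fun _ => rfl
  proj ρ τ := H.const (fun _ => Tm.proj ρ τ) fun _ => rfl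
  comb δ ρ τ := H.const (fun _ => Tm.comb δ ρ τ) fun _ => rfl
  recr := H.const (fun _ => Tm.recr) fun _ => rfl

variable {hHA : ∀ Γ A, HA V Γ A → A ∈ T Γ}

theorem val_eq_iff {a b : H.Elt Ty.nat} : (H.str hHA).val a = (H.str hHA).val b ↔
    H.Holds fun n => Fm.eq (a.tm n) (b.tm n) := by
  let _ := H.natSetoid hHA
  exact Quotient.eq

/-- The substitutions given by an environment. -/
def envSub {Γ : List Ty} (e : (H.str hHA).Env Γ) (n : ℕ) : Sub Γ (H.C n) :=
  fun σ v => (e σ v : H.Elt σ).tm n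

theorem envSub_coh {Γ : List Ty} (e : (H.str hHA).Env Γ) : ∃ N, ∀ n ≥ N, envSub e (n + 1) =
    fun σ v => (envSub e n σ v).subst (H.sh n) := by
  induction Γ with
  | nil => exact ⟨0, fun n _ => by funext σ v; cases v⟩
  | cons ρ Γ ih =>
    obtain ⟨N, h⟩ := ih e.tail
    obtain ⟨N', h'⟩ := (e.head : H.Elt ρ).coh
    refine ⟨max N N', fun n hn => ?_⟩
    funext σ v
    cases v with
    | zero => exact h' n (le_of_max_le_right hn)
    | succ v => exact congrFun (congrFun (h n (le_of_max_le_left hn)) σ) v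

theorem envSub_cons {Γ : List Ty} {ρ : Ty} (e : (H.str hHA).Env Γ) (a : H.Elt ρ) (n : ℕ) :
    envSub (e.cons a : (H.str hHA).Env (ρ :: Γ)) n = (envSub e n).cons (a.tm n) := by
  funext σ v
  cases v <;> rfl

theorem eval_tm {Γ : List Ty} (e : (H.str hHA).Env Γ) {σ : Ty} (t : Tm Γ σ) (n : ℕ) :
    ((H.str hHA).eval e t : H.Elt σ).tm n = t.subst (envSub e n) := by
  induction t with
  | app f a hf ha =>
    change Tm.app _ _ = _
    rw [hf, ha]
    rfl
  | _ => rfl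

theorem subst_coh {Γ : List Ty} (e : (H.str hHA).Env Γ) (A : Fm V Γ) :
    H.Coh fun n => A.subst (envSub e n) := by
  obtain ⟨N, h⟩ := envSub_coh e
  exact ⟨N, fun n hn => by
    beta_reduce
    rw [h n hn, Fm.subst_subst]⟩

theorem subst_coh₁ {Γ : List Ty} {σ : Ty} (e : (H.str hHA).Env Γ) (A : Fm V (σ :: Γ)) :
    H.Coh₁ fun n => A.subst ((envSub e n).lift σ) := by
  obtain ⟨N, h⟩ := envSub_coh e
  exact ⟨N, fun n hn => by
    beta_reduce
    rw [h n hn, Fm.subst_subst, Sub.lift_comp]⟩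

/-- Truth in the term model. -/
theorem holds_iff_sat (hLEM : ∀ Γ A, LEM V Γ A → A ∈ T Γ) {Γ : List Ty} (A : Fm V Γ) :
    ∀ e : (H.str hHA).Env Γ, (H.Holds fun n => A.subst (envSub e n)) ↔ (H.str hHA).Sat e A := by
  induction A with
  | eq a b =>
    intro e
    refine Iff.trans ?_ val_eq_iff.symm
    simp only [eval_tm]
    rfl
  | bot => exact fun e => iff_of_false not_holds_bot fun h => h
  | and A B hA hB =>
    exact fun e => (holds_and (subst_coh e A) (subst_coh e B)).trans (and_congr (hA e) (hB e))
  | or A B hA hB =>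
    exact fun e => (holds_or (subst_coh e A) (subst_coh e B)).trans (or_congr (hA e) (hB e))
  | imp A B hA hB =>
    exact fun e => (holds_imp (subst_coh e A) (subst_coh e B)).trans (imp_congr (hA e) (hB e))
  | all h A hA =>
    intro e
    refine (holds_all hLEM (subst_coh₁ e A) h).trans (forall_congr' fun a => ?_)
    rw [← hA]
    simp only [Fm.subst_lift_inst, envSub_cons]
  | ex h A hA =>
    intro e
    refine (holds_ex (subst_coh₁ e A) h).trans (exists_congr fun a => ?_)
    rw [← hA]
    simp only [Fm.subst_lift_inst, envSub_cons]

theorem sat_of_HA (hLEM : ∀ Γ A, LEM V Γ A → A ∈ T Γ) {Γ : List Ty} {A : Fm V Γ}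
    (e : (H.str hHA).Env Γ) (h : ∀ n, HA V (H.C n) (A.subst (envSub e n))) :
    (H.str hHA).Sat e A :=
  (holds_iff_sat hLEM A e).1 (holds_ax (subst_coh e A) fun n => hHA _ _ (h n))

theorem E_of_HA (σ : Ty) : ∀ f g : H.Elt σ, (∀ n (u : Args (H.C n) σ),
    HA V (H.C n) (Fm.eq ((f.tm n).applyArgs u) ((g.tm n).applyArgs u))) →
    (H.str hHA).E σ f g := by
  induction σ with
  | nat => exact fun f g h => val_eq_iff.2 (holds_ax (f.coh_eq g) fun n => hHA _ _ (h n Args.nil))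
  | arr σ τ _ ih => exact fun f g h a => ih _ _ fun n u => h n (Args.cons (a.tm n) u)

theorem str_isModel (hLEM : ∀ Γ A, LEM V Γ A → A ∈ T Γ) (hV : V Ty.nat) :
    (H.str hHA).IsModel V where
  val_surj := Quotient.mk_surjective
  ext {ρ τ} hρ hτ s t r h := by
    have := sat_of_HA (H := H) (hHA := hHA) hLEM (A := Fm.imp (Fm.eqAt ρ hρ Tm.v0 Tm.v1)
      (Fm.eqAt τ hτ (Tm.app Tm.v2 Tm.v0) (Tm.app Tm.v2 Tm.v1)))
      ((((Str.Env.nil _).cons r).cons t).cons s) (fun n => by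
        rw [Fm.subst, Fm.eqAt_subst, Fm.eqAt_subst]
        exact HA.ext _ _ _ _ _)
    rw [Str.Sat, Str.sat_eqAt, Str.sat_eqAt] at this
    exact this h
  succ_ne_zero a := sat_of_HA hLEM (A := Fm.neg (Fm.eq Tm.v0.suc Tm.zero))
    ((Str.Env.nil _).cons a) fun n => HA.succ_ne_zero _
  succ_inj a b := sat_of_HA hLEM (A := Fm.imp (Fm.eq Tm.v1.suc Tm.v0.suc) (Fm.eq Tm.v1 Tm.v0))
    (((Str.Env.nil _).cons a).cons b) fun n => HA.succ_inj _ _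
  add_zero a := sat_of_HA hLEM (A := Fm.eq (Tm.v0.plus Tm.zero) Tm.v0)
    ((Str.Env.nil _).cons a) fun n => HA.add_zero _
  add_succ a b := sat_of_HA hLEM (A := Fm.eq (Tm.v1.plus Tm.v0.suc) (Tm.v1.plus Tm.v0).suc)
    (((Str.Env.nil _).cons a).cons b) fun n => HA.add_succ _ _
  mul_zero a := sat_of_HA hLEM (A := Fm.eq (Tm.v0.times Tm.zero) Tm.zero)
    ((Str.Env.nil _).cons a) fun n => HA.mul_zero _
  mul_succ a b := sat_of_HA hLEM
    (A := Fm.eq (Tm.v1.times Tm.v0.suc) ((Tm.v1.times Tm.v0).plus Tm.v1))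
    (((Str.Env.nil _).cons a).cons b) fun n => HA.mul_succ _ _
  proj_eq s t := E_of_HA _ _ _ fun n u => HA.proj _ _ u
  comb_eq r s t := E_of_HA _ _ _ fun n u => HA.comb _ _ _ u
  rec_zero y z := sat_of_HA hLEM (A := Fm.eq (Tm.rec0 Tm.zero Tm.v1 Tm.v0) Tm.v1)
    (((Str.Env.nil _).cons y).cons z) fun n => HA.rec_zero _ _
  rec_succ k y z := sat_of_HA hLEM (A := Fm.eq (Tm.rec0 Tm.v2.suc Tm.v1 Tm.v0)
      (Tm.app (Tm.app Tm.v0 (Tm.rec0 Tm.v2 Tm.v1 Tm.v0)) Tm.v2))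
    ((((Str.Env.nil _).cons k).cons y).cons z) fun n => HA.rec_succ _ _ _
  ind f g f' g' h0 h a := by
    let A : Fm V [Ty.nat, Ty.one, Ty.one, Ty.one, Ty.one] :=
      Fm.or (Fm.eq (Tm.app Tm.v1 Tm.v0) (Tm.app Tm.v2 Tm.v0))
        (Fm.eq (Tm.app (Tm.var Var.zero.succ.succ.succ) Tm.v0)
          (Tm.app (Tm.var Var.zero.succ.succ.succ.succ) Tm.v0))
    have := sat_of_HA (H := H) (hHA := hHA) hLEM (A := Fm.imp (Fm.and (A.inst Tm.zero)
      (Fm.all hV (Fm.imp A (A.subst (Sub.cons (Sub.shift _ Ty.nat) Tm.v0.suc))))) (Fm.all hV A))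
      (((((Str.Env.nil _).cons g').cons f').cons g).cons f) (fun n => by
        simp only [Fm.subst, Fm.inst_subst, Fm.step_subst]
        exact HA.induction hV _ ⟨trivial, trivial⟩)
    exact this ⟨h0, h⟩ a

end HenkinChain

/-- Completeness: classical theories with the axioms of arithmetic have term models. -/
theorem exists_model {V : Ty → Prop} {T : Theory V} (hHA : ∀ Γ A, HA V Γ A → A ∈ T Γ)
    (hLEM : ∀ Γ A, LEM V Γ A → A ∈ T Γ) (hV : V Ty.nat) (φ : Fm V []) (h : ¬ Provable T φ) :
    ∃ M : Str, M.IsModel V ∧ ¬ M.Sat (Str.Env.nil M) φ := by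
  obtain ⟨H, hH⟩ := exists_henkinChain (T := T) hV φ.neg fun hd =>
    h (Der.orE (Der.ax (hLEM _ _ (LEM.mk φ))) (Der.hyp (List.mem_cons_self ..)) (Der.botE hd))
  refine ⟨H.str hHA, HenkinChain.str_isModel hLEM hV, ?_⟩
  have hs : (H.str hHA).Sat (Str.Env.nil _) φ.neg := by
    rw [← HenkinChain.holds_iff_sat hLEM]
    have hn : ∀ n, HenkinChain.envSub (Str.Env.nil (H.str hHA)) n = Sub.nil _ := fun n => by
      funext σ v
      cases v
    simp only [hn]
    exact ⟨0, HenkinChain.mem_of_le (φ := fun n => φ.neg.subst (Sub.nil _)) (N := 0)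
      (fun n _ => by
        rw [Fm.subst_subst]
        congr 1
        funext σ v
        cases v) le_rfl hH⟩
  exact hs

end FiniteType

namespace FiniteType

namespace Str

variable {M : Str}

/-! ### Sequential forms in extensional models -/

theorem sat_mono (M : Str) {V W : Ty → Prop} (h : ∀ σ, V σ → W σ) {Γ : List Ty} (A : Fm V Γ) :
    ∀ e : M.Env Γ, M.Sat e (A.mono h) ↔ M.Sat e A := by
  induction A with
  | eq a b => exact fun e => Iff.rfl
  | bot => exact fun e => Iff.rfl
  | and A B hA hB => exact fun e => and_congr (hA e) (hB e)
  | or A B hA hB => exact fun e => or_congr (hA e) (hB e)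
  | imp A B hA hB => exact fun e => imp_congr (hA e) (hB e)
  | all h A hA => exact fun e => forall_congr' fun a => hA _
  | ex h A hA => exact fun e => exists_congr fun a => hA _

namespace IsExt

theorem eval_lam (hM : M.IsExt) {Γ : List Ty} {σ τ : Ty} (t : Tm (σ :: Γ) τ) (e : M.Env Γ)
    (d : M.D σ) : M.app (M.eval e t.lam) d = M.eval (e.cons d) t := by
  induction t with
  | var v =>
    cases v with
    | zero => exact (hM.comb_eq _ _ _).trans (hM.proj_eq _ _)
    | succ v => exact hM.proj_eq _ _
  | app f a hf ha =>
    refine (hM.comb_eq _ _ _).trans ?_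
    rw [hf, ha]
    rfl
  | _ => exact hM.proj_eq _ _

theorem sat_seqForm (hM : M.IsExt) {ρ τ : Ty} {A : Fm AnyType [τ, ρ]} (hA : (allEx A).Gamma1)
    (h : Provable I0 (allEx A)) : M.Sat (Env.nil M) (seqForm A) := by
  obtain ⟨t, ht⟩ := hM.exists_choice hA h
  intro x
  refine ⟨M.app (M.app (M.comb _ _ _) (M.app (M.proj _ _) t)) x, fun n => ?_⟩
  rw [sat_subst, Env.sub_cons, Env.sub_cons]
  have hn := ht (M.app x n)
  have : M.app (M.app (M.app (M.comb _ _ _) (M.app (M.proj _ _) t)) x) n = M.app t (M.app x n) := by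
    rw [hM.comb_eq, hM.proj_eq]
  rw [← this] at hn
  rw [Env.eq_nil (Env.sub _ _)]
  exact hn

theorem eval_row (hM : M.IsExt) {Γ : List Ty} (X : Tm Γ Ty.one) (n : Tm Γ Ty.nat) (e : M.Env Γ)
    (m : M.D Ty.nat) : M.app (M.eval e (X.row n)) m =
      M.app (M.eval e X) (M.eval (e.cons m) (Tm.pair (n.weaken Ty.nat) Tm.v0)) := by
  rw [Tm.row, hM.eval_lam]
  simp only [eval, eval_weaken, Env.tail_cons]

theorem sat_seqForm2 (hM : M.IsExt) {A : Fm SecondOrder [Ty.one, Ty.one]}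
    (hA : (allEx2 A).toAny.Gamma1) (h : Provable I0 (allEx2 A).toAny) :
    M.Sat (Env.nil M) (seqForm2 A) := by
  obtain ⟨t, ht⟩ := hM.exists_choice (A := A.toAny) hA h
  obtain ⟨p, q, hpq⟩ : ∃ p q : M.D Ty.one, ∀ (e : M.Env [Ty.nat, Ty.nat]),
      M.app p (M.eval e (Tm.pair Tm.v1 Tm.v0)) = e _ Var.zero.succ ∧
      M.app q (M.eval e (Tm.pair Tm.v1 Tm.v0)) = e _ Var.zero := by
    let _ := hM.model.arith trivial
    obtain ⟨p, hp⟩ := Arith.F1_unpairFst (N := M.N)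
    obtain ⟨q, hq⟩ := Arith.F1_unpairSnd (N := M.N)
    have hv : ∀ e : M.Env [Ty.nat, Ty.nat], M.val (M.eval e (Tm.pair Tm.v1 Tm.v0)) =
        Arith.pair (M.val (e _ Var.zero.succ)) (M.val (e _ Var.zero)) := fun e =>
      (hM.model.val_add trivial _ _).trans (congrArg (· + M.val (e _ Var.zero.succ))
        ((hM.model.val_mul trivial _ _).trans (congrArg₂ (· * ·)
          (hM.model.val_add trivial _ _) (hM.model.val_add trivial _ _))))
    exact ⟨p, q, fun e => ⟨hM.val_inj ((hp _).trans ((congrArg _ (hv e)).trans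
      (Arith.unpairFst_pair _ _))), hM.val_inj ((hq _).trans ((congrArg _ (hv e)).trans
      (Arith.unpairSnd_pair _ _)))⟩⟩
  intro X
  obtain ⟨x, -, hx⟩ := hM.lam (Def.eval (M := M) (Γ := [Ty.nat, Ty.one]) (Tm.row Tm.v1 Tm.v0))
  obtain ⟨Y, -, hY⟩ := hM.lam (f := fun e : M.Env [Ty.nat] =>
    M.app (M.app t (M.app (x ((Env.nil M).cons X)) (M.app p (e _ Var.zero))))
      (M.app q (e _ Var.zero)))
    ((((Def.const t).app ((Def.const _).app ((Def.const p).app (Def.var Var.zero))))).app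
      ((Def.const q).app (Def.var Var.zero)))
  refine ⟨Y (Env.nil M), fun n => ?_⟩
  rw [sat_subst, Env.sub_cons, Env.sub_cons, Env.eq_nil (Env.sub _ _)]
  have hX : M.eval ((((Env.nil M).cons X).cons (Y (Env.nil M))).cons n) (Tm.row Tm.v2 Tm.v0) =
      M.app (x ((Env.nil M).cons X)) n := by
    rw [hx]
    refine hM.funext fun m => ?_
    rw [hM.eval_row, hM.eval_row]
    rfl
  have hY' : M.eval ((((Env.nil M).cons X).cons (Y (Env.nil M))).cons n) (Tm.row Tm.v1 Tm.v0) =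
      M.app t (M.app (x ((Env.nil M).cons X)) n) := by
    refine hM.funext fun m => ?_
    rw [hM.eval_row]
    have e1 := hpq (((Env.nil M).cons n).cons m)
    refine (hY (Env.nil M) _).trans ?_
    exact congrArg₂ (fun a b => M.app (M.app t (M.app (x ((Env.nil M).cons X)) a)) b) e1.1 e1.2
  rw [hX, hY', ← sat_mono M (fun σ _ => anyType σ)]
  exact ht _

end IsExt

/-! ### The extensional quotient of a model -/

def extSetoid (M : Str) (σ : Ty) : Setoid (M.D σ) where
  r := M.E σ
  iseqv := ⟨E.refl, E.symm, E.trans⟩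

theorem IsModel.app_congr (hM : M.IsModel AnyType) {σ τ : Ty} {f g : M.D (Ty.arr σ τ)}
    {a b : M.D σ} (hf : M.E (Ty.arr σ τ) f g) (ha : M.E σ a b) :
    M.E τ (M.app f a) (M.app g b) :=
  have hArgs : ∀ σ, ArgsIn AnyType σ := fun σ => by
    induction σ with
    | nat => trivial
    | arr _ _ _ ih => exact ⟨trivial, ih⟩
  E.trans (hM.ext (hArgs _) (hArgs _) a b f ha) (hf b)

/-- The extensional quotient. -/
def IsModel.quot (hM : M.IsModel AnyType) : Str where
  D σ := Quotient (M.extSetoid σ)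
  N := M.N
  val := Quotient.lift M.val fun _ _ h => h
  app {σ τ} := Quotient.map₂ (sa := M.extSetoid (Ty.arr σ τ)) (sb := M.extSetoid σ)
    (sc := M.extSetoid τ) M.app fun _ _ hf _ _ ha => hM.app_congr hf ha
  zero := Quotient.mk _ M.zero
  succ := Quotient.mk _ M.succ
  add := Quotient.mk _ M.add
  mul := Quotient.mk _ M.mul
  proj ρ τ := Quotient.mk _ (M.proj ρ τ)
  comb δ ρ τ := Quotient.mk _ (M.comb δ ρ τ)
  recr := Quotient.mk _ M.recr

namespace IsModel

def quotMk (hM : M.IsModel AnyType) {σ : Ty} (a : M.D σ) : hM.quot.D σ :=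
  Quotient.mk (M.extSetoid σ) a

theorem quotMk_surj (hM : M.IsModel AnyType) {σ : Ty} (a : hM.quot.D σ) :
    ∃ b, a = hM.quotMk b := by
  obtain ⟨b, rfl⟩ := Quotient.exists_rep a
  exact ⟨b, rfl⟩

theorem quot_E (hM : M.IsModel AnyType) (σ : Ty) : ∀ a b : M.D σ,
    hM.quot.E σ (hM.quotMk a) (hM.quotMk b) ↔ M.E σ a b := by
  induction σ with
  | nat => exact fun a b => Iff.rfl
  | arr σ τ _ ih =>
    refine fun f g => ⟨fun h a => (ih _ _).1 (h (hM.quotMk a)), fun h a => ?_⟩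
    obtain ⟨a, rfl⟩ := hM.quotMk_surj a
    exact (ih _ _).2 (h a)

theorem quot_isExt (hM : M.IsModel AnyType) : hM.quot.IsExt where
  eq_of_E {σ f g} h := by
    obtain ⟨f, rfl⟩ := hM.quotMk_surj f
    obtain ⟨g, rfl⟩ := hM.quotMk_surj g
    exact Quotient.sound ((hM.quot_E σ f g).1 h)
  model :=
    { val_surj := fun x => by
        obtain ⟨a, rfl⟩ := hM.val_surj x
        exact ⟨hM.quotMk a, rfl⟩
      ext := fun {ρ τ} hρ hτ s t r h => by
        obtain ⟨s, rfl⟩ := hM.quotMk_surj s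
        obtain ⟨t, rfl⟩ := hM.quotMk_surj t
        obtain ⟨r, rfl⟩ := hM.quotMk_surj r
        exact (hM.quot_E _ _ _).2 (hM.ext hρ hτ s t r ((hM.quot_E _ _ _).1 h))
      succ_ne_zero := by rintro ⟨a⟩; exact hM.succ_ne_zero a
      succ_inj := by rintro ⟨a⟩ ⟨b⟩; exact hM.succ_inj a b
      add_zero := by rintro ⟨a⟩; exact hM.add_zero a
      add_succ := by rintro ⟨a⟩ ⟨b⟩; exact hM.add_succ a b
      mul_zero := by rintro ⟨a⟩; exact hM.mul_zero a
      mul_succ := by rintro ⟨a⟩ ⟨b⟩; exact hM.mul_succ a b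
      proj_eq := by rintro ρ τ ⟨a⟩ ⟨b⟩; exact (hM.quot_E _ _ _).2 (hM.proj_eq a b)
      comb_eq := by
        rintro δ ρ τ ⟨a⟩ ⟨b⟩ ⟨c⟩
        exact (hM.quot_E _ _ _).2 (hM.comb_eq a b c)
      rec_zero := by rintro ⟨a⟩ ⟨b⟩; exact hM.rec_zero a b
      rec_succ := by rintro ⟨a⟩ ⟨b⟩ ⟨c⟩; exact hM.rec_succ a b c
      ind := by
        rintro ⟨f⟩ ⟨g⟩ ⟨f'⟩ ⟨g'⟩ h0 h ⟨a⟩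
        exact hM.ind f g f' g' h0 (fun a => h (hM.quotMk a)) a }

theorem quot_eval (hM : M.IsModel AnyType) {Γ : List Ty} (e : M.Env Γ) {σ : Ty} (t : Tm Γ σ) :
    hM.quot.eval (fun σ v => hM.quotMk (e σ v)) t = hM.quotMk (M.eval e t) := by
  induction t with
  | app f a hf ha =>
    rw [eval, hf, ha]
    rfl
  | _ => rfl

theorem quot_cons (hM : M.IsModel AnyType) {Γ : List Ty} (e : M.Env Γ) {ρ : Ty} (d : M.D ρ) :
    Env.cons (M := hM.quot) (fun σ v => hM.quotMk (e σ v)) (hM.quotMk d) =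
      fun σ v => hM.quotMk (e.cons d σ v) := by
  funext σ v
  cases v <;> rfl

theorem quot_sat (hM : M.IsModel AnyType) {V : Ty → Prop} {Γ : List Ty} (A : Fm V Γ) :
    ∀ e : M.Env Γ, hM.quot.Sat (fun σ v => hM.quotMk (e σ v)) A ↔ M.Sat e A := by
  induction A with
  | eq a b =>
    intro e
    rw [Sat, quot_eval, quot_eval]
    rfl
  | bot => exact fun e => Iff.rfl
  | and A B hA hB => exact fun e => and_congr (hA e) (hB e)
  | or A B hA hB => exact fun e => or_congr (hA e) (hB e)
  | imp A B hA hB => exact fun e => imp_congr (hA e) (hB e)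
  | all h A hA =>
    refine fun e => ⟨fun h d => ?_, fun h d => ?_⟩
    · rw [← hA, ← quot_cons]
      exact h _
    · obtain ⟨d, rfl⟩ := hM.quotMk_surj d
      rw [quot_cons, hA]
      exact h d
  | ex h A hA =>
    refine fun e => ⟨fun ⟨d, h⟩ => ?_, fun ⟨d, h⟩ => ⟨hM.quotMk d, ?_⟩⟩
    · obtain ⟨d, rfl⟩ := hM.quotMk_surj d
      rw [quot_cons, hA] at h
      exact ⟨d, h⟩
    · rw [quot_cons, hA]
      exact h

end IsModel

end Str

end FiniteType

namespace FiniteType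

open Arith

/-! ### The extensional model over an arithmetic -/

/-- A set with a class of sequences that is to be preserved by the functions of a model. -/
structure Plotted (N : Type) where
  carrier : Type
  plot : (N → carrier) → Prop

/-- The functions of finite type that preserve plots; the plots of type `0` are the unary
functions of the arithmetic. -/
def plotted (N : Type) [Arith N] : Ty → Plotted N
  | Ty.nat => ⟨N, F1⟩
  | Ty.arr σ τ =>
    ⟨{f : (plotted N σ).carrier → (plotted N τ).carrier //
        ∀ x, (plotted N σ).plot x → (plotted N τ).plot fun k => f (x k)},
      fun f => ∀ α, F1 α → ∀ x, (plotted N σ).plot x →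
        (plotted N τ).plot fun k => (f (α k)).1 (x k)⟩

section

variable {N : Type} [Arith N]

theorem plot_const : ∀ {σ : Ty} (c : (plotted N σ).carrier), (plotted N σ).plot fun _ => c
  | Ty.nat, c => F1_const (N := N) c
  | Ty.arr _ _, f => fun _ _ x hx => f.2 x hx

theorem plot_comp : ∀ {σ : Ty} {x : N → (plotted N σ).carrier} {α : N → N},
    (plotted N σ).plot x → F1 α → (plotted N σ).plot fun k => x (α k)
  | Ty.nat, _, _, hx, hα => F1_comp1 (N := N) hx hα
  | Ty.arr _ _, _, _, hf, hα => fun _ hβ x hx => hf _ (F1_comp1 hα hβ) x hx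

theorem plot_app {σ τ : Ty} {f : N → (plotted N (Ty.arr σ τ)).carrier}
    {x : N → (plotted N σ).carrier} (hf : (plotted N (Ty.arr σ τ)).plot f)
    (hx : (plotted N σ).plot x) : (plotted N τ).plot fun k => (f k).1 (x k) :=
  hf _ F1_id x hx

theorem F2_uncurry (z : (plotted N (Ty.arr Ty.nat Ty.one)).carrier) :
    F2 fun a b : N => (z.1 a).1 b := by
  have h : F1 fun k : N => (z.1 (unpairFst (N := N) k)).1 (unpairSnd (N := N) k) :=
    plot_app (σ := Ty.nat) (τ := Ty.nat) (z.2 _ (F1_unpairFst (N := N)))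
      (F1_unpairSnd (N := N))
  simpa using F2_comp1 h F2_pair

/-- Iteration of a function of the model. -/
noncomputable def plotRec (z : (plotted N (Ty.arr Ty.nat Ty.one)).carrier) : N → N → N :=
  (exists_rec (F2_uncurry z)).choose

theorem F2_plotRec (z : (plotted N (Ty.arr Ty.nat Ty.one)).carrier) : F2 (plotRec z) :=
  (exists_rec (F2_uncurry z)).choose_spec.1

theorem plotRec_zero (z : (plotted N (Ty.arr Ty.nat Ty.one)).carrier) (y : N) :
    plotRec z 0 y = y :=
  (exists_rec (F2_uncurry z)).choose_spec.2.1 y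

theorem plotRec_add_one (z : (plotted N (Ty.arr Ty.nat Ty.one)).carrier) (n y : N) :
    plotRec z (n + 1) y = (z.1 (plotRec (N := N) z n y)).1 n :=
  (exists_rec (F2_uncurry z)).choose_spec.2.2 n y

theorem F1_pair {f g : N → N} (hf : F1 f) (hg : F1 g) : F1 fun k => pair (f k) (g k) :=
  F1_comp2 F2_pair hf hg

theorem F1_plotRec {z : N → (plotted N (Ty.arr Ty.nat Ty.one)).carrier} {n y : N → N}
    (hz : (plotted N (Ty.arr Ty.nat Ty.one)).plot z) (hn : F1 n) (hy : F1 y) :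
    F1 fun k => plotRec (z k) (n k) (y k) := by
  have hw : F1 fun j : N => ((z (unpairFst j)).1 (unpairFst (N := N) (unpairSnd j))).1
      (unpairSnd (N := N) (unpairSnd j)) :=
    plot_app (σ := Ty.nat) (τ := Ty.nat) (plot_app (σ := Ty.nat) (τ := Ty.one)
      (plot_comp hz F1_unpairFst) (F1_comp1 (N := N) F1_unpairFst F1_unpairSnd))
      (F1_comp1 (N := N) F1_unpairSnd F1_unpairSnd)
  have hfst : F2 fun s _ : N => unpairFst s := F2_comp1 F1_unpairFst F2_fst
  have hsnd : F2 fun s _ : N => unpairSnd s := F2_comp1 F1_unpairSnd F2_fst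
  have hh := F2_comp2 F2_pair hfst
    (F2_comp1 hw (F2_comp2 F2_pair hfst (F2_comp2 F2_pair hsnd F2_snd)))
  simp only [unpairFst_pair, unpairSnd_pair] at hh
  obtain ⟨R, hR, hR0, hR1⟩ := exists_rec hh
  have key : ∀ k y n, R n (pair k y) = pair k (plotRec (z k) n y) := fun k y n =>
    induct (F2_left hR (pair k y)) (F1_pair (F1_const k) (F2_left (F2_plotRec (z k)) y))
      (by rw [hR0, plotRec_zero])
      (fun n ih => by rw [hR1, ih, plotRec_add_one, unpairFst_pair, unpairSnd_pair]) n
  have := F1_comp1 F1_unpairSnd (F1_comp2 hR hn (F1_pair F1_id hy))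
  simpa only [key, unpairSnd_pair] using this

variable (N) in
/-- The structure of the functions that preserve plots. -/
noncomputable def plotStr : Str where
  D σ := (plotted N σ).carrier
  N := N
  val a := a
  app f a := f.1 a
  zero := (0 : N)
  succ := ⟨fun x : N => x + 1, fun _ hx => F1_add (N := N) hx (F1_const 1)⟩
  add := ⟨fun x : N => ⟨fun y : N => x + y, fun _ hy => F1_add (N := N) (F1_const x) hy⟩,
    fun _ hx _ hα _ hy => F1_add (N := N) (F1_comp1 (N := N) hx hα) hy⟩
  mul := ⟨fun x : N => ⟨fun y : N => x * y, fun _ hy => F1_mul (N := N) (F1_const x) hy⟩,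
    fun _ hx _ hα _ hy => F1_mul (N := N) (F1_comp1 (N := N) hx hα) hy⟩
  proj _ _ := ⟨fun s => ⟨fun _ => s, fun _ _ => plot_const s⟩,
    fun _ hs _ hα _ _ => plot_comp hs hα⟩
  comb _ _ _ := ⟨fun r => ⟨fun s => ⟨fun t => (r.1 t).1 (s.1 t),
        fun t ht => plot_app (r.2 t ht) (s.2 t ht)⟩,
      fun s hs α hα t ht => plot_app (f := fun k => r.1 (t k)) (x := fun k => (s (α k)).1 (t k))
        (r.2 t ht) (plot_app (plot_comp hs hα) ht)⟩,
    fun r hr α hα s hs β hβ t ht => plot_app (f := fun k => (r (α (β k))).1 (t k))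
      (x := fun k => (s (β k)).1 (t k)) (plot_app (plot_comp hr (F1_comp1 hα hβ)) ht)
      (plot_app (plot_comp hs hβ) ht)⟩
  recr := ⟨fun n : N => ⟨fun y : N => ⟨fun z => plotRec (N := N) z n y,
        fun _ hz => F1_plotRec (N := N) hz (F1_const n) (F1_const y)⟩,
      fun _ hy _ hα _ hz => F1_plotRec (N := N) hz (F1_const n) (F1_comp1 (N := N) hy hα)⟩,
    fun _ hn _ hα _ hy _ hβ _ hz => F1_plotRec (N := N) hz
      (F1_comp1 (N := N) hn (F1_comp1 hα hβ)) (F1_comp1 (N := N) hy hβ)⟩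

theorem plotStr_eq_of_E : ∀ {σ : Ty} {f g : (plotStr N).D σ}, (plotStr N).E σ f g → f = g
  | Ty.nat, _, _, h => h
  | Ty.arr _ _, _, _, h => Subtype.ext (funext fun a => plotStr_eq_of_E (h a))

theorem plotStr_isExt : (plotStr N).IsExt where
  eq_of_E := plotStr_eq_of_E
  model :=
    { val_surj := fun a => ⟨a, rfl⟩
      ext := fun _ _ s t r h => by
        rw [plotStr_eq_of_E h]
        exact Str.E.refl _
      succ_ne_zero := add_one_ne_zero (N := N)
      succ_inj := fun _ _ h => add_one_inj (N := N) h
      add_zero := add_zero (M := N)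
      add_succ := fun a b => (add_assoc (G := N) a b 1).symm
      mul_zero := mul_zero (M₀ := N)
      mul_succ := fun a b => (mul_add (R := N) a b 1).trans
        (congrArg (plus (times (N := N) a b)) (mul_one (M := N) a))
      proj_eq := fun _ _ => Str.E.refl _
      comb_eq := fun _ _ _ => Str.E.refl _
      rec_zero := fun y z => plotRec_zero (N := N) z y
      rec_succ := fun n y z => plotRec_add_one (N := N) z n y
      ind := fun f g f' g' h0 h => ind_or (N := N) (f.2 _ F1_id) (g.2 _ F1_id) (f'.2 _ F1_id)
        (g'.2 _ F1_id) h0 fun x hx => by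
          rw [s_eq]
          exact h x hx }

end

/-! ### Comparison with second order models -/

namespace Str

variable {M : Str} {V : Ty → Prop}

/-- The logical relation between a structure and the plot preserving functions over its numbers. -/
def Rel [Arith M.N] : (σ : Ty) → M.D σ → (plotted M.N σ).carrier → Prop
  | Ty.nat, a, d => M.val a = d
  | Ty.arr σ τ, f, F => ∀ a d, Rel σ a d → Rel τ (M.app f a) (F.1 d)

theorem Rel.congr [Arith M.N] : ∀ {σ : Ty} {a b : M.D σ} {d : (plotted M.N σ).carrier},
    M.E σ a b → Rel σ b d → Rel σ a d
  | Ty.nat, _, _, _, h, h' => Eq.trans h h'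
  | Ty.arr _ _, _, _, _, h, h' => fun a d had => Rel.congr (h a) (h' a d had)

namespace IsModel

theorem rel_recr (hM : M.IsModel V) (hV : V Ty.nat) :
    let _ := hM.arith hV
    Rel _ M.recr (plotStr M.N).recr := by
  intro _ n n' hn y y' hy z z' hz
  obtain ⟨R, hR, hR'⟩ := hM.exists_F2_recr hV z
  have hzz : ∀ a b, M.val (M.app (M.app z a) b) = (z'.1 (M.val a)).1 (M.val b) :=
    fun a b => hz a _ rfl b _ rfl
  subst hn hy
  refine (hR' n y).trans (induct (N := M.N) (F2_left hR (M.val y))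
    (F2_left (F2_plotRec z') (M.val y)) ?_ (fun k ih => ?_) (M.val n))
  · rw [plotRec_zero, ← hM.val_zero hV, ← hR', hM.rec_zero]
  · obtain ⟨a, rfl⟩ := hM.val_surj k
    rw [plotRec_add_one, ← ih, ← hM.val_succ hV, ← hR', ← hR', hM.rec_succ]
    exact hzz _ _

theorem rel_eval (hM : M.IsModel V) (hV : V Ty.nat) {Γ : List Ty} {σ : Ty} (t : Tm Γ σ) :
    let _ := hM.arith hV
    ∀ (e : M.Env Γ) (e' : (plotStr M.N).Env Γ), (∀ σ v, Rel σ (e σ v) (e' σ v)) →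
      Rel σ (M.eval e t) ((plotStr M.N).eval e' t) := by
  intro _ e e' he
  induction t with
  | var v => exact he _ v
  | app f a hf ha => exact hf _ _ ha
  | zero => exact hM.val_zero hV
  | succ =>
    rintro a _ rfl
    exact hM.val_succ hV a
  | add =>
    rintro a _ rfl b _ rfl
    exact hM.val_add hV a b
  | mul =>
    rintro a _ rfl b _ rfl
    exact hM.val_mul hV a b
  | proj ρ τ => exact fun a _ ha b _ _ => Rel.congr (hM.proj_eq a b) ha
  | comb δ ρ τ =>
    exact fun r _ hr s _ hs t _ ht => Rel.congr (hM.comb_eq r s t) (hr _ _ ht _ _ (hs _ _ ht))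
  | recr => exact hM.rel_recr hV

theorem exists_rel_right (hM : M.IsModel V) (hV : V Ty.nat) {σ : Ty} (hσ : SecondOrder σ) :
    let _ := hM.arith hV
    ∀ a : M.D σ, ∃ d : (plotStr M.N).D σ, Rel σ a d := by
  intro _ a
  rcases hσ with rfl | rfl
  · exact ⟨M.val a, rfl⟩
  · obtain ⟨f, hf⟩ := hM.exists_F1 a
    refine ⟨⟨f, fun x hx => F1_comp1 (N := M.N) ⟨a, hf⟩ hx⟩, ?_⟩
    rintro b _ rfl
    exact hf b

theorem exists_rel_left (hM : M.IsModel V) (hV : V Ty.nat) {σ : Ty} (hσ : SecondOrder σ) :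
    let _ := hM.arith hV
    ∀ d : (plotStr M.N).D σ, ∃ a : M.D σ, Rel σ a d := by
  intro _ d
  rcases hσ with rfl | rfl
  · exact hM.val_surj d
  · obtain ⟨a, ha⟩ : M.F1 d.1 := d.2 _ (Arith.F1_id (N := M.N))
    refine ⟨a, ?_⟩
    rintro b _ rfl
    exact ha b

theorem rel_cons [Arith M.N] {Γ : List Ty} {ρ : Ty} {e : M.Env Γ} {e' : (plotStr M.N).Env Γ}
    (he : ∀ σ v, Rel σ (e σ v) (e' σ v)) {a : M.D ρ} {d : (plotStr M.N).D ρ} (h : Rel ρ a d)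
    (σ : Ty) (v : Var (ρ :: Γ) σ) : Rel σ (e.cons a σ v) (e'.cons d σ v) := by
  cases v with
  | zero => exact h
  | succ v => exact he _ v

theorem sat_iff_plotStr_sat (hM : M.IsModel V) (hV : V Ty.nat) {Γ : List Ty}
    (A : Fm SecondOrder Γ) :
    let _ := hM.arith hV
    ∀ (e : M.Env Γ) (e' : (plotStr M.N).Env Γ), (∀ σ v, Rel σ (e σ v) (e' σ v)) →
      (M.Sat e A ↔ (plotStr M.N).Sat e' A) := by
  intro _
  induction A with
  | eq a b =>
    intro e e' he
    have ha : M.val (M.eval e a) = _ := hM.rel_eval hV a e e' he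
    have hb : M.val (M.eval e b) = _ := hM.rel_eval hV b e e' he
    rw [Sat, ha, hb]
    rfl
  | bot => exact fun e e' he => Iff.rfl
  | and A B hA hB => exact fun e e' he => and_congr (hA e e' he) (hB e e' he)
  | or A B hA hB => exact fun e e' he => or_congr (hA e e' he) (hB e e' he)
  | imp A B hA hB => exact fun e e' he => imp_congr (hA e e' he) (hB e e' he)
  | all h A hA =>
    refine fun e e' he => ⟨fun H d => ?_, fun H a => ?_⟩
    · obtain ⟨a, ha⟩ := hM.exists_rel_left hV h d
      exact (hA _ _ (rel_cons he ha)).1 (H a)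
    · obtain ⟨d, hd⟩ := hM.exists_rel_right hV h a
      exact (hA _ _ (rel_cons he hd)).2 (H d)
  | ex h A hA =>
    refine fun e e' he => ⟨fun ⟨a, H⟩ => ?_, fun ⟨d, H⟩ => ?_⟩
    · obtain ⟨d, hd⟩ := hM.exists_rel_right hV h a
      exact ⟨d, (hA _ _ (rel_cons he hd)).1 H⟩
    · obtain ⟨a, ha⟩ := hM.exists_rel_left hV h d
      exact ⟨a, (hA _ _ (rel_cons he ha)).2 H⟩

end IsModel

end Str

end FiniteType

namespace FiniteType

theorem provable_seqForm {ρ τ : Ty} (A : Fm AnyType [τ, ρ]) (hA : (allEx A).Gamma1)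
    (h : Provable I0 (allEx A)) : Provable RCA0omega (seqForm A) := by
  by_contra hn
  obtain ⟨M, hM, hM'⟩ := exists_model (T := RCA0omega) (fun _ _ => Or.inl)
    (fun _ _ h => Or.inr (Or.inr h)) (anyType _) _ hn
  refine hM' ((hM.quot_sat _ _).1 ?_)
  rw [Str.Env.eq_nil (fun _ _ => _)]
  exact hM.quot_isExt.sat_seqForm hA h

theorem provable_seqForm2 (A : Fm SecondOrder [Ty.one, Ty.one]) (hA : (allEx2 A).toAny.Gamma1)
    (h : Provable I0 (allEx2 A).toAny) : Provable RCA0 (seqForm2 A) := by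
  by_contra hn
  obtain ⟨M, hM, hM'⟩ := exists_model (T := RCA0) (fun _ _ => Or.inl)
    (fun _ _ h => Or.inr (Or.inr h)) secondOrder_nat _ hn
  let _ := hM.arith secondOrder_nat
  exact hM' ((hM.sat_iff_plotStr_sat secondOrder_nat _ _ (Str.Env.nil _) nofun).2
    (plotStr_isExt.sat_seqForm2 hA h))

end FiniteType

theorem mainTheorem1 :
    (∀ (ρ τ : FiniteType.Ty) (A : FiniteType.Fm FiniteType.AnyType [τ, ρ]),
      (FiniteType.allEx A).Gamma1 →
      FiniteType.Provable FiniteType.I0 (FiniteType.allEx A) →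
      FiniteType.Provable FiniteType.RCA0omega (FiniteType.seqForm A)) ∧
    (∀ A : FiniteType.Fm FiniteType.SecondOrder [FiniteType.Ty.one, FiniteType.Ty.one],
      (FiniteType.allEx2 A).toAny.Gamma1 →
      FiniteType.Provable FiniteType.I0 (FiniteType.allEx2 A).toAny →
      FiniteType.Provable FiniteType.RCA0 (FiniteType.seqForm2 A)) :=
  ⟨fun _ _ => FiniteType.provable_seqForm, FiniteType.provable_seqForm2⟩
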